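/- Let $(W_t)_{t\ge 0}$ be a standard Wiener process and let $Y_1,Y_2,\ldots\ge 0$ be i.i.d. transmission times with $\mathbb{E}[Y_1^2]<\infty$, independent of $W$. A sampling policy is a sequence of random times $0=S_0\le S_1\le S_2\le\cdots$; sample $(S_i,W_{S_i})$ is sent over a work-conserving FIFO queue, so that it starts its transmission at $G_i=\max(S_i,D_{i-1})$ and is delivered at $D_i=G_i+Y_i$ for $i\ge1$, with $D_0=0$. The channel is busy at time $t$ if $S_j\le t<D_j$ for some $j$. The estimate is $\hat W_t=W_{S_i}$ for $t\in[D_i,D_{i+1})$, $i=0,1,2,\ldots$. Let $\Pi$ be the set of policies such that (i) (causality) each $S_i$ is, up to null events, a stopping time of the right-continuous filtration generated by the signal, by the previous sampling times $S_0,\ldots,S_{i-1}$, and by the idle/busy state of the channel resulting from the previous samples; (ii) the inter-sampling times $T_i=S_{i+1}-S_i$ are regenerative: there are integers $0\le k_1<k_2<\cdots$ such that, for each $j$, $(T_{k_j+i})_{i\ge0}$ has the same distribution as $(T_{k_1+i})_{i\ge0}$ and is independent of $(T_0,\ldots,T_{k_j-1})$, with $\mathbb{E}[S_{k_1}^2]<\infty$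 and $0<\mathbb{E}[(S_{k_{j+1}}-S_{k_j})^2]<\infty$. Fix $f_{\max}\in(0,\infty]$ and consider the problem of minimizing $$\mathrm{MSE}(\pi)=\limsup_{T\to\infty}\frac1T\,\mathbb{E}\left[\int_0^T(W_t-\hat W_t)^2\,dt\right]$$ over all $\pi\in\Pi$ that satisfy $\liminf_{n\to\infty}\frac1n\mathbb{E}[S_n]\ge \frac1{f_{\max}}$. Then taking a new sample before the previous sample is delivered is suboptimal, in the sense that nothing is lost by never doing so: for every policy $\pi\in\Pi$ that satisfies the constraint there is a policy $\pi'=(S'_0,S'_1,\ldots)\in\Pi$ that satisfies the constraint, that almost surely takes each sample only after the previous one has been delivered ($S'_i\ge D'_{i-1}$ for all $i\ge1$, where $D'_i$ are the delivery times under $\pi'$), and for which $\mathrm{MSE}(\pi')\le\mathrm{MSE}(\pi)$. -/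

import Mathlib

open MeasureTheory ProbabilityTheory Filter
open scoped NNReal ENNReal

namespace RemoteEstimation

variable {Ω : Type*}

/-- Delivery times `D i` of a work-conserving FIFO queue: `D 0 = 0`, and for `i ≥ 1` sample `i`,
generated at time `S i`, starts its transmission at `max (S i) (D (i - 1))` and needs the
transmission time `Y i`.  (`Y 0` is never used.) -/
def delivery (S Y : ℕ → Ω → ℝ≥0) : ℕ → Ω → ℝ≥0
  | 0, _ => 0
  | i + 1, ω => max (S (i + 1) ω) (delivery S Y i ω) + Y (i + 1) ω

/-- The event that, at time `t`, the channel is busy with samples of index `< i`, i.e. one of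
these samples has been generated but not yet delivered.  Strictly before time `S i` this is the
actual state of the channel, since no sample of index `≥ i` has been generated. -/
def busyBefore (S Y : ℕ → Ω → ℝ≥0) (i : ℕ) (t : ℝ≥0) : Set Ω :=
  {ω | ∃ j < i, S j ω ≤ t ∧ t < delivery S Y j ω}

/-- The information available at time `t` for choosing the sampling time `S i`: the signal and
the channel state on `[0, t]`, and the earlier sampling times as far as they have occurred. -/
@[reducible] def info (W : ℝ≥0 → Ω → ℝ) (S Y : ℕ → Ω → ℝ≥0) (i : ℕ) (t : ℝ≥0) : MeasurableSpace Ω :=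
  (⨆ s ≤ t, MeasurableSpace.comap (W s) inferInstance) ⊔
    MeasurableSpace.generateFrom {A | ∃ s ≤ t, A = busyBefore S Y i s} ⊔
    MeasurableSpace.generateFrom {A | ∃ s ≤ t, ∃ j < i, A = {ω | S j ω ≤ s}}

/-- The right-continuous version of `info`. -/
@[reducible] def infoPlus (W : ℝ≥0 → Ω → ℝ) (S Y : ℕ → Ω → ℝ≥0) (i : ℕ) (t : ℝ≥0) : MeasurableSpace Ω :=
  ⨅ u > t, info W S Y i u

/-- Inter-sampling times `T i = S (i + 1) - S i`. -/
def interSampling (S : ℕ → Ω → ℝ≥0) (i : ℕ) (ω : Ω) : ℝ≥0 := S (i + 1) ω - S i ω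

variable [MeasurableSpace Ω]

/-- Each `S i` is a stopping time of the information available for choosing it
(up to `P`-null sets). -/
def IsCausal (P : Measure Ω) (W : ℝ≥0 → Ω → ℝ) (Y S : ℕ → Ω → ℝ≥0) : Prop :=
  ∀ i t, ∃ A : Set Ω, MeasurableSet[infoPlus W S Y i t] A ∧ {ω | S i ω ≤ t} =ᵐ[P] A

/-- The inter-sampling times form a regenerative process with square-integrable cycles; the
regeneration indices are the deterministic integers `k 0 < k 1 < ⋯`.  (The differences in `ℝ≥0`
are genuine, since `S` is nondecreasing in the index.) -/
def IsRegenerative (P : Measure Ω) (S : ℕ → Ω → ℝ≥0) : Prop :=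
  ∃ k : ℕ → ℕ, StrictMono k ∧
    (∀ j, IdentDistrib (fun ω i => interSampling S (k j + i) ω)
      (fun ω i => interSampling S (k 0 + i) ω) P P) ∧
    (∀ j, IndepFun (fun ω (i : ℕ) => interSampling S (k j + i) ω)
      (fun ω (i : Fin (k j)) => interSampling S i ω) P) ∧
    ∫⁻ ω, (S (k 0) ω : ℝ≥0∞) ^ 2 ∂P < ∞ ∧
    ∀ j, 0 < ∫⁻ ω, ((S (k (j + 1)) ω - S (k j) ω : ℝ≥0) : ℝ≥0∞) ^ 2 ∂P ∧
      ∫⁻ ω, ((S (k (j + 1)) ω - S (k j) ω : ℝ≥0) : ℝ≥0∞) ^ 2 ∂P < ∞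

/-- The class `Π` of causal sampling policies `0 = S 0 ≤ S 1 ≤ S 2 ≤ ⋯`. -/
structure IsPolicy (P : Measure Ω) (W : ℝ≥0 → Ω → ℝ) (Y S : ℕ → Ω → ℝ≥0) : Prop where
  measurable : ∀ i, Measurable (S i)
  zero : ∀ᵐ ω ∂P, S 0 ω = 0
  mono : ∀ᵐ ω ∂P, ∀ i, S i ω ≤ S (i + 1) ω
  causal : IsCausal P W Y S
  regenerative : IsRegenerative P S

/-- No sample is generated before the previous sample has been delivered. -/
def NeverSamplesBusy (P : Measure Ω) (Y S : ℕ → Ω → ℝ≥0) : Prop :=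
  ∀ᵐ ω ∂P, ∀ i, delivery S Y i ω ≤ S (i + 1) ω

/-- The sampling frequency constraint `liminf E[S n] / n ≥ 1 / fmax`, with `fmax = ∞` allowed. -/
def FrequencyConstraint (P : Measure Ω) (fmax : ℝ≥0∞) (S : ℕ → Ω → ℝ≥0) : Prop :=
  1 / fmax ≤ liminf (fun n : ℕ => (∫⁻ ω, (S n ω : ℝ≥0∞) ∂P) / (n : ℝ≥0∞)) atTop

/-- Index of the freshest sample delivered by time `t`: the `i` with `t ∈ [D i, D (i + 1))`. -/
noncomputable def freshest (Y S : ℕ → Ω → ℝ≥0) (t : ℝ≥0) (ω : Ω) : ℕ :=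
  sSup {i | delivery S Y i ω ≤ t}

/-- The estimate `Ŵ t = W (S i)` for `t ∈ [D i, D (i + 1))`. -/
noncomputable def estimate (W : ℝ≥0 → Ω → ℝ) (Y S : ℕ → Ω → ℝ≥0) (t : ℝ≥0) (ω : Ω) : ℝ :=
  W (S (freshest Y S t ω) ω) ω

/-- The long-run mean square estimation error
`limsup (1 / T) E ∫₀ᵀ (W t - Ŵ t)² dt` as `T → ∞`, with values in `[0, ∞]`. -/
noncomputable def mse (P : Measure Ω) (W : ℝ≥0 → Ω → ℝ) (Y S : ℕ → Ω → ℝ≥0) : ℝ≥0∞ :=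
  limsup (fun T : ℝ =>
    (∫⁻ ω, (∫⁻ t : ℝ in Set.Icc 0 T,
      ENNReal.ofReal ((W t.toNNReal ω - estimate W Y S t.toNNReal ω) ^ 2)) ∂P) /
      ENNReal.ofReal T) atTop

end RemoteEstimation

/-! One policy is exhibited that is optimal among all admissible ones and never samples a busy
channel; the given policy is compared with it through a number, not by modification. Write m = E[Y],
A = E[max(W_Y², β)] and B = E[max(W_Y², β)²], where W_Y is the displacement of the signal during one
transmission. For a suitable β > 0 every admissible policy has mean square error at least m + B/(6A)
(`le_mse`). The threshold policy, which samples once the previous sample is delivered and the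
squared deviation from it exceeds β, has at most this error (`Model.mse_threshold_le`).

Lower bound. Time is cut at the deliveries. A stage consists of a wait, of length w, and a
transmission; let y and z be the deviations from the held sample at the two ends of the wait. The
wait costs E[z⁴ − y⁴]/6, and E[z² − y²] = E[w]. The transmission time is independent of the past, so
the transmission costs m E[z²] + E[Y²]/2. Pricing the wait at β/3 per unit of time leaves a stopping
problem with terminal cost z⁴/6 − βz²/3. Its value is bounded below by the convex minorant of this
cost, which lies below it by ((β − y²)⁺)²/6 (`tangent_le`, `Sandwich.gap_le_wait`).

This is where premature sampling matters. At a delivery, y is the displacement between sampling and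
start of transmission plus a centred Gaussian displacement during the transmission. A nonzero first
part does not lower E[y²] (`Timed.le_integral_sq`), and by Anderson's inequality it does not raise
the expected deficit E[((β − y²)⁺)²] (`lintegral_gap_shift_le`, `Timed.integral_gap_le`). So every
stage is bounded as if its sample had been fresh when its transmission started. Summation bounds the
error up to T below by (β/3 + m)T − cN, up to truncation and to terms that stay bounded along
suitable T → ∞. Here c = (2βA − B)/6 is the net price of a sample and N the expected number of
samples. Regeneration bounds N/T asymptotically by d/μ, for cycles of d samples and mean length μ,
and the frequency constraint gives d/μ ≤ f_max. The threshold β is chosen with c ≥ 0, A ≥ 1/f_max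
and equality in one of the two (`exists_threshold`); in either case the bound becomes m + B/(6A).

Upper bound. By the strong Markov property the cycles of the threshold policy are i.i.d. Its waits
end with z² = max(y², β), so a cycle has mean length at least A and costs at most B/6 + Am; a
renewal argument gives the ratio.

No stochastic integral is used: the moment identities on [σ, τ] follow by comparing σ and τ with a
later time θ that is known at σ (`Sandwich`). If Y = 0 almost surely, every policy already avoids
the busy channel. In the other case the signal is first altered on a null set to make all paths
regular (`exists_model`). -/

namespace RemoteEstimation

open Topology

/-! ### Brownian motion relative to a filtration; the strong Markov property -/

section BrownianFiltration

variable {Ω : Type*} {mΩ : MeasurableSpace Ω} {P : Measure Ω}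
  {𝓖 : Filtration ℝ≥0 mΩ} {W : ℝ≥0 → Ω → ℝ}

/-- The finite random time `τ` is a stopping time of `𝓖`. -/
abbrev Stops (𝓖 : Filtration ℝ≥0 mΩ) (τ : Ω → ℝ≥0) : Prop :=
  IsStoppingTime 𝓖 (fun ω => WithTop.some (τ ω))

/-- `W` is a continuous Brownian motion relative to the filtration `𝓖`. -/
structure IsBM (P : Measure Ω) (𝓖 : Filtration ℝ≥0 mΩ) (W : ℝ≥0 → Ω → ℝ) : Prop where
  cont : ∀ ω, Continuous (W · ω)
  zero : ∀ ω, W 0 ω = 0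
  adapted : ∀ t, Measurable[𝓖 t] (W t)
  pre : IsPreBrownianReal W P
  indep : ∀ s u, s < u →
    Indep (𝓖 s) (MeasurableSpace.comap (fun ω t => W (u + t) ω - W u ω) inferInstance) P

/-- The increments of `W` after the random time `τ`. -/
def incr (W : ℝ≥0 → Ω → ℝ) (τ : Ω → ℝ≥0) (ω : Ω) (t : ℝ≥0) : ℝ := W (τ ω + t) ω - W (τ ω) ω

lemma Stops.measurableSet_le {τ : Ω → ℝ≥0} (h : Stops 𝓖 τ) (t : ℝ≥0) :
    MeasurableSet[𝓖 t] {ω | τ ω ≤ t} := by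
  simpa only [WithTop.coe_le_coe] using IsStoppingTime.measurableSet_le h t

lemma Stops.measurableSet_lt {τ : Ω → ℝ≥0} (h : Stops 𝓖 τ) (t : ℝ≥0) :
    MeasurableSet[𝓖 t] {ω | τ ω < t} := by
  simpa only [WithTop.coe_lt_coe] using IsStoppingTime.measurableSet_lt h t

lemma stops_iff {τ : Ω → ℝ≥0} : Stops 𝓖 τ ↔ ∀ t, MeasurableSet[𝓖 t] {ω | τ ω ≤ t} := by
  simp only [Stops, IsStoppingTime, WithTop.coe_le_coe]

lemma Stops.measurable_past {τ : Ω → ℝ≥0} (h : Stops 𝓖 τ) :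
    Measurable[h.measurableSpace] τ := by
  have := IsStoppingTime.measurable h
  refine measurable_of_Iic fun t => ?_
  have e : τ ⁻¹' Set.Iic t = (fun ω => WithTop.some (τ ω)) ⁻¹' Set.Iic (WithTop.some t) := by
    ext ω
    exact (WithTop.coe_le_coe (a := t) (b := τ ω)).symm
  rw [e]
  exact this measurableSet_Iic

lemma Stops.measurable {τ : Ω → ℝ≥0} (h : Stops 𝓖 τ) : Measurable τ :=
  h.measurable_past.mono h.measurableSpace_le le_rfl

lemma Stops.past_mono {σ τ : Ω → ℝ≥0} (hσ : Stops 𝓖 σ) (hτ : Stops 𝓖 τ) (h : ∀ ω, σ ω ≤ τ ω) :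
    hσ.measurableSpace ≤ hτ.measurableSpace :=
  IsStoppingTime.measurableSpace_mono hσ hτ fun ω => WithTop.coe_le_coe.2 (h ω)

lemma Stops.zero_le_past {τ : Ω → ℝ≥0} (h : Stops 𝓖 τ) : 𝓖 0 ≤ h.measurableSpace :=
  IsStoppingTime.le_measurableSpace_of_const_le h fun _ => WithTop.coe_le_coe.2 zero_le

lemma Stops.measurableSet_inter_le {τ : Ω → ℝ≥0} (h : Stops 𝓖 τ) {A : Set Ω}
    (hA : MeasurableSet[h.measurableSpace] A) (t : ℝ≥0) :
    MeasurableSet[𝓖 t] (A ∩ {ω | τ ω ≤ t}) := by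
  have := (IsStoppingTime.measurableSet h A).1 hA
  simpa only [WithTop.coe_le_coe] using this.2 t

/-- A later time that is determined by the past of a stopping time is a stopping time. -/
lemma Stops.of_past {τ θ : Ω → ℝ≥0} (h : Stops 𝓖 τ) (hθ : Measurable[h.measurableSpace] θ)
    (hle : ∀ ω, τ ω ≤ θ ω) : Stops 𝓖 θ := by
  refine stops_iff.2 fun t => ?_
  have := h.measurableSet_inter_le (hθ (measurableSet_Iic (a := t))) t
  convert this using 1
  ext ω
  simpa using fun h' => (hle ω).trans h'

lemma Stops.max {σ τ : Ω → ℝ≥0} (hσ : Stops 𝓖 σ) (hτ : Stops 𝓖 τ) :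
    Stops 𝓖 (fun ω => max (σ ω) (τ ω)) := by
  refine stops_iff.2 fun t => ?_
  convert (hσ.measurableSet_le t).inter (hτ.measurableSet_le t) using 1
  ext ω; simp

lemma Stops.min {σ τ : Ω → ℝ≥0} (hσ : Stops 𝓖 σ) (hτ : Stops 𝓖 τ) :
    Stops 𝓖 (fun ω => min (σ ω) (τ ω)) := by
  refine stops_iff.2 fun t => ?_
  convert (hσ.measurableSet_le t).union (hτ.measurableSet_le t) using 1
  ext ω; simp

lemma stops_const (c : ℝ≥0) : Stops 𝓖 (fun _ => c) := isStoppingTime_const 𝓖 c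

lemma IsBM.measurable (h : IsBM P 𝓖 W) (t : ℝ≥0) : Measurable (W t) :=
  (h.adapted t).mono (𝓖.le t) le_rfl

lemma measurable_eval_time {W : ℝ≥0 → Ω → ℝ} (hc : ∀ ω, Continuous (W · ω))
    (hm : ∀ t, Measurable (W t)) :
    Measurable (fun p : ℝ≥0 × Ω => W p.1 p.2) :=
  measurable_uncurry_of_continuous_of_measurable (u := W) hc hm

lemma IsBM.measurable_eval_past (h : IsBM P 𝓖 W) {τ : Ω → ℝ≥0} (hτ : Stops 𝓖 τ) :
    Measurable[hτ.measurableSpace] (fun ω => W (τ ω) ω) := by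
  have h1 : StronglyAdapted 𝓖 W := fun t => (h.adapted t).stronglyMeasurable
  have h2 := measurable_stoppedValue (h1.isStronglyProgressive_of_continuous h.cont) hτ
  exact h2

lemma IsBM.measurable_eval (h : IsBM P 𝓖 W) {τ : Ω → ℝ≥0} (hτ : Measurable τ) :
    Measurable (fun ω => W (τ ω) ω) :=
  (measurable_eval_time h.cont h.measurable).comp (hτ.prodMk measurable_id)

lemma IsBM.measurable_incr (h : IsBM P 𝓖 W) {τ : Ω → ℝ≥0} (hτ : Measurable τ) :
    Measurable (incr W τ) := by
  refine measurable_pi_lambda _ fun t => ?_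
  exact (h.measurable_eval (hτ.add_const t)).sub (h.measurable_eval hτ)

/-- Grid approximation from strictly above. -/
noncomputable def grid (m : ℕ) (τ : ℝ≥0) : ℝ≥0 := (⌊(m + 1 : ℝ≥0) * τ⌋₊ + 2) / (m + 1)

lemma tendsto_grid (τ : ℝ≥0) : Tendsto (fun m => grid m τ) atTop (𝓝 τ) := by
  have h1 : ∀ m : ℕ, τ ≤ grid m τ := fun m => by
    rw [grid, le_div_iff₀ (by positivity)]
    have := (Nat.lt_floor_add_one ((m + 1 : ℝ≥0) * τ)).le
    calc τ * (m + 1) = (m + 1) * τ := mul_comm _ _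
      _ ≤ ⌊(m + 1 : ℝ≥0) * τ⌋₊ + 1 := this
      _ ≤ _ := by gcongr; norm_num
  have h2 : ∀ m : ℕ, grid m τ ≤ τ + 2 * (1 / ((m : ℝ≥0) + 1)) := fun m => by
    rw [grid, div_le_iff₀ (by positivity)]
    have := Nat.floor_le (zero_le (a := (m + 1 : ℝ≥0) * τ))
    calc (⌊(m + 1 : ℝ≥0) * τ⌋₊ + 2 : ℝ≥0) ≤ (m + 1) * τ + 2 := by gcongr
      _ = _ := by field_simp
  refine tendsto_of_tendsto_of_tendsto_of_le_of_le tendsto_const_nhds ?_ h1 h2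
  have h3 := (tendsto_one_div_add_atTop_nhds_zero_nat (𝕜 := ℝ≥0)).const_mul 2
  simpa using h3.const_add τ

/-- Markov property at a deterministic time. Bounded continuous functions of finitely many
coordinates are enough to determine laws and independence of processes. -/
lemma IsBM.setIntegral_incr_const [IsProbabilityMeasure P] (h : IsBM P 𝓖 W) {s u : ℝ≥0}
    (hsu : s < u) {A : Set Ω} (hA : MeasurableSet[𝓖 s] A) (I : Finset ℝ≥0)
    (f : BoundedContinuousFunction (I → ℝ) ℝ) :
    ∫ ω in A, f (fun i => W (u + i) ω - W u ω) ∂P =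
      P.real A * ∫ ω, f (fun i => W i ω) ∂P := by
  have hm : Measurable (fun ω (t : ℝ≥0) => W (u + t) ω - W u ω) :=
    measurable_pi_lambda _ fun t => (h.measurable _).sub (h.measurable _)
  have h1 := Indep.setIntegral_eq_mul (P := P) (𝓖.le s) (X := fun ω (t : ℝ≥0) => W (u + t) ω - W u ω)
    (f := fun b => f (fun i : I => b i)) (h.indep s u hsu) ?_ hA ?_
  · rw [h1]
    congr 1
    have e1 := ((h.pre.shift u).hasLaw I)
    have e2 := h.pre.hasLaw I
    have e3 := e1.integral_comp (f := f) f.continuous.aestronglyMeasurable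
    have e4 := e2.integral_comp (f := f) f.continuous.aestronglyMeasurable
    exact e3.trans e4.symm
  · exact hm.aemeasurable
  · refine Measurable.aestronglyMeasurable ?_
    exact f.continuous.measurable.comp (by fun_prop)

/-- The event is split according to the grid cell of τ; on each piece the grid time is
deterministic. -/
lemma IsBM.setIntegral_incr_grid [IsProbabilityMeasure P] (h : IsBM P 𝓖 W) {τ : Ω → ℝ≥0}
    (hτ : Stops 𝓖 τ) {A : Set Ω} (hA : MeasurableSet[hτ.measurableSpace] A) (I : Finset ℝ≥0)
    (f : BoundedContinuousFunction (I → ℝ) ℝ) (m : ℕ) :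
    ∫ ω in A, f (fun i => W (grid m (τ ω) + i) ω - W (grid m (τ ω)) ω) ∂P =
      P.real A * ∫ ω, f (fun i => W i ω) ∂P := by
  set Ak : ℕ → Set Ω := fun k => A ∩ {ω | ⌊(m + 1 : ℝ≥0) * τ ω⌋₊ = k} with hAk
  have hset : ∀ k, Ak k = (A ∩ {ω | τ ω ≤ (k + 1) / (m + 1)}) ∩ {ω | τ ω < (k + 1) / (m + 1)} ∩
      {ω | τ ω < k / (m + 1)}ᶜ := fun k => by
    ext ω
    have hpos : (0 : ℝ≥0) < m + 1 := by positivity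
    simp only [hAk, Set.mem_inter_iff, Set.mem_ofPred_eq, Set.mem_compl_iff, not_lt]
    rw [Nat.floor_eq_iff (zero_le), lt_div_iff₀ hpos, le_div_iff₀ hpos, div_le_iff₀ hpos,
      mul_comm (τ ω)]
    constructor
    · rintro ⟨h1, h2, h3⟩; exact ⟨⟨⟨h1, h3.le⟩, h3⟩, h2⟩
    · rintro ⟨⟨⟨h1, -⟩, h3⟩, h2⟩; exact ⟨h1, h2, h3⟩
  have hAkm : ∀ k : ℕ, MeasurableSet[𝓖 ((k + 1) / (m + 1))] (Ak k) := fun k => by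
    rw [hset]
    refine ((hτ.measurableSet_inter_le hA _).inter (hτ.measurableSet_lt _)).inter
      (MeasurableSet.compl ?_)
    refine 𝓖.mono ?_ _ (hτ.measurableSet_lt _)
    gcongr; simp
  have hAkm' : ∀ k, MeasurableSet (Ak k) := fun k => 𝓖.le _ _ (hAkm k)
  have hU : A = ⋃ k, Ak k := by
    ext ω; simp [hAk]
  have hdisj : Pairwise (Function.onFun Disjoint Ak) := fun j k hjk => by
    refine Set.disjoint_left.2 fun ω h1 h2 => hjk ?_
    exact h1.2.symm.trans h2.2
  have hτm := hτ.measurable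
  have hgm : Measurable (fun ω => grid m (τ ω)) := by
    unfold grid
    have : Measurable (fun ω => (⌊(m + 1 : ℝ≥0) * τ ω⌋₊ : ℝ≥0)) :=
      (measurable_from_nat (f := fun n : ℕ => (n : ℝ≥0))).comp
        (Nat.measurable_floor.comp (hτm.const_mul _))
    exact (this.add_const _).div_const _
  have hmeas : Measurable (fun ω => f (fun i => W (grid m (τ ω) + i) ω - W (grid m (τ ω)) ω)) := by
    refine f.continuous.measurable.comp (measurable_pi_lambda _ fun i => ?_)
    exact (h.measurable_eval (hgm.add_const _)).sub (h.measurable_eval hgm)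
  have hint : Integrable (fun ω => f (fun i => W (grid m (τ ω) + i) ω - W (grid m (τ ω)) ω)) P :=
    Integrable.of_bound hmeas.aestronglyMeasurable ‖f‖ (ae_of_all _ fun ω => f.norm_coe_le_norm _)
  have e1 := integral_iUnion (μ := P) (s := Ak) hAkm' hdisj hint.integrableOn
  have e2 := integral_iUnion (μ := P) (s := Ak) (f := fun _ => (1 : ℝ)) hAkm' hdisj
    (integrable_const _).integrableOn
  rw [← hU] at e1 e2
  simp only [integral_const, MeasurableSet.univ, measureReal_restrict_apply, Set.univ_inter,
    smul_eq_mul, mul_one] at e2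
  rw [e1, e2, ← tsum_mul_right]
  refine tsum_congr fun k => ?_
  -- The offset 2 in `grid` pays off here: the piece is known at (k + 1)/(m + 1), strictly before
  -- the grid time (k + 2)/(m + 1), as `IsBM.indep` demands.
  have hlt : ((k + 1) / (m + 1) : ℝ≥0) < (k + 2) / (m + 1) := by gcongr; norm_num
  rw [← h.setIntegral_incr_const hlt (hAkm k) I f]
  refine setIntegral_congr_fun (hAkm' k) fun ω hω => ?_
  have : grid m (τ ω) = (k + 2) / (m + 1) := by rw [grid, hω.2]
  simp only [this]

/-- The mesh tends to zero; continuity of the paths and boundedness of f justify the limit. -/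
lemma IsBM.setIntegral_incr [IsProbabilityMeasure P] (h : IsBM P 𝓖 W) {τ : Ω → ℝ≥0}
    (hτ : Stops 𝓖 τ) {A : Set Ω} (hA : MeasurableSet[hτ.measurableSpace] A) (I : Finset ℝ≥0)
    (f : BoundedContinuousFunction (I → ℝ) ℝ) :
    ∫ ω in A, f (fun i => incr W τ ω i) ∂P = P.real A * ∫ ω, f (fun i => W i ω) ∂P := by
  have hτm := hτ.measurable
  have h1 : Tendsto (fun m => ∫ ω in A, f (fun i => W (grid m (τ ω) + i) ω - W (grid m (τ ω)) ω) ∂P)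
      atTop (𝓝 (∫ ω in A, f (fun i => incr W τ ω i) ∂P)) := by
    refine tendsto_integral_of_dominated_convergence (fun _ => ‖f‖) ?_ (integrable_const _) ?_ ?_
    · intro m
      refine Measurable.aestronglyMeasurable ?_
      have hgm : Measurable (fun ω => grid m (τ ω)) := by
        unfold grid
        have : Measurable (fun ω => (⌊(m + 1 : ℝ≥0) * τ ω⌋₊ : ℝ≥0)) :=
          (measurable_from_nat (f := fun n : ℕ => (n : ℝ≥0))).comp
            (Nat.measurable_floor.comp (hτm.const_mul _))
        exact (this.add_const _).div_const _
      refine f.continuous.measurable.comp (measurable_pi_lambda _ fun i => ?_)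
      exact (h.measurable_eval (hgm.add_const _)).sub (h.measurable_eval hgm)
    · exact fun m => ae_of_all _ fun ω => f.norm_coe_le_norm _
    · refine ae_of_all _ fun ω => ?_
      refine (f.continuous.tendsto _).comp (tendsto_pi_nhds.2 fun i => ?_)
      refine Tendsto.sub ?_ ?_
      · exact ((h.cont ω).tendsto _).comp ((tendsto_grid (τ ω)).add_const _)
      · exact ((h.cont ω).tendsto _).comp (tendsto_grid (τ ω))
  refine tendsto_nhds_unique h1 ?_
  simp_rw [h.setIntegral_incr_grid hτ hA I f]
  exact tendsto_const_nhds

/-- **Strong Markov property**, law of the increments. -/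
lemma IsBM.map_incr [IsProbabilityMeasure P] (h : IsBM P 𝓖 W) {τ : Ω → ℝ≥0} (hτ : Stops 𝓖 τ) :
    P.map (incr W τ) = P.map (fun ω t => W t ω) := by
  have hWm : Measurable (fun ω t => W t ω) := measurable_pi_lambda _ h.measurable
  have hi := h.measurable_incr hτ.measurable
  refine (map_eq_iff_forall_finset_map_restrict_eq (X := fun t ω => incr W τ ω t)
    hi.aemeasurable hWm.aemeasurable).2 fun I => ?_
  have m1 : Measurable (fun ω => I.restrict (fun t => incr W τ ω t)) :=
    (Finset.measurable_restrict I).comp hi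
  have m2 : Measurable (fun ω => I.restrict (fun t => W t ω)) :=
    (Finset.measurable_restrict I).comp hWm
  have := Measure.isProbabilityMeasure_map (μ := P) m1.aemeasurable
  have := Measure.isProbabilityMeasure_map (μ := P) m2.aemeasurable
  refine ext_of_forall_integral_eq_of_IsFiniteMeasure fun f => ?_
  rw [integral_map m1.aemeasurable f.continuous.aestronglyMeasurable,
    integral_map m2.aemeasurable f.continuous.aestronglyMeasurable]
  simpa [Finset.restrict_def] using h.setIntegral_incr hτ MeasurableSet.univ I f

/-- **Strong Markov property**, independence. -/
lemma IsBM.indep_incr [IsProbabilityMeasure P] (h : IsBM P 𝓖 W) {τ : Ω → ℝ≥0} (hτ : Stops 𝓖 τ) :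
    Indep hτ.measurableSpace (MeasurableSpace.comap (incr W τ) inferInstance) P := by
  have hi := h.measurable_incr hτ.measurable
  rw [Indep_iff]
  intro A B hA hB
  have hAm : MeasurableSet A := hτ.measurableSpace_le _ hA
  -- Independence of the indicator of A from the process reduces to the test functions treated
  -- above.
  have key : (A.indicator (1 : Ω → ℝ)) ⟂ᵢ[P] (fun ω t => incr W τ ω t) := by
    refine IndepFun.indepFun_process (Y := fun t ω => incr W τ ω t)
      (measurable_one.indicator hAm) (fun t => measurable_pi_iff.1 hi t) fun I => ?_
    refine indicator_indepFun_pi_of_bcf (X := fun (i : I) ω => incr W τ ω i)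
      hAm.nullMeasurableSet (fun i => (measurable_pi_iff.1 hi i).aemeasurable) fun f => ?_
    rw [h.setIntegral_incr hτ hA I f]
    congr 1
    have := h.setIntegral_incr hτ MeasurableSet.univ I f
    simpa using this.symm
  have := (IndepSets_iff _ _ _).1 (IndepFun.singleton_indepSets_of_indicator key) A B rfl hB
  exact this

end BrownianFiltration

/-! ### Gaussian moments up to order four -/

section GaussianMoments

/-- The function is the moment generating function of a centred Gaussian of variance v, so these are
its third and fourth moments. -/
lemma iteratedDeriv_exp_quadratic (v : ℝ) :
    iteratedDeriv 3 (fun t : ℝ => Real.exp (v * t ^ 2 / 2)) 0 = 0 ∧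
      iteratedDeriv 4 (fun t : ℝ => Real.exp (v * t ^ 2 / 2)) 0 = 3 * v ^ 2 := by
  have h0 : ∀ t : ℝ, HasDerivAt (fun t : ℝ => Real.exp (v * t ^ 2 / 2))
      (v * t * Real.exp (v * t ^ 2 / 2)) t := fun t => by
    have : HasDerivAt (fun t : ℝ => v * t ^ 2 / 2) (v * t) t := by
      have := ((hasDerivAt_pow 2 t).const_mul v).div_const 2
      exact this.congr_deriv (by push_cast; ring)
    exact this.exp.congr_deriv (by ring)
  have h1 : ∀ t : ℝ, HasDerivAt (fun t : ℝ => v * t * Real.exp (v * t ^ 2 / 2))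
      ((v + v ^ 2 * t ^ 2) * Real.exp (v * t ^ 2 / 2)) t := fun t => by
    have := ((hasDerivAt_id t).const_mul v).mul (h0 t)
    exact this.congr_deriv (by simp; ring)
  have h2 : ∀ t : ℝ, HasDerivAt (fun t : ℝ => (v + v ^ 2 * t ^ 2) * Real.exp (v * t ^ 2 / 2))
      ((3 * v ^ 2 * t + v ^ 3 * t ^ 3) * Real.exp (v * t ^ 2 / 2)) t := fun t => by
    have := (((hasDerivAt_pow 2 t).const_mul (v ^ 2)).const_add v).mul (h0 t)
    exact this.congr_deriv (by push_cast; ring)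
  have h3 : ∀ t : ℝ, HasDerivAt
      (fun t : ℝ => (3 * v ^ 2 * t + v ^ 3 * t ^ 3) * Real.exp (v * t ^ 2 / 2))
      ((3 * v ^ 2 + 6 * v ^ 3 * t ^ 2 + v ^ 4 * t ^ 4) * Real.exp (v * t ^ 2 / 2)) t := fun t => by
    have := (((hasDerivAt_id t).const_mul (3 * v ^ 2)).add
      ((hasDerivAt_pow 3 t).const_mul (v ^ 3))).mul (h0 t)
    exact this.congr_deriv (by simp; ring)
  have d0 := funext fun t => (h0 t).deriv
  have d1 := funext fun t => (h1 t).deriv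
  have d2 := funext fun t => (h2 t).deriv
  have d3 := funext fun t => (h3 t).deriv
  simp only [iteratedDeriv_succ, iteratedDeriv_zero, d0, d1, d2, d3]
  simp

lemma integrable_pow_gaussianReal (r : ℝ≥0) (n : ℕ) :
    Integrable (fun x : ℝ => x ^ n) (gaussianReal 0 r) := by
  by_cases hn : n = 0
  · subst hn; simp
  have := (memLp_id_gaussianReal (μ := 0) (v := r) (n : ℝ≥0)).integrable_norm_rpow
    (by simpa using hn) (by simp)
  refine (integrable_norm_iff (by fun_prop)).1 ?_
  simpa using this

lemma integral_pow_gaussianReal (r : ℝ≥0) :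
    ∫ x, x ^ 2 ∂(gaussianReal 0 r) = r ∧ ∫ x, x ^ 3 ∂(gaussianReal 0 r) = 0 ∧
      ∫ x, x ^ 4 ∂(gaussianReal 0 r) = 3 * r ^ 2 := by
  have h := iteratedDeriv_mgf_zero (X := id) (μ := gaussianReal 0 r)
    (by rw [integrableExpSet_id_gaussianReal]; simp)
  have h3 := h 3
  have h4 := h 4
  rw [mgf_id_gaussianReal] at h3 h4
  simp only [zero_mul, zero_add] at h3 h4
  have := iteratedDeriv_exp_quadratic r
  rw [this.1] at h3
  rw [this.2] at h4
  refine ⟨?_, h3.symm, h4.symm⟩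
  have hv := variance_id_gaussianReal (μ := 0) (v := r)
  rw [variance_eq_integral (by fun_prop)] at hv
  simpa using hv

lemma lintegral_shift_sq_gaussianReal (r : ℝ≥0) (z : ℝ) :
    ∫⁻ x, ENNReal.ofReal ((z + x) ^ 2) ∂(gaussianReal 0 r) = ENNReal.ofReal (z ^ 2 + r) := by
  have i1 := integrable_pow_gaussianReal r 1
  have i2 := integrable_pow_gaussianReal r 2
  obtain ⟨m2, -, -⟩ := integral_pow_gaussianReal r
  have m1 : ∫ x, x ^ 1 ∂(gaussianReal 0 r) = 0 := by simp
  have e : (fun x : ℝ => (z + x) ^ 2) = fun x => z ^ 2 + (2 * z * x ^ 1 + x ^ 2) := by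
    ext; ring
  have j1 : Integrable (fun x : ℝ => 2 * z * x ^ 1 + x ^ 2) (gaussianReal 0 r) :=
    (i1.const_mul _).add i2
  rw [← ofReal_integral_eq_lintegral_ofReal _ (ae_of_all _ fun x => by positivity), e,
    integral_add (integrable_const _) j1,
    integral_add (i1.const_mul _) i2, integral_const_mul, m1, m2]
  · simp
  · rw [e]; exact (integrable_const _).add j1

/-- The increase 6z²r + 3r² is six times the integral of z² + s over [0, r]. This ties the
accumulated squared error to fourth moments. -/
lemma lintegral_shift_pow_four_gaussianReal (r : ℝ≥0) (z : ℝ) :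
    ∫⁻ x, ENNReal.ofReal ((z + x) ^ 4) ∂(gaussianReal 0 r) =
      ENNReal.ofReal (z ^ 4 + 6 * z ^ 2 * r + 3 * r ^ 2) := by
  have i1 := integrable_pow_gaussianReal r 1
  have i2 := integrable_pow_gaussianReal r 2
  have i3 := integrable_pow_gaussianReal r 3
  have i4 := integrable_pow_gaussianReal r 4
  obtain ⟨m2, m3, m4⟩ := integral_pow_gaussianReal r
  have m1 : ∫ x, x ^ 1 ∂(gaussianReal 0 r) = 0 := by simp
  have e : (fun x : ℝ => (z + x) ^ 4) = fun x =>
      z ^ 4 + (4 * z ^ 3 * x ^ 1 + (6 * z ^ 2 * x ^ 2 + (4 * z * x ^ 3 + x ^ 4))) := by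
    ext; ring
  have j3 : Integrable (fun x : ℝ => 4 * z * x ^ 3 + x ^ 4) (gaussianReal 0 r) :=
    (i3.const_mul (4 * z)).add i4
  have j2 : Integrable (fun x : ℝ => 6 * z ^ 2 * x ^ 2 + (4 * z * x ^ 3 + x ^ 4))
      (gaussianReal 0 r) := (i2.const_mul (6 * z ^ 2)).add j3
  have j1 : Integrable (fun x : ℝ => 4 * z ^ 3 * x ^ 1 +
      (6 * z ^ 2 * x ^ 2 + (4 * z * x ^ 3 + x ^ 4))) (gaussianReal 0 r) :=
    (i1.const_mul (4 * z ^ 3)).add j2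
  rw [← ofReal_integral_eq_lintegral_ofReal _ (ae_of_all _ fun x => by positivity), e,
    integral_add (integrable_const _) j1, integral_add (i1.const_mul _) j2,
    integral_add (i2.const_mul _) j3, integral_add (i3.const_mul _) i4]
  · simp only [integral_const_mul, m1, m2, m3, m4]
    congr 1; simp; ring
  · rw [e]; exact (integrable_const _).add j1

end GaussianMoments

/-! ### The strong Markov property in integrated form -/

section StrongMarkov

variable {Ω : Type*} {mΩ : MeasurableSpace Ω} {P : Measure Ω}
  {𝓖 : Filtration ℝ≥0 mΩ} {W : ℝ≥0 → Ω → ℝ}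

/-- Fubini for independent variables. -/
lemma lintegral_of_indepFun [IsProbabilityMeasure P] {E F : Type*} [MeasurableSpace E]
    [MeasurableSpace F] {X : Ω → E} {Z : Ω → F} (hX : Measurable X) (hZ : Measurable Z)
    (h : IndepFun X Z P) {f : E × F → ℝ≥0∞} (hf : Measurable f) :
    ∫⁻ ω, f (X ω, Z ω) ∂P = ∫⁻ ω, ∫⁻ ω', f (X ω, Z ω') ∂P ∂P := by
  have h1 := (indepFun_iff_map_prod_eq_prod_map_map hX.aemeasurable hZ.aemeasurable).1 h
  have := Measure.isProbabilityMeasure_map (μ := P) hZ.aemeasurable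
  rw [← lintegral_map (μ := P) (g := fun ω => (X ω, Z ω)) hf (hX.prodMk hZ), h1,
    lintegral_prod _ hf.aemeasurable,
    lintegral_map (f := fun x => ∫⁻ y, f (x, y) ∂(P.map Z)) hf.lintegral_prod_right' hX]
  refine lintegral_congr fun ω => ?_
  rw [lintegral_map (f := fun y => f (X ω, y)) (hf.comp measurable_prodMk_left) hZ]

/-- Evaluation of a path at a time, measurable for the product sigma-algebra. -/
noncomputable def evalLim (b : ℝ≥0 → ℝ) (s : ℝ≥0) : ℝ := limsup (fun m => b (grid m s)) atTop

lemma evalLim_eq {b : ℝ≥0 → ℝ} (hb : Continuous b) (s : ℝ≥0) : evalLim b s = b s :=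
  (((hb.tendsto s).comp (tendsto_grid s))).limsup_eq

/-- Evaluation at a variable time is not measurable for the product σ-algebra on all paths. Each
mesh has only countably many grid points, so the upper limit along the grids is measurable. -/
lemma measurable_evalLim : Measurable (fun p : (ℝ≥0 → ℝ) × ℝ≥0 => evalLim p.1 p.2) := by
  refine Measurable.limsup fun m => ?_
  have h1 : Measurable (fun q : (ℝ≥0 → ℝ) × ℕ => q.1 (((q.2 : ℝ≥0) + 2) / (m + 1))) := by
    refine measurable_from_prod_countable_left fun n => ?_
    exact measurable_pi_apply (((n : ℝ≥0) + 2) / (m + 1))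
  have h2 : Measurable (fun p : (ℝ≥0 → ℝ) × ℝ≥0 => (p.1, ⌊(m + 1 : ℝ≥0) * p.2⌋₊)) :=
    measurable_fst.prodMk (Nat.measurable_floor.comp (measurable_snd.const_mul _))
  exact h1.comp h2

attribute [irreducible] evalLim

lemma IsBM.continuous_incr (h : IsBM P 𝓖 W) (τ : Ω → ℝ≥0) (ω : Ω) :
    Continuous (incr W τ ω) := by
  unfold incr
  exact ((h.cont ω).comp (continuous_const.add continuous_id)).sub continuous_const

/-- **Strong Markov property** in integrated form, on the level of paths. -/
lemma IsBM.lintegral_incr [IsProbabilityMeasure P] (h : IsBM P 𝓖 W) {τ : Ω → ℝ≥0}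
    (hτ : Stops 𝓖 τ) {E : Type*} [MeasurableSpace E] {ξ : Ω → E}
    (hξ : Measurable[hτ.measurableSpace] ξ) {f : E × (ℝ≥0 → ℝ) → ℝ≥0∞} (hf : Measurable f) :
    ∫⁻ ω, f (ξ ω, incr W τ ω) ∂P = ∫⁻ ω, ∫⁻ ω', f (ξ ω, fun t => W t ω') ∂P ∂P := by
  have hξ' : Measurable ξ := hξ.mono hτ.measurableSpace_le le_rfl
  have hi := h.measurable_incr hτ.measurable
  have hWm : Measurable (fun ω t => W t ω) := measurable_pi_lambda _ h.measurable
  have hind : IndepFun ξ (incr W τ) P := by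
    rw [IndepFun_iff_Indep]
    exact indep_of_indep_of_le_left (h.indep_incr hτ) (hξ.comap_le)
  rw [lintegral_of_indepFun hξ' hi hind hf]
  refine lintegral_congr fun ω => ?_
  have hfω : Measurable (fun b => f (ξ ω, b)) := hf.comp measurable_prodMk_left
  rw [← lintegral_map hfω hi, h.map_incr hτ, lintegral_map hfω hWm]

/-- **Strong Markov property** in integrated form, at one later time. -/
lemma IsBM.lintegral_later [IsProbabilityMeasure P] (h : IsBM P 𝓖 W) {τ ρ : Ω → ℝ≥0}
    (hτ : Stops 𝓖 τ) (hρ : Measurable[hτ.measurableSpace] ρ) {E : Type*} [MeasurableSpace E]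
    {ξ : Ω → E} (hξ : Measurable[hτ.measurableSpace] ξ) {A : Set Ω}
    (hA : MeasurableSet[hτ.measurableSpace] A) {f : E × ℝ → ℝ≥0∞} (hf : Measurable f) :
    ∫⁻ ω in A, f (ξ ω, W (τ ω + ρ ω) ω - W (τ ω) ω) ∂P =
      ∫⁻ ω in A, ∫⁻ x, f (ξ ω, x) ∂(gaussianReal 0 (ρ ω)) ∂P := by
  have hAm : MeasurableSet A := hτ.measurableSpace_le _ hA
  obtain ⟨g, hg⟩ : ∃ g : ((E × ℝ≥0) × ℝ≥0∞) × (ℝ≥0 → ℝ) → ℝ≥0∞,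
    g = fun p => p.1.2 * f (p.1.1.1, evalLim p.2 p.1.1.2) := ⟨_, rfl⟩
  have hgm : Measurable g := by
    rw [hg]
    have e1 : Measurable (fun p : ((E × ℝ≥0) × ℝ≥0∞) × (ℝ≥0 → ℝ) => (p.2, p.1.1.2)) :=
      measurable_snd.prodMk ((measurable_snd.comp measurable_fst).comp measurable_fst)
    have e2 : Measurable (fun p : ((E × ℝ≥0) × ℝ≥0∞) × (ℝ≥0 → ℝ) => evalLim p.2 p.1.1.2) :=
      Measurable.comp (g := fun p : (ℝ≥0 → ℝ) × ℝ≥0 => evalLim p.1 p.2) measurable_evalLim e1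
    have e3 : Measurable (fun p : ((E × ℝ≥0) × ℝ≥0∞) × (ℝ≥0 → ℝ) => p.1.1.1) :=
      (measurable_fst.comp measurable_fst).comp measurable_fst
    exact (measurable_snd.comp measurable_fst).mul (hf.comp (e3.prodMk e2))
  have h0 : Measurable[hτ.measurableSpace] (A.indicator (fun _ => (1 : ℝ≥0∞))) :=
    Measurable.indicator measurable_const hA
  have h1 : Measurable[hτ.measurableSpace]
      (fun ω => ((ξ ω, ρ ω), A.indicator (fun _ => (1 : ℝ≥0∞)) ω)) := (hξ.prodMk hρ).prodMk h0
  have key := h.lintegral_incr (E := (E × ℝ≥0) × ℝ≥0∞) (f := g) hτ h1 hgm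
  rw [← lintegral_indicator hAm, ← lintegral_indicator hAm]
  refine Eq.trans ?_ (key.trans ?_)
  · refine lintegral_congr fun ω => ?_
    by_cases hω : ω ∈ A
    · simp [hg, hω, evalLim_eq (h.continuous_incr τ ω), incr]
    · simp [hg, hω]
  · refine lintegral_congr fun ω => ?_
    by_cases hω : ω ∈ A
    · simp only [hg, hω, Set.indicator_of_mem, one_mul]
      have hl := h.pre.hasLaw_eval (ρ ω)
      rw [← hl.map_eq, lintegral_map' (f := fun x => f (ξ ω, x))
        (hf.comp measurable_prodMk_left).aemeasurable hl.aemeasurable]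
      refine lintegral_congr fun ω' => ?_
      rw [evalLim_eq (h.cont ω')]
    · simp [hg, hω]

lemma IsBM.lintegral_sq_later [IsProbabilityMeasure P] (h : IsBM P 𝓖 W) {τ θ : Ω → ℝ≥0}
    (hτ : Stops 𝓖 τ) (hθ : Measurable[hτ.measurableSpace] θ) (hle : ∀ ω, τ ω ≤ θ ω)
    {a : Ω → ℝ} (ha : Measurable[hτ.measurableSpace] a) {A : Set Ω}
    (hA : MeasurableSet[hτ.measurableSpace] A) :
    ∫⁻ ω in A, ENNReal.ofReal ((W (θ ω) ω - a ω) ^ 2) ∂P =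
      ∫⁻ ω in A, ENNReal.ofReal ((W (τ ω) ω - a ω) ^ 2 + (θ ω - τ ω : ℝ)) ∂P := by
  have hz : Measurable[hτ.measurableSpace] (fun ω => W (τ ω) ω - a ω) :=
    (h.measurable_eval_past hτ).sub ha
  have hd : Measurable[hτ.measurableSpace] (fun ω => θ ω - τ ω) := hθ.sub hτ.measurable_past
  have key := h.lintegral_later hτ hd hz hA (f := fun p => ENNReal.ofReal ((p.1 + p.2) ^ 2))
    (by fun_prop)
  convert key using 1
  · refine lintegral_congr fun ω => ?_
    simp only [add_tsub_cancel_of_le (hle ω)]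
    congr 2; ring
  · refine lintegral_congr fun ω => ?_
    simp only [lintegral_shift_sq_gaussianReal, NNReal.coe_sub (hle ω)]

lemma IsBM.lintegral_pow_four_later [IsProbabilityMeasure P] (h : IsBM P 𝓖 W) {τ θ : Ω → ℝ≥0}
    (hτ : Stops 𝓖 τ) (hθ : Measurable[hτ.measurableSpace] θ) (hle : ∀ ω, τ ω ≤ θ ω)
    {a : Ω → ℝ} (ha : Measurable[hτ.measurableSpace] a) {A : Set Ω}
    (hA : MeasurableSet[hτ.measurableSpace] A) :
    ∫⁻ ω in A, ENNReal.ofReal ((W (θ ω) ω - a ω) ^ 4) ∂P =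
      ∫⁻ ω in A, ENNReal.ofReal ((W (τ ω) ω - a ω) ^ 4 +
        6 * (W (τ ω) ω - a ω) ^ 2 * (θ ω - τ ω : ℝ) + 3 * (θ ω - τ ω : ℝ) ^ 2) ∂P := by
  have hz : Measurable[hτ.measurableSpace] (fun ω => W (τ ω) ω - a ω) :=
    (h.measurable_eval_past hτ).sub ha
  have hd : Measurable[hτ.measurableSpace] (fun ω => θ ω - τ ω) := hθ.sub hτ.measurable_past
  have key := h.lintegral_later hτ hd hz hA (f := fun p => ENNReal.ofReal ((p.1 + p.2) ^ 4))
    (by fun_prop)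
  convert key using 1
  · refine lintegral_congr fun ω => ?_
    simp only [add_tsub_cancel_of_le (hle ω)]
    congr 2; ring
  · refine lintegral_congr fun ω => ?_
    simp only [lintegral_shift_pow_four_gaussianReal, NNReal.coe_sub (hle ω)]

/-- Integral of the squared error `(W t - a)²` over the random interval `[τ, θ)`. -/
noncomputable def sqErr (W : ℝ≥0 → Ω → ℝ) (a : Ω → ℝ) (τ θ : Ω → ℝ≥0) (ω : Ω) : ℝ≥0∞ :=
  ∫⁻ t : ℝ in Set.Ico (τ ω : ℝ) (θ ω), ENNReal.ofReal ((W t.toNNReal ω - a ω) ^ 2)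

lemma sqErr_eq_shift (W : ℝ≥0 → Ω → ℝ) (a : Ω → ℝ) (τ θ : Ω → ℝ≥0) (ω : Ω) :
    sqErr W a τ θ ω = ∫⁻ s : ℝ, (Set.Ico (0 : ℝ) (θ ω - τ ω)).indicator
      (fun s => ENNReal.ofReal ((W (τ ω + s.toNNReal) ω - a ω) ^ 2)) s := by
  unfold sqErr
  rw [← lintegral_indicator measurableSet_Ico, ← lintegral_add_left_eq_self _ (τ ω : ℝ)]
  refine lintegral_congr fun s => ?_
  by_cases hs : s ∈ Set.Ico (0 : ℝ) (θ ω - τ ω)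
  · have : (τ ω : ℝ) + s ∈ Set.Ico (τ ω : ℝ) (θ ω) := ⟨by linarith [hs.1], by linarith [hs.2]⟩
    rw [Set.indicator_of_mem hs, Set.indicator_of_mem this,
      Real.toNNReal_add (NNReal.coe_nonneg _) hs.1, Real.toNNReal_coe]
  · have : (τ ω : ℝ) + s ∉ Set.Ico (τ ω : ℝ) (θ ω) := fun h =>
      hs ⟨by linarith [h.1], by linarith [h.2]⟩
    rw [Set.indicator_of_notMem hs, Set.indicator_of_notMem this]

lemma lintegral_Ico_add_const (c : ℝ) (hc : 0 ≤ c) (d : ℝ) (hd : 0 ≤ d) :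
    ∫⁻ s : ℝ, (Set.Ico (0 : ℝ) d).indicator (fun s => ENNReal.ofReal (c + s)) s =
      ENNReal.ofReal (c * d + d ^ 2 / 2) := by
  rw [lintegral_indicator measurableSet_Ico, ← ofReal_integral_eq_lintegral_ofReal]
  · congr 1
    rw [integral_Ico_eq_integral_Ioo, ← integral_Ioc_eq_integral_Ioo,
      ← intervalIntegral.integral_of_le hd, intervalIntegral.integral_add (by simp) (by simp)]
    simp; ring
  · exact (Continuous.integrableOn_Icc (by fun_prop)).mono_set Set.Ico_subset_Icc_self
  · filter_upwards [ae_restrict_mem measurableSet_Ico] with s hs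
    exact add_nonneg hc hs.1

/-- By Tonelli: given the past of τ, the mean squared error at τ + s is (W_τ − a)² + s, and the
length θ − τ of the interval is already known at τ. -/
lemma IsBM.lintegral_sqErr_later [IsProbabilityMeasure P] (h : IsBM P 𝓖 W) {τ θ : Ω → ℝ≥0}
    (hτ : Stops 𝓖 τ) (hθ : Measurable[hτ.measurableSpace] θ) (hle : ∀ ω, τ ω ≤ θ ω)
    {a : Ω → ℝ} (ha : Measurable[hτ.measurableSpace] a) {A : Set Ω}
    (hA : MeasurableSet[hτ.measurableSpace] A) :
    ∫⁻ ω in A, sqErr W a τ θ ω ∂P =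
      ∫⁻ ω in A, ENNReal.ofReal ((W (τ ω) ω - a ω) ^ 2 * (θ ω - τ ω : ℝ) +
        (θ ω - τ ω : ℝ) ^ 2 / 2) ∂P := by
  have hz : Measurable[hτ.measurableSpace] (fun ω => W (τ ω) ω - a ω) :=
    (h.measurable_eval_past hτ).sub ha
  have hz' : Measurable (fun ω => W (τ ω) ω - a ω) := hz.mono hτ.measurableSpace_le le_rfl
  have ha' : Measurable a := ha.mono hτ.measurableSpace_le le_rfl
  have hθ' : Measurable θ := hθ.mono hτ.measurableSpace_le le_rfl
  have hτ' := hτ.measurable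
  have hd : Measurable[hτ.measurableSpace] (fun ω => (θ ω : ℝ) - τ ω) :=
    (measurable_coe_nnreal_real.comp hθ).sub (measurable_coe_nnreal_real.comp hτ.measurable_past)
  have hd' : Measurable (fun ω => (θ ω : ℝ) - τ ω) := hd.mono hτ.measurableSpace_le le_rfl
  have hSet : MeasurableSet {p : Ω × ℝ | p.2 ∈ Set.Ico (0 : ℝ) (θ p.1 - τ p.1)} :=
    (measurableSet_le measurable_const measurable_snd).inter
      (measurableSet_lt measurable_snd (hd'.comp measurable_fst))
  have m1 : Measurable (fun p : Ω × ℝ => (Set.Ico (0 : ℝ) (θ p.1 - τ p.1)).indicator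
      (fun s => ENNReal.ofReal ((W (τ p.1 + s.toNNReal) p.1 - a p.1) ^ 2)) p.2) := by
    have : Measurable (fun p : Ω × ℝ => ENNReal.ofReal
        ((W (τ p.1 + p.2.toNNReal) p.1 - a p.1) ^ 2)) := by
      refine ENNReal.measurable_ofReal.comp (Measurable.pow_const (Measurable.sub ?_ ?_) 2)
      · exact (measurable_eval_time h.cont h.measurable).comp
          (((hτ'.comp measurable_fst).add (measurable_real_toNNReal.comp measurable_snd)).prodMk
            measurable_fst)
      · exact ha'.comp measurable_fst
    exact this.indicator hSet
  have m2 : Measurable (fun p : Ω × ℝ => (Set.Ico (0 : ℝ) (θ p.1 - τ p.1)).indicator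
      (fun s => ENNReal.ofReal ((W (τ p.1) p.1 - a p.1) ^ 2 + s)) p.2) := by
    have : Measurable (fun p : Ω × ℝ => ENNReal.ofReal ((W (τ p.1) p.1 - a p.1) ^ 2 + p.2)) := by
      refine ENNReal.measurable_ofReal.comp (Measurable.add ?_ measurable_snd)
      exact (hz'.comp measurable_fst).pow_const 2
    exact this.indicator hSet
  calc ∫⁻ ω in A, sqErr W a τ θ ω ∂P
      = ∫⁻ ω in A, (∫⁻ s : ℝ, (Set.Ico (0 : ℝ) (θ ω - τ ω)).indicator
          (fun s => ENNReal.ofReal ((W (τ ω + s.toNNReal) ω - a ω) ^ 2)) s) ∂P := by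
        simp_rw [sqErr_eq_shift]
    _ = ∫⁻ s : ℝ, (∫⁻ ω in A, (Set.Ico (0 : ℝ) (θ ω - τ ω)).indicator
          (fun s => ENNReal.ofReal ((W (τ ω + s.toNNReal) ω - a ω) ^ 2)) s ∂P) :=
        lintegral_lintegral_swap (μ := P.restrict A) m1.aemeasurable
    _ = ∫⁻ s : ℝ, (∫⁻ ω in A, (Set.Ico (0 : ℝ) (θ ω - τ ω)).indicator
          (fun s => ENNReal.ofReal ((W (τ ω) ω - a ω) ^ 2 + s)) s ∂P) := by
        refine lintegral_congr fun s => ?_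
        by_cases hs : 0 ≤ s
        swap
        · have : ∀ ω, s ∉ Set.Ico (0 : ℝ) (θ ω - τ ω) := fun ω h' => hs h'.1
          simp [this]
        have key := h.lintegral_later hτ (ρ := fun _ => s.toNNReal) measurable_const
          (hz.prodMk hd) hA
          (f := fun p => (Set.Ioi s).indicator
            (fun _ => ENNReal.ofReal ((p.1.1 + p.2) ^ 2)) p.1.2) (by
            have : Measurable (fun p : (ℝ × ℝ) × ℝ => ENNReal.ofReal ((p.1.1 + p.2) ^ 2)) := by
              fun_prop
            exact this.indicator (measurableSet_lt measurable_const
              (measurable_snd.comp measurable_fst)))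
        convert key using 1
        · refine lintegral_congr fun ω => ?_
          by_cases h2 : s < θ ω - τ ω
          · simp only [Set.indicator_apply, Set.mem_Ico, Set.mem_Ioi, hs, h2, and_self, if_true]
            congr 2; ring
          · simp only [Set.indicator_apply, Set.mem_Ico, Set.mem_Ioi, h2, and_false, if_false]
        · refine lintegral_congr fun ω => ?_
          by_cases h2 : s < θ ω - τ ω
          · simp only [Set.indicator_apply, Set.mem_Ico, Set.mem_Ioi, hs, h2, and_self, if_true]
            rw [lintegral_shift_sq_gaussianReal, Real.coe_toNNReal _ hs]
          · simp only [Set.indicator_apply, Set.mem_Ico, Set.mem_Ioi, h2, and_false, if_false,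
              lintegral_zero]
    _ = ∫⁻ ω in A, (∫⁻ s : ℝ, (Set.Ico (0 : ℝ) (θ ω - τ ω)).indicator
          (fun s => ENNReal.ofReal ((W (τ ω) ω - a ω) ^ 2 + s)) s) ∂P :=
        (lintegral_lintegral_swap (μ := P.restrict A) m2.aemeasurable).symm
    _ = _ := by
        refine lintegral_congr fun ω => ?_
        exact lintegral_Ico_add_const _ (sq_nonneg _) _ (sub_nonneg.2 (by exact_mod_cast hle ω))

/-- Given the past, the increment is a symmetric Gaussian, so positive and negative parts have the
same integral. -/
lemma IsBM.setIntegral_mul_later [IsProbabilityMeasure P] (h : IsBM P 𝓖 W) {τ θ : Ω → ℝ≥0}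
    (hτ : Stops 𝓖 τ) (hθ : Measurable[hτ.measurableSpace] θ) (hle : ∀ ω, τ ω ≤ θ ω)
    {ξ : Ω → ℝ} (hξ : Measurable[hτ.measurableSpace] ξ) {A : Set Ω}
    (hA : MeasurableSet[hτ.measurableSpace] A)
    (hi : IntegrableOn (fun ω => ξ ω * (W (θ ω) ω - W (τ ω) ω)) A P) :
    ∫ ω in A, ξ ω * (W (θ ω) ω - W (τ ω) ω) ∂P = 0 := by
  have hd : Measurable[hτ.measurableSpace] (fun ω => θ ω - τ ω) := hθ.sub hτ.measurable_past
  rw [integral_eq_lintegral_pos_part_sub_lintegral_neg_part hi, sub_eq_zero]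
  congr 1
  have k1 := h.lintegral_later hτ hd hξ hA (f := fun p => ENNReal.ofReal (p.1 * p.2))
    (by fun_prop)
  have k2 := h.lintegral_later hτ hd hξ hA (f := fun p => ENNReal.ofReal (-(p.1 * p.2)))
    (by fun_prop)
  simp only [add_tsub_cancel_of_le (hle _)] at k1 k2
  rw [k1, k2]
  refine lintegral_congr fun ω => ?_
  have hneg := gaussianReal_map_neg (μ := 0) (v := θ ω - τ ω)
  rw [neg_zero] at hneg
  conv_lhs => rw [← hneg]
  rw [lintegral_map (by fun_prop) (by fun_prop)]
  simp

end StrongMarkov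

/-! ### Moment identities and optimal stopping between stopping times -/

section Sandwich

variable {Ω : Type*} {mΩ : MeasurableSpace Ω} {P : Measure Ω}
  {𝓖 : Filtration ℝ≥0 mΩ} {W : ℝ≥0 → Ω → ℝ}

lemma IsBM.measurable_sqErr (h : IsBM P 𝓖 W) {τ θ : Ω → ℝ≥0} {a : Ω → ℝ}
    (hτ : Measurable τ) (hθ : Measurable θ) (ha : Measurable a) : Measurable (sqErr W a τ θ) := by
  have hSet : MeasurableSet {p : Ω × ℝ | p.2 ∈ Set.Ico (τ p.1 : ℝ) (θ p.1)} :=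
    (measurableSet_le (measurable_coe_nnreal_real.comp (hτ.comp measurable_fst))
      measurable_snd).inter
      (measurableSet_lt measurable_snd (measurable_coe_nnreal_real.comp (hθ.comp measurable_fst)))
  have m0 : Measurable (fun p : Ω × ℝ => ENNReal.ofReal ((W p.2.toNNReal p.1 - a p.1) ^ 2)) := by
    refine ENNReal.measurable_ofReal.comp (Measurable.pow_const (Measurable.sub ?_ ?_) 2)
    · exact (measurable_eval_time h.cont h.measurable).comp
        ((measurable_real_toNNReal.comp measurable_snd).prodMk measurable_fst)
    · exact ha.comp measurable_fst
  have := (m0.indicator hSet).lintegral_prod_right' (ν := (volume : Measure ℝ))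
  convert this using 2 with ω
  rw [sqErr, ← lintegral_indicator measurableSet_Ico]
  rfl

lemma sqErr_add (W : ℝ≥0 → Ω → ℝ) (a : Ω → ℝ) {σ τ θ : Ω → ℝ≥0} {ω : Ω} (h1 : σ ω ≤ τ ω)
    (h2 : τ ω ≤ θ ω) : sqErr W a σ θ ω = sqErr W a σ τ ω + sqErr W a τ θ ω := by
  unfold sqErr
  rw [← Set.Ico_union_Ico_eq_Ico (NNReal.coe_le_coe.2 h1) (NNReal.coe_le_coe.2 h2),
    lintegral_union measurableSet_Ico]
  exact Set.disjoint_left.2 fun t h h' => (not_lt.2 h'.1) h.2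

/-- Stopping times `σ ≤ τ ≤ θ`, where `θ` and the reference level `a` are known at time `σ` and,
on the event `A` of the past of `σ`, the interval `[σ, θ]` is bounded. -/
structure Sandwich (P : Measure Ω) (𝓖 : Filtration ℝ≥0 mΩ) (W : ℝ≥0 → Ω → ℝ)
    (σ τ θ : Ω → ℝ≥0) (a : Ω → ℝ) (A : Set Ω) (N : ℝ) : Prop where
  bm : IsBM P 𝓖 W
  hσ : Stops 𝓖 σ
  hτ : Stops 𝓖 τ
  le₁ : ∀ ω, σ ω ≤ τ ω
  le₂ : ∀ ω, τ ω ≤ θ ω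
  hθ : Measurable[hσ.measurableSpace] θ
  ha : Measurable[hσ.measurableSpace] a
  hA : MeasurableSet[hσ.measurableSpace] A
  bdd : ∀ ω ∈ A, (θ ω : ℝ) - σ ω ≤ N
  fin : ∫⁻ ω in A, ENNReal.ofReal ((W (σ ω) ω - a ω) ^ 4) ∂P < ∞

namespace Sandwich

variable {σ τ θ : Ω → ℝ≥0} {a : Ω → ℝ} {A : Set Ω} {N : ℝ}

lemma measurable_a (S : Sandwich P 𝓖 W σ τ θ a A N) : Measurable a :=
  S.ha.mono S.hσ.measurableSpace_le le_rfl

lemma measurable_θ (S : Sandwich P 𝓖 W σ τ θ a A N) : Measurable θ :=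
  S.hθ.mono S.hσ.measurableSpace_le le_rfl

lemma measurableSet (S : Sandwich P 𝓖 W σ τ θ a A N) : MeasurableSet A :=
  S.hσ.measurableSpace_le _ S.hA

lemma measurable_diff (S : Sandwich P 𝓖 W σ τ θ a A N) {ρ : Ω → ℝ≥0} (hρ : Measurable ρ) :
    Measurable (fun ω => W (ρ ω) ω - a ω) :=
  (S.bm.measurable_eval hρ).sub S.measurable_a

lemma past_le (S : Sandwich P 𝓖 W σ τ θ a A N) :
    S.hσ.measurableSpace ≤ S.hτ.measurableSpace := S.hσ.past_mono S.hτ S.le₁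

lemma hθ' (S : Sandwich P 𝓖 W σ τ θ a A N) : Measurable[S.hτ.measurableSpace] θ :=
  S.hθ.mono S.past_le le_rfl

lemma ha' (S : Sandwich P 𝓖 W σ τ θ a A N) : Measurable[S.hτ.measurableSpace] a :=
  S.ha.mono S.past_le le_rfl

lemma hA' (S : Sandwich P 𝓖 W σ τ θ a A N) : MeasurableSet[S.hτ.measurableSpace] A :=
  S.past_le _ S.hA

lemma le_trans (S : Sandwich P 𝓖 W σ τ θ a A N) (ω : Ω) : σ ω ≤ θ ω := (S.le₁ ω).trans (S.le₂ ω)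

lemma bounds (S : Sandwich P 𝓖 W σ τ θ a A N) {ω : Ω} (hω : ω ∈ A) :
    0 ≤ (θ ω : ℝ) - τ ω ∧ 0 ≤ (τ ω : ℝ) - σ ω ∧ (θ ω : ℝ) - σ ω ≤ N := by
  refine ⟨sub_nonneg.2 (NNReal.coe_le_coe.2 (S.le₂ ω)), sub_nonneg.2 (NNReal.coe_le_coe.2 (S.le₁ ω)),
    S.bdd ω hω⟩

variable [IsProbabilityMeasure P]

omit [IsProbabilityMeasure P] in
lemma integrable_start (S : Sandwich P 𝓖 W σ τ θ a A N) :
    IntegrableOn (fun ω => (W (σ ω) ω - a ω) ^ 4) A P :=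
  (lintegral_ofReal_ne_top_iff_integrable
    ((S.measurable_diff S.hσ.measurable).pow_const 4).aestronglyMeasurable
    (ae_of_all _ fun ω => by positivity)).1 S.fin.ne

/-- Together with `pow_four_mid` this expresses one quantity, the fourth moment at θ, from σ and
from τ. Comparing the two expressions takes the place of Itô's formula on [σ, τ]. -/
lemma pow_four_start (S : Sandwich P 𝓖 W σ τ θ a A N) :
    ∫ ω in A, (W (θ ω) ω - a ω) ^ 4 ∂P = ∫ ω in A, ((W (σ ω) ω - a ω) ^ 4 +
        6 * (W (σ ω) ω - a ω) ^ 2 * (θ ω - σ ω : ℝ) + 3 * (θ ω - σ ω : ℝ) ^ 2) ∂P := by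
  have mθ := S.measurable_θ
  have mσ := S.hσ.measurable
  have m1 := S.measurable_diff mθ
  have m2 := S.measurable_diff mσ
  rw [integral_eq_lintegral_of_nonneg_ae, integral_eq_lintegral_of_nonneg_ae,
    S.bm.lintegral_pow_four_later S.hσ S.hθ S.le_trans S.ha S.hA]
  · filter_upwards [ae_restrict_mem S.measurableSet] with ω hω
    have := S.bounds hω
    have h3 : 0 ≤ (θ ω : ℝ) - σ ω := by linarith
    positivity
  · exact (by fun_prop : Measurable _).aestronglyMeasurable
  · exact ae_of_all _ fun ω => by positivity
  · exact (by fun_prop : Measurable _).aestronglyMeasurable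

lemma pow_four_mid (S : Sandwich P 𝓖 W σ τ θ a A N) :
    ∫ ω in A, (W (θ ω) ω - a ω) ^ 4 ∂P = ∫ ω in A, ((W (τ ω) ω - a ω) ^ 4 +
        6 * (W (τ ω) ω - a ω) ^ 2 * (θ ω - τ ω : ℝ) + 3 * (θ ω - τ ω : ℝ) ^ 2) ∂P := by
  have mθ := S.measurable_θ
  have mσ := S.hτ.measurable
  have m1 := S.measurable_diff mθ
  have m2 := S.measurable_diff mσ
  rw [integral_eq_lintegral_of_nonneg_ae, integral_eq_lintegral_of_nonneg_ae,
    S.bm.lintegral_pow_four_later S.hτ S.hθ' S.le₂ S.ha' S.hA']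
  · filter_upwards [ae_restrict_mem S.measurableSet] with ω hω
    have h3 := (S.bounds hω).1
    positivity
  · exact (by fun_prop : Measurable _).aestronglyMeasurable
  · exact ae_of_all _ fun ω => by positivity
  · exact (by fun_prop : Measurable _).aestronglyMeasurable

/-- Every polynomial bound in the initial error gives integrability on `A`. -/
lemma integrable_of_bound (S : Sandwich P 𝓖 W σ τ θ a A N) {g : Ω → ℝ} (hg : Measurable g) (C : ℝ)
    (hb : ∀ ω ∈ A, |g ω| ≤ C * ((W (σ ω) ω - a ω) ^ 4 + 1)) : IntegrableOn g A P := by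
  refine Integrable.mono' ((S.integrable_start.add (integrable_const (1 : ℝ))).const_mul C)
    hg.aestronglyMeasurable ?_
  filter_upwards [ae_restrict_mem S.measurableSet] with ω hω using hb ω hω

lemma integrable_start_poly (S : Sandwich P 𝓖 W σ τ θ a A N) :
    IntegrableOn (fun ω => (W (σ ω) ω - a ω) ^ 4 +
        6 * (W (σ ω) ω - a ω) ^ 2 * (θ ω - σ ω : ℝ) + 3 * (θ ω - σ ω : ℝ) ^ 2) A P := by
  have mθ := S.measurable_θ
  have mσ := S.hσ.measurable
  have m2 := S.measurable_diff mσ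
  refine S.integrable_of_bound (by fun_prop) (1 + 6 * |N| + 3 * N ^ 2) fun ω hω => ?_
  have hb := S.bounds hω
  set y := W (σ ω) ω - a ω
  set d := (θ ω : ℝ) - σ ω
  have h0 : 0 ≤ d := by simp only [d]; linarith
  have h1 : d ≤ |N| := hb.2.2.trans (le_abs_self N)
  have h2 : y ^ 2 ≤ y ^ 4 + 1 := by nlinarith [sq_nonneg (y ^ 2 - 1)]
  have h3 : d ^ 2 ≤ N ^ 2 := by rw [← sq_abs N]; gcongr
  rw [abs_of_nonneg (by positivity)]
  have h4 : y ^ 2 * d ≤ (y ^ 4 + 1) * |N| := mul_le_mul h2 h1 h0 (by positivity)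
  have h5 : 0 ≤ N ^ 2 * y ^ 4 := by positivity
  nlinarith

lemma integrable_end (S : Sandwich P 𝓖 W σ τ θ a A N) :
    IntegrableOn (fun ω => (W (θ ω) ω - a ω) ^ 4) A P := by
  refine (lintegral_ofReal_ne_top_iff_integrable
    ((S.measurable_diff S.measurable_θ).pow_const 4).aestronglyMeasurable
    (ae_of_all _ fun ω => by positivity)).1 ?_
  rw [S.bm.lintegral_pow_four_later S.hσ S.hθ S.le_trans S.ha S.hA]
  refine (lintegral_ofReal_ne_top_iff_integrable S.integrable_start_poly.1 ?_).2
    S.integrable_start_poly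
  filter_upwards [ae_restrict_mem S.measurableSet] with ω hω
  have := S.bounds hω
  have h3 : 0 ≤ (θ ω : ℝ) - σ ω := by linarith
  positivity

/-- The integrand is nonnegative on A and has the same integral as the fourth power at θ, whose
finiteness follows from σ; no bound at the random time τ is needed beforehand. -/
lemma integrable_mid_poly (S : Sandwich P 𝓖 W σ τ θ a A N) :
    IntegrableOn (fun ω => (W (τ ω) ω - a ω) ^ 4 +
        6 * (W (τ ω) ω - a ω) ^ 2 * (θ ω - τ ω : ℝ) + 3 * (θ ω - τ ω : ℝ) ^ 2) A P := by
  have mθ := S.measurable_θ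
  have mτ := S.hτ.measurable
  have m2 := S.measurable_diff mτ
  refine (lintegral_ofReal_ne_top_iff_integrable
    (by fun_prop : Measurable _).aestronglyMeasurable ?_).1 ?_
  · filter_upwards [ae_restrict_mem S.measurableSet] with ω hω
    have h3 := (S.bounds hω).1
    positivity
  rw [← S.bm.lintegral_pow_four_later S.hτ S.hθ' S.le₂ S.ha' S.hA']
  exact (lintegral_ofReal_ne_top_iff_integrable S.integrable_end.1
    (ae_of_all _ fun ω => by positivity)).2 S.integrable_end

lemma integrable_mid (S : Sandwich P 𝓖 W σ τ θ a A N) :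
    IntegrableOn (fun ω => (W (τ ω) ω - a ω) ^ 4) A P := by
  refine Integrable.mono' S.integrable_mid_poly
    ((S.measurable_diff S.hτ.measurable).pow_const 4).aestronglyMeasurable ?_
  filter_upwards [ae_restrict_mem S.measurableSet] with ω hω
  have h3 := (S.bounds hω).1
  rw [Real.norm_of_nonneg (by positivity)]
  have : 0 ≤ 6 * (W (τ ω) ω - a ω) ^ 2 * (θ ω - τ ω : ℝ) + 3 * (θ ω - τ ω : ℝ) ^ 2 := by positivity
  linarith

omit [IsProbabilityMeasure P] in
lemma integrable_sq_of_pow_four [IsFiniteMeasure P] {g : Ω → ℝ} (hg : Measurable g)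
    (h : IntegrableOn (fun ω => g ω ^ 4) A P) : IntegrableOn (fun ω => g ω ^ 2) A P := by
  refine Integrable.mono' (h.add (integrable_const (1 : ℝ)))
    (hg.pow_const 2).aestronglyMeasurable (ae_of_all _ fun ω => ?_)
  rw [Real.norm_of_nonneg (by positivity)]
  simp only [Pi.add_apply]
  nlinarith [sq_nonneg (g ω ^ 2 - 1)]

lemma integrable_start_sq (S : Sandwich P 𝓖 W σ τ θ a A N) :
    IntegrableOn (fun ω => (W (σ ω) ω - a ω) ^ 2) A P :=
  integrable_sq_of_pow_four (S.measurable_diff S.hσ.measurable) S.integrable_start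

lemma integrable_mid_sq (S : Sandwich P 𝓖 W σ τ θ a A N) :
    IntegrableOn (fun ω => (W (τ ω) ω - a ω) ^ 2) A P :=
  integrable_sq_of_pow_four (S.measurable_diff S.hτ.measurable) S.integrable_mid

lemma integrable_bounded (S : Sandwich P 𝓖 W σ τ θ a A N) {g : Ω → ℝ} (hg : Measurable g) (C : ℝ)
    (hb : ∀ ω ∈ A, |g ω| ≤ C) : IntegrableOn g A P := by
  refine Integrable.mono' (integrable_const C) hg.aestronglyMeasurable ?_
  filter_upwards [ae_restrict_mem S.measurableSet] with ω hω using hb ω hω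

lemma integrable_wait (S : Sandwich P 𝓖 W σ τ θ a A N) :
    IntegrableOn (fun ω => (τ ω - σ ω : ℝ)) A P := by
  have mτ := S.hτ.measurable
  have mσ := S.hσ.measurable
  refine S.integrable_bounded (by fun_prop) N fun ω hω => ?_
  have := S.bounds hω
  rw [abs_of_nonneg this.2.1]; linarith

lemma integrable_rest (S : Sandwich P 𝓖 W σ τ θ a A N) :
    IntegrableOn (fun ω => (θ ω - τ ω : ℝ)) A P := by
  have mτ := S.hτ.measurable
  have mθ := S.measurable_θ
  refine S.integrable_bounded (by fun_prop) N fun ω hω => ?_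
  have := S.bounds hω
  rw [abs_of_nonneg this.1]; linarith

/-- Wald's second identity on `[σ, τ]`. -/
lemma integral_sq (S : Sandwich P 𝓖 W σ τ θ a A N) :
    ∫ ω in A, (W (τ ω) ω - a ω) ^ 2 ∂P =
      ∫ ω in A, (W (σ ω) ω - a ω) ^ 2 ∂P + ∫ ω in A, (τ ω - σ ω : ℝ) ∂P := by
  have mθ := S.measurable_θ
  have mτ := S.hτ.measurable
  have mσ := S.hσ.measurable
  have m1 := S.measurable_diff mθ
  have m2 := S.measurable_diff mτ
  have m3 := S.measurable_diff mσ
  -- Both sides are the second moment at θ, seen from σ and from τ.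
  have e1 : ∫ ω in A, ((W (σ ω) ω - a ω) ^ 2 + (θ ω - σ ω : ℝ)) ∂P =
      ∫ ω in A, ((W (τ ω) ω - a ω) ^ 2 + (θ ω - τ ω : ℝ)) ∂P := by
    rw [integral_eq_lintegral_of_nonneg_ae, integral_eq_lintegral_of_nonneg_ae,
      ← S.bm.lintegral_sq_later S.hσ S.hθ S.le_trans S.ha S.hA,
      ← S.bm.lintegral_sq_later S.hτ S.hθ' S.le₂ S.ha' S.hA']
    · filter_upwards [ae_restrict_mem S.measurableSet] with ω hω
      have h3 := (S.bounds hω).1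
      positivity
    · exact (by fun_prop : Measurable _).aestronglyMeasurable
    · filter_upwards [ae_restrict_mem S.measurableSet] with ω hω
      have := S.bounds hω
      have h3 : 0 ≤ (θ ω : ℝ) - σ ω := by linarith
      positivity
    · exact (by fun_prop : Measurable _).aestronglyMeasurable
  have e2 : ∫ ω in A, ((W (σ ω) ω - a ω) ^ 2 + (θ ω - σ ω : ℝ)) ∂P =
      ∫ ω in A, (W (σ ω) ω - a ω) ^ 2 ∂P +
        (∫ ω in A, (θ ω - τ ω : ℝ) ∂P + ∫ ω in A, (τ ω - σ ω : ℝ) ∂P) := by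
    rw [← integral_add' S.integrable_rest S.integrable_wait, ← integral_add' S.integrable_start_sq
      (S.integrable_rest.add S.integrable_wait)]
    refine integral_congr_ae (ae_of_all _ fun ω => ?_)
    simp only [Pi.add_apply]; ring
  rw [integral_add S.integrable_mid_sq S.integrable_rest, e2] at e1
  linarith

/-- The error over [σ, τ] is the error over [σ, θ] less that over [τ, θ]. Each of these is one sixth
of an increase of the fourth moment, and the contributions at θ cancel. -/
lemma lintegral_sqErr (S : Sandwich P 𝓖 W σ τ θ a A N) :
    ∫⁻ ω in A, sqErr W a σ τ ω ∂P = ENNReal.ofReal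
      ((∫ ω in A, (W (τ ω) ω - a ω) ^ 4 ∂P - ∫ ω in A, (W (σ ω) ω - a ω) ^ 4 ∂P) / 6) := by
  have mθ := S.measurable_θ
  have mτ := S.hτ.measurable
  have mσ := S.hσ.measurable
  have ma := S.measurable_a
  have e1 : ∫⁻ ω in A, sqErr W a σ θ ω ∂P = ENNReal.ofReal
      ((∫ ω in A, (W (θ ω) ω - a ω) ^ 4 ∂P - ∫ ω in A, (W (σ ω) ω - a ω) ^ 4 ∂P) / 6) := by
    rw [S.bm.lintegral_sqErr_later S.hσ S.hθ S.le_trans S.ha S.hA, S.pow_four_start,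
      ← integral_sub S.integrable_start_poly S.integrable_start, ← integral_div,
      ofReal_integral_eq_lintegral_ofReal]
    · refine lintegral_congr fun ω => ?_
      congr 1; ring
    · exact (S.integrable_start_poly.sub S.integrable_start).div_const 6
    · filter_upwards [ae_restrict_mem S.measurableSet] with ω hω
      have := S.bounds hω
      have h3 : 0 ≤ (θ ω : ℝ) - σ ω := by linarith
      refine div_nonneg ?_ (by norm_num)
      have : 0 ≤ 6 * (W (σ ω) ω - a ω) ^ 2 * (θ ω - σ ω : ℝ) + 3 * (θ ω - σ ω : ℝ) ^ 2 := by
        positivity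
      linarith
  have p2 : 0 ≤ (∫ ω in A, (W (θ ω) ω - a ω) ^ 4 ∂P - ∫ ω in A, (W (τ ω) ω - a ω) ^ 4 ∂P) / 6 := by
    rw [S.pow_four_mid, ← integral_sub S.integrable_mid_poly S.integrable_mid]
    refine div_nonneg (setIntegral_nonneg S.measurableSet fun ω hω => ?_) (by norm_num)
    have h3 := (S.bounds hω).1
    have : 0 ≤ 6 * (W (τ ω) ω - a ω) ^ 2 * (θ ω - τ ω : ℝ) + 3 * (θ ω - τ ω : ℝ) ^ 2 := by
      positivity
    linarith
  have e2 : ∫⁻ ω in A, sqErr W a τ θ ω ∂P = ENNReal.ofReal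
      ((∫ ω in A, (W (θ ω) ω - a ω) ^ 4 ∂P - ∫ ω in A, (W (τ ω) ω - a ω) ^ 4 ∂P) / 6) := by
    rw [S.bm.lintegral_sqErr_later S.hτ S.hθ' S.le₂ S.ha' S.hA', S.pow_four_mid,
      ← integral_sub S.integrable_mid_poly S.integrable_mid, ← integral_div,
      ofReal_integral_eq_lintegral_ofReal]
    · refine lintegral_congr fun ω => ?_
      congr 1; ring
    · exact (S.integrable_mid_poly.sub S.integrable_mid).div_const 6
    · filter_upwards [ae_restrict_mem S.measurableSet] with ω hω
      have h3 := (S.bounds hω).1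
      refine div_nonneg ?_ (by norm_num)
      have : 0 ≤ 6 * (W (τ ω) ω - a ω) ^ 2 * (θ ω - τ ω : ℝ) + 3 * (θ ω - τ ω : ℝ) ^ 2 := by
        positivity
      linarith
  have e3 : ∫⁻ ω in A, sqErr W a σ θ ω ∂P =
      ∫⁻ ω in A, sqErr W a σ τ ω ∂P + ∫⁻ ω in A, sqErr W a τ θ ω ∂P := by
    rw [← lintegral_add_right _ (S.bm.measurable_sqErr mτ mθ ma)]
    exact lintegral_congr fun ω => sqErr_add W a (S.le₁ ω) (S.le₂ ω)
  rw [e1, e2] at e3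
  have e4 := congrArg (fun x => x - ENNReal.ofReal
    ((∫ ω in A, (W (θ ω) ω - a ω) ^ 4 ∂P - ∫ ω in A, (W (τ ω) ω - a ω) ^ 4 ∂P) / 6)) e3
  simp only [ENNReal.add_sub_cancel_right ENNReal.ofReal_ne_top] at e4
  rw [← e4, ← ENNReal.ofReal_sub _ p2]
  congr 1; ring

/-- The increment over [σ, τ] is the difference of those over [σ, θ] and [τ, θ], both centred given
the past. The cubic bound, which the slope of a quartic cost satisfies, gives integrability through
|y|³|u| ≤ y⁴ + u⁴. -/
lemma integral_mul_increment (S : Sandwich P 𝓖 W σ τ θ a A N) {ξ : Ω → ℝ}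
    (hξ : Measurable[S.hσ.measurableSpace] ξ)
    (hb : ∀ ω, |ξ ω| ≤ |W (σ ω) ω - a ω| ^ 3) :
    IntegrableOn (fun ω => ξ ω * (W (τ ω) ω - W (σ ω) ω)) A P ∧
      ∫ ω in A, ξ ω * (W (τ ω) ω - W (σ ω) ω) ∂P = 0 := by
  have hξ' : Measurable ξ := hξ.mono S.hσ.measurableSpace_le le_rfl
  have hξτ : Measurable[S.hτ.measurableSpace] ξ := hξ.mono S.past_le le_rfl
  have mθ := S.bm.measurable_eval S.measurable_θ
  have mτ := S.bm.measurable_eval S.hτ.measurable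
  have mσ := S.bm.measurable_eval S.hσ.measurable
  have young : ∀ y u : ℝ, |y| ^ 3 * |u| ≤ y ^ 4 + u ^ 4 := fun y u => by
    have h1 : y ^ 4 = |y| ^ 4 := by rw [← abs_pow, abs_of_nonneg (by positivity)]
    have h2 : u ^ 4 = |u| ^ 4 := by rw [← abs_pow, abs_of_nonneg (by positivity)]
    rw [h1, h2]
    have hy := abs_nonneg y
    have hu := abs_nonneg u
    rcases le_total |y| |u| with h | h
    · have : |y| ^ 3 * |u| ≤ |u| ^ 3 * |u| := by gcongr
      nlinarith [pow_nonneg hy 4]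
    · have : |y| ^ 3 * |u| ≤ |y| ^ 3 * |y| := by gcongr
      nlinarith [pow_nonneg hu 4]
  have key : ∀ ρ : Ω → ℝ≥0, Measurable ρ →
      IntegrableOn (fun ω => (W (ρ ω) ω - a ω) ^ 4) A P →
      IntegrableOn (fun ω => ξ ω * (W (ρ ω) ω - a ω)) A P := fun ρ hρ hi => by
    refine Integrable.mono' (S.integrable_start.add hi)
      (hξ'.mul (S.measurable_diff hρ)).aestronglyMeasurable (ae_of_all _ fun ω => ?_)
    rw [norm_mul, Real.norm_eq_abs, Real.norm_eq_abs]
    exact (mul_le_mul_of_nonneg_right (hb ω) (abs_nonneg _)).trans (young _ _)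
  have k1 := key σ S.hσ.measurable S.integrable_start
  have k2 := key τ S.hτ.measurable S.integrable_mid
  have k3 := key θ S.measurable_θ S.integrable_end
  have i1 : IntegrableOn (fun ω => ξ ω * (W (θ ω) ω - W (σ ω) ω)) A P := by
    refine (k3.sub k1).congr (ae_of_all _ fun ω => ?_)
    simp only [Pi.sub_apply]; ring
  have i2 : IntegrableOn (fun ω => ξ ω * (W (θ ω) ω - W (τ ω) ω)) A P := by
    refine (k3.sub k2).congr (ae_of_all _ fun ω => ?_)
    simp only [Pi.sub_apply]; ring
  have i3 : IntegrableOn (fun ω => ξ ω * (W (τ ω) ω - W (σ ω) ω)) A P := by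
    refine (k2.sub k1).congr (ae_of_all _ fun ω => ?_)
    simp only [Pi.sub_apply]; ring
  refine ⟨i3, ?_⟩
  have z1 := S.bm.setIntegral_mul_later S.hσ S.hθ S.le_trans hξ S.hA i1
  have z2 := S.bm.setIntegral_mul_later S.hτ S.hθ' S.le₂ hξτ S.hA' i2
  have : ∫ ω in A, ξ ω * (W (τ ω) ω - W (σ ω) ω) ∂P =
      ∫ ω in A, ξ ω * (W (θ ω) ω - W (σ ω) ω) ∂P -
        ∫ ω in A, ξ ω * (W (θ ω) ω - W (τ ω) ω) ∂P := by
    rw [← integral_sub i1 i2]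
    refine integral_congr_ae (ae_of_all _ fun ω => ?_)
    ring
  rw [this, z1, z2, sub_zero]

/-- The deficit `((β - y²)⁺)²`, six times the gap between `y⁴/6 - β y²/3` and its convex hull. -/
noncomputable def _root_.RemoteEstimation.gap (β y : ℝ) : ℝ := (max (β - y ^ 2) 0) ^ 2

lemma _root_.RemoteEstimation.gap_nonneg (β y : ℝ) : 0 ≤ gap β y := sq_nonneg _

lemma _root_.RemoteEstimation.gap_le {β : ℝ} (hβ : 0 ≤ β) (y : ℝ) : gap β y ≤ β ^ 2 := by
  unfold gap
  have : max (β - y ^ 2) 0 ≤ β := max_le (by nlinarith [sq_nonneg y]) hβ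
  gcongr

lemma _root_.RemoteEstimation.continuous_gap (β : ℝ) : Continuous (gap β) := by
  unfold gap; fun_prop

/-- Supporting lines of the convex minorant of z⁴/6 − βz²/3. For y² ≤ β the minorant is the constant
−β²/6, the minimum attained at z² = β; for other y it is the function itself, supported by its
tangent. -/
lemma _root_.RemoteEstimation.tangent_le (β y z : ℝ) :
    y ^ 4 / 6 - β * y ^ 2 / 3 - gap β y / 6 +
      (if y ^ 2 ≤ β then 0 else 2 / 3 * (y ^ 3 - β * y)) * (z - y) ≤ z ^ 4 / 6 - β * z ^ 2 / 3 := by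
  unfold gap
  split_ifs with h
  · rw [max_eq_left (by linarith)]
    nlinarith [sq_nonneg (z ^ 2 - β)]
  · push Not at h
    rw [max_eq_right (by linarith)]
    have h1 : z ^ 4 / 6 - β * z ^ 2 / 3 - (y ^ 4 / 6 - β * y ^ 2 / 3) -
        2 / 3 * (y ^ 3 - β * y) * (z - y) =
        (z - y) ^ 2 * ((z + y) ^ 2 + 2 * (y ^ 2 - β)) / 6 := by ring
    have h2 : 0 ≤ (z - y) ^ 2 * ((z + y) ^ 2 + 2 * (y ^ 2 - β)) / 6 := by
      have : 0 ≤ y ^ 2 - β := by linarith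
      positivity
    linarith

/-- Waiting from `σ` to `τ` cannot beat the convexified terminal cost. -/
lemma gap_le_wait (S : Sandwich P 𝓖 W σ τ θ a A N) {β : ℝ} (hβ : 0 ≤ β) :
    - (∫ ω in A, gap β (W (σ ω) ω - a ω) ∂P) / 6 ≤
      (∫ ω in A, (W (τ ω) ω - a ω) ^ 4 ∂P - ∫ ω in A, (W (σ ω) ω - a ω) ^ 4 ∂P) / 6 -
        β / 3 * ∫ ω in A, (τ ω - σ ω : ℝ) ∂P := by
  -- The slope of the supporting line at y is known at σ, so the linear term of `tangent_le`
  -- integrates to zero.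
  set ξ : Ω → ℝ := fun ω => if (W (σ ω) ω - a ω) ^ 2 ≤ β then 0 else
    2 / 3 * ((W (σ ω) ω - a ω) ^ 3 - β * (W (σ ω) ω - a ω)) with hξdef
  have hy : Measurable[S.hσ.measurableSpace] (fun ω => W (σ ω) ω - a ω) :=
    (S.bm.measurable_eval_past S.hσ).sub S.ha
  have hf : Measurable (fun y : ℝ => if y ^ 2 ≤ β then 0 else 2 / 3 * (y ^ 3 - β * y)) :=
    Measurable.ite (measurableSet_le (by fun_prop) (by fun_prop)) (by fun_prop) (by fun_prop)
  have hξ : Measurable[S.hσ.measurableSpace] ξ := hf.comp hy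
  have hb : ∀ ω, |ξ ω| ≤ |W (σ ω) ω - a ω| ^ 3 := fun ω => by
    simp only [hξdef]
    split_ifs with h
    · simp
    · push Not at h
      set y := W (σ ω) ω - a ω
      have e : 2 / 3 * (y ^ 3 - β * y) = 2 / 3 * (y ^ 2 - β) * y := by ring
      have e2 : |y| ^ 3 = y ^ 2 * |y| := by rw [← sq_abs]; ring
      rw [e, e2, abs_mul, abs_of_nonneg (by linarith)]
      gcongr
      linarith
  obtain ⟨i1, z1⟩ := S.integral_mul_increment hξ hb
  have ig : IntegrableOn (fun ω => gap β (W (σ ω) ω - a ω)) A P := by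
    refine S.integrable_bounded
      ((continuous_gap β).measurable.comp (S.measurable_diff S.hσ.measurable)) (β ^ 2) fun ω _ => ?_
    rw [abs_of_nonneg (gap_nonneg _ _)]
    exact gap_le hβ _
  have j0 : IntegrableOn (fun ω => (W (σ ω) ω - a ω) ^ 4 / 6 - β * (W (σ ω) ω - a ω) ^ 2 / 3) A P :=
    (S.integrable_start.div_const 6).sub ((S.integrable_start_sq.const_mul β).div_const 3)
  have j1 : IntegrableOn (fun ω => (W (σ ω) ω - a ω) ^ 4 / 6 - β * (W (σ ω) ω - a ω) ^ 2 / 3 -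
      gap β (W (σ ω) ω - a ω) / 6) A P := j0.sub (ig.div_const 6)
  have j2 : IntegrableOn (fun ω => (W (τ ω) ω - a ω) ^ 4 / 6 - β * (W (τ ω) ω - a ω) ^ 2 / 3) A P :=
    (S.integrable_mid.div_const 6).sub ((S.integrable_mid_sq.const_mul β).div_const 3)
  have mono := integral_mono (j1.add i1) j2 fun ω => by
    have := tangent_le β (W (σ ω) ω - a ω) (W (τ ω) ω - a ω)
    have e : W (τ ω) ω - a ω - (W (σ ω) ω - a ω) = W (τ ω) ω - W (σ ω) ω := by ring
    rw [e] at this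
    exact this
  rw [integral_add' j1 i1, z1,
    integral_sub j0 (ig.div_const 6),
    integral_sub (S.integrable_start.div_const 6) ((S.integrable_start_sq.const_mul β).div_const 3),
    integral_sub (S.integrable_mid.div_const 6) ((S.integrable_mid_sq.const_mul β).div_const 3)]
    at mono
  simp only [integral_div, integral_const_mul] at mono
  have := S.integral_sq
  rw [this] at mono
  linarith

/-- Second moment of the waiting time, for a deterministic horizon. -/
lemma integral_wait_sq (S : Sandwich P 𝓖 W σ τ θ a A N) (hN : ∀ ω, (θ ω : ℝ) - σ ω = N) :
    3 * ∫ ω in A, (τ ω - σ ω : ℝ) ^ 2 ∂P ≤ ∫ ω in A, (W (σ ω) ω - a ω) ^ 4 ∂P +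
      6 * ∫ ω in A, (W (τ ω) ω - a ω) ^ 2 * (τ ω - σ ω : ℝ) ∂P := by
  have mτ := S.hτ.measurable
  have mσ := S.hσ.measurable
  have m2 := S.measurable_diff mτ
  -- With constant horizon N the terms in N cancel by `integral_sq`. What remains is E[y⁴] = E[z⁴] −
  -- 6E[z²w] + 3E[w²] on A, where w = τ − σ; then E[z⁴] ≥ 0 is dropped.
  have e := S.pow_four_start.symm.trans S.pow_four_mid
  have hw : ∀ ω, (θ ω : ℝ) - τ ω = N - (τ ω - σ ω) := fun ω => by linarith [hN ω]
  simp only [hN, hw] at e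
  have iw2 : IntegrableOn (fun ω => (τ ω - σ ω : ℝ) ^ 2) A P := by
    refine S.integrable_bounded (by fun_prop) (N ^ 2) fun ω hω => ?_
    have := S.bounds hω
    rw [abs_of_nonneg (by positivity)]
    have : (τ ω : ℝ) - σ ω ≤ N := by linarith
    gcongr
    linarith
  have izw : IntegrableOn (fun ω => (W (τ ω) ω - a ω) ^ 2 * (τ ω - σ ω : ℝ)) A P := by
    refine Integrable.mono' (S.integrable_mid_sq.mul_const N)
      (by fun_prop : Measurable _).aestronglyMeasurable ?_
    filter_upwards [ae_restrict_mem S.measurableSet] with ω hω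
    have := S.bounds hω
    rw [Real.norm_of_nonneg (by have := this.2.1; positivity)]
    gcongr
    linarith
  have e1 : ∫ ω in A, ((W (σ ω) ω - a ω) ^ 4 + 6 * (W (σ ω) ω - a ω) ^ 2 * N + 3 * N ^ 2) ∂P =
      ∫ ω in A, (W (σ ω) ω - a ω) ^ 4 ∂P + 6 * N * ∫ ω in A, (W (σ ω) ω - a ω) ^ 2 ∂P +
        ∫ _ in A, 3 * N ^ 2 ∂P := by
    rw [← integral_const_mul, ← integral_add' S.integrable_start (S.integrable_start_sq.const_mul _),
      ← integral_add' (S.integrable_start.add (S.integrable_start_sq.const_mul _))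
        (integrable_const _)]
    refine integral_congr_ae (ae_of_all _ fun ω => ?_)
    simp only [Pi.add_apply]; ring
  have e2 : ∫ ω in A, ((W (τ ω) ω - a ω) ^ 4 + 6 * (W (τ ω) ω - a ω) ^ 2 * (N - (τ ω - σ ω)) +
        3 * (N - (τ ω - σ ω)) ^ 2) ∂P =
      (((∫ ω in A, (W (τ ω) ω - a ω) ^ 4 ∂P + 6 * N * ∫ ω in A, (W (τ ω) ω - a ω) ^ 2 ∂P +
        ∫ _ in A, 3 * N ^ 2 ∂P) + -6 * ∫ ω in A, (W (τ ω) ω - a ω) ^ 2 * (τ ω - σ ω : ℝ) ∂P) +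
        -6 * N * ∫ ω in A, (τ ω - σ ω : ℝ) ∂P) + 3 * ∫ ω in A, (τ ω - σ ω : ℝ) ^ 2 ∂P := by
    have a1 := S.integrable_mid.add (S.integrable_mid_sq.const_mul (6 * N))
    have a2 := a1.add (integrable_const (3 * N ^ 2))
    have a3 := a2.add (izw.const_mul (-6))
    have a4 := a3.add (S.integrable_wait.const_mul (-6 * N))
    rw [← integral_const_mul, ← integral_const_mul, ← integral_const_mul, ← integral_const_mul,
      ← integral_add' S.integrable_mid (S.integrable_mid_sq.const_mul _),
      ← integral_add' a1 (integrable_const _), ← integral_add' a2 (izw.const_mul _),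
      ← integral_add' a3 (S.integrable_wait.const_mul _), ← integral_add' a4 (iw2.const_mul _)]
    refine integral_congr_ae (ae_of_all _ fun ω => ?_)
    simp only [Pi.add_apply]; ring
  have e3 := S.integral_sq
  have p : 0 ≤ ∫ ω in A, (W (τ ω) ω - a ω) ^ 4 ∂P :=
    integral_nonneg fun ω => by positivity
  rw [e1, e2, e3] at e
  nlinarith

end Sandwich

end Sandwich

/-! ### Independence and completion of σ-algebras -/

section Independence

variable {Ω : Type*} {mΩ : MeasurableSpace Ω} {P : Measure Ω}

/-- Independence of `a ∨ b` and `c` from successive independence. -/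
lemma Indep.sup_of_sup [IsProbabilityMeasure P] {a b c : MeasurableSpace Ω} (ha : a ≤ mΩ)
    (hb : b ≤ mΩ) (hc : c ≤ mΩ) (hac : Indep a c P) (h : Indep (a ⊔ c) b P) :
    Indep (a ⊔ b) c P := by
  have e : a ⊔ b = MeasurableSpace.generateFrom
      {s | ∃ u v, MeasurableSet[a] u ∧ MeasurableSet[b] v ∧ s = u ∩ v} := by
    refine le_antisymm (sup_le (fun u hu => ?_) (fun v hv => ?_)) ?_
    · exact MeasurableSpace.measurableSet_generateFrom ⟨u, Set.univ, hu, MeasurableSet.univ, by simp⟩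
    · exact MeasurableSpace.measurableSet_generateFrom ⟨Set.univ, v, MeasurableSet.univ, hv, by simp⟩
    · refine MeasurableSpace.generateFrom_le ?_
      rintro s ⟨u, v, hu, hv, rfl⟩
      have h1 : MeasurableSet[a ⊔ b] u := (le_sup_left : a ≤ a ⊔ b) _ hu
      have h2 : MeasurableSet[a ⊔ b] v := (le_sup_right : b ≤ a ⊔ b) _ hv
      exact h1.inter h2
  refine IndepSets.indep (p2 := {s | MeasurableSet[c] s}) (sup_le ha hb) hc ?_
    (@MeasurableSpace.isPiSystem_measurableSet _ c) e
    (@MeasurableSpace.generateFrom_measurableSet _ c).symm ?_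
  · rintro s ⟨u, v, hu, hv, rfl⟩ s' ⟨u', v', hu', hv', rfl⟩ -
    exact ⟨u ∩ u', v ∩ v', hu.inter hu', hv.inter hv', by rw [Set.inter_inter_inter_comm]⟩
  · rw [IndepSets_iff]
    rintro s t ⟨u, v, hu, hv, rfl⟩ ht
    rw [Indep_iff] at hac h
    have hu' : MeasurableSet[a ⊔ c] u := (le_sup_left : a ≤ a ⊔ c) _ hu
    have ht' : MeasurableSet[a ⊔ c] t := (le_sup_right : c ≤ a ⊔ c) _ ht
    rw [h u v hu' hv, show u ∩ v ∩ t = (u ∩ t) ∩ v by rw [Set.inter_right_comm],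
      h _ v (hu'.inter ht') hv, hac u t hu ht]
    ring

/-- The measurable sets that are almost surely equal to a set of `m`. -/
@[reducible] def completed (P : Measure Ω) (m : MeasurableSpace Ω) : MeasurableSpace Ω :=
  eventuallyMeasurableSpace m (ae P) ⊓ mΩ

lemma measurableSet_completed {m : MeasurableSpace Ω} {A : Set Ω} :
    MeasurableSet[completed P m] A ↔ (∃ B, MeasurableSet[m] B ∧ A =ᵐ[P] B) ∧ MeasurableSet[mΩ] A :=
  MeasurableSpace.measurableSet_inf

lemma completed_mono {m m' : MeasurableSpace Ω} (h : m ≤ m') : completed P m ≤ completed P m' :=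
  fun _ hA => by
    obtain ⟨⟨B, hB, e⟩, hA⟩ := measurableSet_completed.1 hA
    exact measurableSet_completed.2 ⟨⟨B, h _ hB, e⟩, hA⟩

lemma le_completed {m : MeasurableSpace Ω} (h : m ≤ mΩ) : m ≤ completed P m :=
  fun A hA => measurableSet_completed.2 ⟨⟨A, hA, ae_eq_refl _⟩, h _ hA⟩

lemma completed_le {m : MeasurableSpace Ω} : completed P m ≤ mΩ := inf_le_right

lemma Indep.completed {m m' : MeasurableSpace Ω} (h : Indep m m' P) :
    Indep (completed P m) (completed P m') P := by
  rw [Indep_iff] at h ⊢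
  intro A A' hA hA'
  obtain ⟨⟨B, hB, e⟩, -⟩ := measurableSet_completed.1 hA
  obtain ⟨⟨B', hB', e'⟩, -⟩ := measurableSet_completed.1 hA'
  rw [measure_congr (e.inter e'), measure_congr e, measure_congr e', h B B' hB hB']

end Independence

/-- The standing assumptions on signal and transmission times, with every path of the signal
continuous, unbounded and started at zero. -/
structure Model {Ω : Type*} [MeasurableSpace Ω] (P : Measure Ω) (W : ℝ≥0 → Ω → ℝ)
    (Y : ℕ → Ω → ℝ≥0) : Prop where
  cont : ∀ ω, Continuous (W · ω)
  zero : ∀ ω, W 0 ω = 0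
  unbounded : ∀ ω c, ∃ t, c < |W t ω|
  measW : ∀ t, Measurable (W t)
  pre : IsPreBrownianReal W P
  measY : ∀ i, Measurable (Y i)
  indepY : iIndepFun (fun i => Y (i + 1)) P
  identY : ∀ i, IdentDistrib (Y (i + 1)) (Y 1) P P
  sqY : ∫⁻ ω, (Y 1 ω : ℝ≥0∞) ^ 2 ∂P < ∞
  indepWY : IndepFun (fun ω t => W t ω) (fun ω i => Y (i + 1) ω) P

/-! ### The signal's filtration enlarged by transmission times; causality -/

section History

variable {Ω : Type*} {mΩ : MeasurableSpace Ω} {P : Measure Ω} {W : ℝ≥0 → Ω → ℝ}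
  {Y : ℕ → Ω → ℝ≥0}

/-- The σ-algebra of the first `n` transmission times. -/
@[reducible] def services (Y : ℕ → Ω → ℝ≥0) (n : ℕ) : MeasurableSpace Ω :=
  ⨆ j < n, MeasurableSpace.comap (Y (j + 1)) inferInstance

/-- The σ-algebra of the signal up to time `t`. -/
@[reducible] def signal (W : ℝ≥0 → Ω → ℝ) (t : ℝ≥0) : MeasurableSpace Ω :=
  ⨆ s ≤ t, MeasurableSpace.comap (W s) inferInstance

/-- The completed right-continuous filtration of the signal, initially enlarged by the first `n`
transmission times. -/
def history (P : Measure Ω) (W : ℝ≥0 → Ω → ℝ) (Y : ℕ → Ω → ℝ≥0) (n : ℕ) : Filtration ℝ≥0 mΩ where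
  seq t := ⨅ u > t, completed P (signal W u ⊔ services Y n)
  mono' s t hst := le_iInf₂ fun u hu => iInf₂_le u (lt_of_le_of_lt hst hu)
  le' t := (iInf₂_le (t + 1) (by simp)).trans completed_le

/-- The completed σ-algebra of the entire signal and the first `n` transmission times. -/
@[reducible] def total (P : Measure Ω) (W : ℝ≥0 → Ω → ℝ) (Y : ℕ → Ω → ℝ≥0) (n : ℕ) :
    MeasurableSpace Ω :=
  completed P (MeasurableSpace.comap (fun ω t => W t ω) inferInstance ⊔ services Y n)

lemma measurableSet_history {n : ℕ} {t : ℝ≥0} {A : Set Ω} :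
    MeasurableSet[history P W Y n t] A ↔
      ∀ u > t, MeasurableSet[completed P (signal W u ⊔ services Y n)] A := by
  change MeasurableSet[⨅ u > t, completed P (signal W u ⊔ services Y n)] A ↔ _
  simp only [MeasurableSpace.measurableSet_iInf]

lemma comap_le_signal {s t : ℝ≥0} (h : s ≤ t) :
    MeasurableSpace.comap (W s) inferInstance ≤ signal W t :=
  le_iSup₂ (f := fun s (_ : s ≤ t) => MeasurableSpace.comap (W s) inferInstance) s h

lemma comap_le_services {j n : ℕ} (h : j < n) :
    MeasurableSpace.comap (Y (j + 1)) inferInstance ≤ services Y n :=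
  le_iSup₂ (f := fun j (_ : j < n) => MeasurableSpace.comap (Y (j + 1)) inferInstance) j h

lemma services_mono {m n : ℕ} (h : m ≤ n) : services Y m ≤ services Y n :=
  iSup₂_le fun _ hu => comap_le_services (hu.trans_le h)

lemma signal_le_comap (t : ℝ≥0) :
    signal W t ≤ MeasurableSpace.comap (fun ω t => W t ω) inferInstance := by
  refine iSup₂_le fun u _ => ?_
  rintro _ ⟨B, hB, rfl⟩
  exact ⟨(fun f : ℝ≥0 → ℝ => f u) ⁻¹' B, measurable_pi_apply u hB, rfl⟩

lemma services_le_comap (n : ℕ) :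
    services Y n ≤ MeasurableSpace.comap (fun ω i => Y (i + 1) ω) inferInstance := by
  refine iSup₂_le fun u _ => ?_
  rintro _ ⟨B, hB, rfl⟩
  exact ⟨(fun f : ℕ → ℝ≥0 => f u) ⁻¹' B, measurable_pi_apply u hB, rfl⟩

lemma history_mono {m n : ℕ} (h : m ≤ n) (t : ℝ≥0) : history P W Y m t ≤ history P W Y n t :=
  le_iInf₂ fun u hu => (iInf₂_le u hu).trans
    (completed_mono (sup_le_sup_left (services_mono h) _))

lemma history_rightCont {n : ℕ} {t : ℝ≥0} {A : Set Ω}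
    (h : ∀ u > t, MeasurableSet[history P W Y n u] A) : MeasurableSet[history P W Y n t] A := by
  have : ⨅ u > t, history P W Y n u ≤ history P W Y n t := by
    refine le_iInf₂ fun u hu => ?_
    obtain ⟨v, hv, hv'⟩ := exists_between hu
    exact (iInf₂_le v hv).trans (iInf₂_le u hv')
  refine this _ ?_
  simpa only [MeasurableSpace.measurableSet_iInf] using h

/-- This is the purpose of the completion: causality describes the sampling times only up to null
events. -/
lemma history_congr {n : ℕ} {t : ℝ≥0} {A B : Set Ω} (hA : MeasurableSet A)
    (hB : MeasurableSet[history P W Y n t] B) (h : A =ᵐ[P] B) :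
    MeasurableSet[history P W Y n t] A := by
  rw [measurableSet_history] at hB ⊢
  intro u hu
  obtain ⟨⟨C, hC, e⟩, -⟩ := measurableSet_completed.1 (hB u hu)
  exact measurableSet_completed.2 ⟨⟨C, hC, h.trans e⟩, hA⟩

lemma Stops.history_mono {m n : ℕ} (h : m ≤ n) {τ : Ω → ℝ≥0} (hτ : Stops (history P W Y m) τ) :
    Stops (history P W Y n) τ :=
  stops_iff.2 fun t => RemoteEstimation.history_mono h t _ (hτ.measurableSet_le t)

namespace Model

lemma le₁ (M : Model P W Y) : MeasurableSpace.comap (fun ω t => W t ω) inferInstance ≤ mΩ :=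
  (measurable_pi_lambda _ M.measW).comap_le

lemma le₂ (M : Model P W Y) : MeasurableSpace.comap (fun ω i => Y (i + 1) ω) inferInstance ≤ mΩ :=
  (measurable_pi_lambda _ fun i => M.measY (i + 1)).comap_le

lemma past_le (M : Model P W Y) (n : ℕ) (t : ℝ≥0) : signal W t ⊔ services Y n ≤ mΩ :=
  sup_le ((signal_le_comap t).trans M.le₁) ((services_le_comap n).trans M.le₂)

lemma measurable_signal (M : Model P W Y) (n : ℕ) (t : ℝ≥0) : Measurable[history P W Y n t] (W t) := by
  refine measurable_iff_comap_le.2 (le_iInf₂ fun u hu => ?_)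
  refine le_trans ?_ (le_completed (M.past_le n u))
  exact le_trans (comap_le_signal (le_of_lt hu)) le_sup_left

lemma measurable_service (M : Model P W Y) {n j : ℕ} (hj : j < n) (t : ℝ≥0) :
    Measurable[history P W Y n t] (Y (j + 1)) := by
  refine measurable_iff_comap_le.2 (le_iInf₂ fun u hu => ?_)
  refine le_trans ?_ (le_completed (M.past_le n u))
  exact le_trans (comap_le_services hj) le_sup_right

/-- Enlargement by the transmission times does no harm, since they are independent of the whole
signal. The strict inequality s < u absorbs the right limit in the filtration. -/
lemma isBM [IsProbabilityMeasure P] (M : Model P W Y) (n : ℕ) : IsBM P (history P W Y n) W where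
  cont := M.cont
  zero := M.zero
  adapted := M.measurable_signal n
  pre := M.pre
  indep s u hsu := by
    have hinc : Measurable (fun ω t => W (u + t) ω - W u ω) :=
      measurable_pi_lambda _ fun t => (M.measW _).sub (M.measW _)
    refine indep_of_indep_of_le (m₁ := completed P (signal W u ⊔ services Y n))
      (m₂ := completed P (MeasurableSpace.comap (fun ω t => W (u + t) ω - W u ω) inferInstance))
      ?_ (iInf₂_le u hsu) (le_completed hinc.comap_le)
    refine Indep.completed ?_
    refine Indep.sup_of_sup ((signal_le_comap u).trans M.le₁) ((services_le_comap n).trans M.le₂)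
      hinc.comap_le ?_ ?_
    · have := (M.pre.indepFun_shift u).symm
      rw [IndepFun_iff_Indep] at this
      refine indep_of_indep_of_le_left this (iSup₂_le fun v hv => ?_)
      rintro _ ⟨B, hB, rfl⟩
      exact ⟨(fun f : Set.Iic u → ℝ => f ⟨v, hv⟩) ⁻¹' B, measurable_pi_apply _ hB, rfl⟩
    · have := M.indepWY
      rw [IndepFun_iff_Indep] at this
      refine indep_of_indep_of_le this (sup_le (signal_le_comap u) ?_) (services_le_comap n)
      have : Measurable (fun (f : ℝ≥0 → ℝ) t => f (u + t) - f u) := by fun_prop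
      rintro _ ⟨B, hB, rfl⟩
      exact ⟨_, this hB, rfl⟩

lemma past_le_total (_ : Model P W Y) {n : ℕ} {τ : Ω → ℝ≥0} (hτ : Stops (history P W Y n) τ) :
    hτ.measurableSpace ≤ total P W Y n := by
  refine le_trans (b := ⨆ t, history P W Y n t) (fun A hA => hA.1) (iSup_le fun t => ?_)
  refine (iInf₂_le (t + 1) (by simp)).trans ?_
  exact completed_mono (sup_le_sup_right (signal_le_comap _) _)

/-- The future of the signal also belongs to `total`, so the next transmission time is independent
of past and future signal jointly. -/
lemma measurable_incr_total (M : Model P W Y) {n : ℕ} {τ : Ω → ℝ≥0}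
    (hτ : Stops (history P W Y n) τ) : Measurable[total P W Y n] (incr W τ) := by
  have hτ' : Measurable[total P W Y n] τ :=
    hτ.measurable_past.mono (M.past_le_total hτ) le_rfl
  have hW : ∀ t, Measurable[total P W Y n] (W t) := fun t => by
    refine measurable_iff_comap_le.2 (le_trans ?_ (le_completed (sup_le M.le₁
      ((services_le_comap n).trans M.le₂))))
    refine le_trans ?_ le_sup_left
    exact le_trans (comap_le_signal le_rfl) (signal_le_comap t)
  have he := measurable_eval_time (mΩ := total P W Y n) M.cont hW
  refine @measurable_pi_lambda _ _ _ (total P W Y n) _ _ fun t => ?_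
  have h1 := he.comp ((hτ'.add_const t).prodMk measurable_id)
  have h2 := he.comp (hτ'.prodMk measurable_id)
  exact h1.sub h2

/-- The next transmission time is independent of the signal and the previous ones. -/
lemma indep_total [IsProbabilityMeasure P] (M : Model P W Y) (n : ℕ) :
    Indep (total P W Y n) (MeasurableSpace.comap (Y (n + 1)) inferInstance) P := by
  have hY : ∀ i, MeasurableSpace.comap (Y (i + 1)) inferInstance ≤ mΩ :=
    fun i => (M.measY (i + 1)).comap_le
  refine indep_of_indep_of_le_right (Indep.completed ?_) (le_completed (hY n))
  rw [sup_comm]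
  refine Indep.sup_of_sup ((services_le_comap n).trans M.le₂) M.le₁ (hY n) ?_ ?_
  · have h := indep_iSup_of_disjoint hY ((iIndepFun_iff_iIndep _ _ _).1 M.indepY)
      (S := {j | j < n}) (T := {n}) (by simp)
    simpa using h
  · have := M.indepWY.symm
    rw [IndepFun_iff_Indep] at this
    refine indep_of_indep_of_le_left this (sup_le (services_le_comap n) ?_)
    refine le_trans ?_ (services_le_comap (n + 1))
    exact comap_le_services n.lt_succ_self

/-- The next transmission time is independent of the past and the future of the signal. -/
lemma indepFun_service [IsProbabilityMeasure P] (M : Model P W Y) {n : ℕ} {E : Type*}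
    [MeasurableSpace E] {ξ : Ω → E} (hξ : Measurable[total P W Y n] ξ) :
    IndepFun ξ (Y (n + 1)) P := by
  rw [IndepFun_iff_Indep]
  exact indep_of_indep_of_le_left (M.indep_total n) hξ.comap_le

end Model

/-- Start of the transmission of sample `i + 1`. -/
def start (S Y : ℕ → Ω → ℝ≥0) (i : ℕ) (ω : Ω) : ℝ≥0 := max (S (i + 1) ω) (delivery S Y i ω)

lemma delivery_succ (S Y : ℕ → Ω → ℝ≥0) (i : ℕ) (ω : Ω) :
    delivery S Y (i + 1) ω = start S Y i ω + Y (i + 1) ω := rfl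

lemma delivery_le_start (S Y : ℕ → Ω → ℝ≥0) (i : ℕ) (ω : Ω) :
    delivery S Y i ω ≤ start S Y i ω := le_max_right _ _

lemma start_le_delivery (S Y : ℕ → Ω → ℝ≥0) (i : ℕ) (ω : Ω) :
    start S Y i ω ≤ delivery S Y (i + 1) ω := le_self_add

lemma delivery_mono (S Y : ℕ → Ω → ℝ≥0) (ω : Ω) : Monotone (fun i => delivery S Y i ω) :=
  monotone_nat_of_le_succ fun i => (delivery_le_start S Y i ω).trans (start_le_delivery S Y i ω)

lemma le_delivery (S Y : ℕ → Ω → ℝ≥0) (i : ℕ) (ω : Ω) : S (i + 1) ω ≤ delivery S Y (i + 1) ω :=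
  (le_max_left _ _).trans (start_le_delivery S Y i ω)

/-- Sampling, starting and delivery times of a causal policy are stopping times. -/
structure Timed (P : Measure Ω) (W : ℝ≥0 → Ω → ℝ) (Y S : ℕ → Ω → ℝ≥0) : Prop where
  sampling : ∀ i, Stops (history P W Y i) (S (i + 1))
  deliv : ∀ i, Stops (history P W Y i) (delivery S Y i)

lemma Timed.starting {S : ℕ → Ω → ℝ≥0} (h : Timed P W Y S) (i : ℕ) :
    Stops (history P W Y i) (start S Y i) := (h.sampling i).max (h.deliv i)

/-- In the history with index i + 1 the transmission time of sample i + 1 is known from time 0, so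
the delivery time is determined at the start of the transmission. -/
lemma Model.stops_delivery (M : Model P W Y) {S : ℕ → Ω → ℝ≥0} {i : ℕ}
    (h1 : Stops (history P W Y i) (S (i + 1))) (h2 : Stops (history P W Y i) (delivery S Y i)) :
    Stops (history P W Y (i + 1)) (delivery S Y (i + 1)) := by
  have h3 : Stops (history P W Y (i + 1)) (RemoteEstimation.start S Y i) :=
    (h1.max h2).history_mono i.le_succ
  refine h3.of_past ?_ (start_le_delivery S Y i)
  exact h3.measurable_past.add
    ((M.measurable_service i.lt_succ_self 0).mono h3.zero_le_past le_rfl)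

/-- By induction, earlier sampling times and the channel state are determined by the signal and the
first i transmission times, so `history` with index i contains all the information for sample i + 1.
Revealing these i times in advance only weakens the requirement; the next transmission time stays
unknown. -/
lemma Model.timed (M : Model P W Y) {S : ℕ → Ω → ℝ≥0} (hm : ∀ i, Measurable (S i))
    (h0 : ∀ᵐ ω ∂P, S 0 ω = 0) (hc : IsCausal P W Y S) : Timed P W Y S := by
  have key : ∀ i, Stops (history P W Y i) (S i) ∧ Stops (history P W Y i) (S (i + 1)) ∧
      Stops (history P W Y i) (delivery S Y i) := by
    intro i
    induction i using Nat.strong_induction_on with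
    | _ i ih =>
      have hS : ∀ j ≤ i, Stops (history P W Y i) (S j) := by
        intro j hj
        rcases j with _ | j
        · refine stops_iff.2 fun t => history_congr (B := Set.univ) (hm 0 measurableSet_Iic)
            MeasurableSet.univ ?_
          filter_upwards [h0] with ω hω
          exact propext ⟨fun _ => trivial, fun _ => show S 0 ω ≤ t by rw [hω]; exact zero_le⟩
        · exact (ih j hj).2.1.history_mono (Nat.le_of_lt hj)
      have hD : ∀ j ≤ i, Stops (history P W Y i) (delivery S Y j) := by
        intro j hj
        rcases j with _ | j
        · exact stops_const 0
        · exact (M.stops_delivery (ih j hj).2.1 (ih j hj).2.2).history_mono hj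
      refine ⟨hS i le_rfl, ?_, hD i le_rfl⟩
      have hinfo : ∀ u, info W S Y (i + 1) u ≤ history P W Y i u := by
        intro u
        refine sup_le (sup_le (iSup₂_le fun s hs => ?_) ?_) ?_
        · exact ((M.measurable_signal i s).mono ((history P W Y i).mono hs) le_rfl).comap_le
        · refine MeasurableSpace.generateFrom_le ?_
          rintro A ⟨s, hs, rfl⟩
          refine (history P W Y i).mono hs _ ?_
          have : busyBefore S Y (i + 1) s
              = ⋃ j, ⋃ (_ : j < i + 1), ({ω | S j ω ≤ s} ∩ {ω | delivery S Y j ω ≤ s}ᶜ) := by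
            ext ω; simp only [busyBefore, Set.mem_ofPred_eq, Set.mem_iUnion, Set.mem_inter_iff, Set.mem_compl_iff, not_le]
            exact ⟨fun ⟨j, h1, h2⟩ => ⟨j, h1, h2⟩, fun ⟨j, h1, h2⟩ => ⟨j, h1, h2⟩⟩
          rw [this]
          refine MeasurableSet.iUnion fun j => MeasurableSet.iUnion fun hj => ?_
          exact ((hS j (Nat.le_of_lt_succ hj)).measurableSet_le s).inter
            ((hD j (Nat.le_of_lt_succ hj)).measurableSet_le s).compl
        · refine MeasurableSpace.generateFrom_le ?_
          rintro A ⟨s, hs, j, hj, rfl⟩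
          exact (history P W Y i).mono hs _ ((hS j (Nat.le_of_lt_succ hj)).measurableSet_le s)
      refine stops_iff.2 fun t => ?_
      obtain ⟨A, hA, hAt⟩ := hc (i + 1) t
      refine history_congr (hm _ measurableSet_Iic) (history_rightCont fun u hu => ?_) hAt
      simp only [MeasurableSpace.measurableSet_iInf] at hA
      exact hinfo u _ (hA u hu)
  exact ⟨fun i => (key i).2.1, fun i => (key i).2.2⟩

end History

/-! ### Regeneration and the number of samples -/

section Renewal

variable {Ω : Type*} {mΩ : MeasurableSpace Ω} {P : Measure Ω}

/-- Sum of the first `n` terms. -/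
def partialSum (x : ℕ → ℝ≥0) (n : ℕ) : ℝ≥0 := ∑ l ∈ Finset.range n, x l

lemma measurable_partialSum (n : ℕ) : Measurable (fun x => partialSum x n) :=
  Finset.measurable_sum _ fun l _ => measurable_pi_apply l

lemma partialSum_add (x : ℕ → ℝ≥0) (d n : ℕ) :
    partialSum x (d + n) = partialSum x d + partialSum (fun i => x (d + i)) n :=
  Finset.sum_range_add x d n

lemma partialSum_mono (x : ℕ → ℝ≥0) : Monotone (partialSum x) := fun _ _ h =>
  Finset.sum_le_sum_of_subset (Finset.range_mono h)

/-- The sequence `x` regenerates after `d` terms. -/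
structure Renews (P : Measure Ω) (x : Ω → ℕ → ℝ≥0) (d : ℕ) : Prop where
  measurable : Measurable x
  ident : IdentDistrib (fun ω i => x ω (d + i)) x P P
  indep : IndepFun (fun ω i => x ω (d + i)) (fun ω (i : Fin d) => x ω i) P

variable {x : Ω → ℕ → ℝ≥0} {d : ℕ}

lemma Renews.measurable_cycle (h : Renews P x d) (n : ℕ) : Measurable (fun ω => partialSum (x ω) n) :=
  (measurable_partialSum n).comp h.measurable

/-- First-step analysis: the sequence after the first cycle is independent of that cycle and
distributed as the whole. -/
lemma Renews.prob_succ [IsProbabilityMeasure P] (h : Renews P x d) (j : ℕ) (T : ℝ≥0) :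
    P {ω | partialSum (x ω) ((j + 1) * d) ≤ T} =
      ∫⁻ ω in {ω | partialSum (x ω) d ≤ T},
        P {ω' | partialSum (x ω') (j * d) ≤ T - partialSum (x ω) d} ∂P := by
  have hc := h.measurable_cycle d
  have hs : Measurable (fun ω i => x ω (d + i)) :=
    measurable_pi_lambda _ fun i => (measurable_pi_iff.1 h.measurable _)
  have hset : MeasurableSet {p : ℝ≥0 × (ℕ → ℝ≥0) | p.1 + partialSum p.2 (j * d) ≤ T} :=
    measurableSet_le (measurable_fst.add ((measurable_partialSum _).comp measurable_snd))
      measurable_const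
  have hind : IndepFun (fun ω => partialSum (x ω) d) (fun ω i => x ω (d + i)) P := by
    have hf : Measurable (fun y : Fin d → ℝ≥0 => ∑ i, y i) :=
      Finset.measurable_sum _ fun i _ => measurable_pi_apply i
    have := (h.indep.comp measurable_id hf).symm
    have e : (fun ω => partialSum (x ω) d) = (fun y : Fin d → ℝ≥0 => ∑ i, y i) ∘
        fun ω (i : Fin d) => x ω i := by
      ext ω
      simp [partialSum, Finset.sum_range]
    rw [e]
    exact this
  have key := lintegral_of_indepFun hc hs hind
    (f := Set.indicator {p : ℝ≥0 × (ℕ → ℝ≥0) | p.1 + partialSum p.2 (j * d) ≤ T} 1)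
    (measurable_one.indicator hset)
  have hl : ∫⁻ ω, Set.indicator {p : ℝ≥0 × (ℕ → ℝ≥0) | p.1 + partialSum p.2 (j * d) ≤ T} 1
      (partialSum (x ω) d, fun i => x ω (d + i)) ∂P
      = P {ω | partialSum (x ω) ((j + 1) * d) ≤ T} := by
    rw [← lintegral_indicator_one (measurableSet_le (h.measurable_cycle _) measurable_const)]
    refine lintegral_congr fun ω => ?_
    simp only [Set.indicator, Set.mem_ofPred_eq, add_mul, one_mul, add_comm (j * d) d, partialSum_add]
    rfl
  rw [← hl, key, ← lintegral_indicator (measurableSet_le hc measurable_const)]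
  refine lintegral_congr fun ω => ?_
  have e : ∫⁻ ω', Set.indicator {p : ℝ≥0 × (ℕ → ℝ≥0) | p.1 + partialSum p.2 (j * d) ≤ T} 1
      (partialSum (x ω) d, fun i => x ω' (d + i)) ∂P
      = P {ω' | partialSum (x ω) d + partialSum (x ω') (j * d) ≤ T} := by
    have hB : MeasurableSet {y : ℕ → ℝ≥0 | partialSum (x ω) d + partialSum y (j * d) ≤ T} :=
      measurableSet_le (measurable_const.add (measurable_partialSum _)) measurable_const
    have := h.ident.measure_mem_eq hB
    refine Eq.trans ?_ this
    rw [← lintegral_indicator_one (hs hB)]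
    rfl
  rw [e]
  by_cases hω : partialSum (x ω) d ≤ T
  · rw [Set.indicator_of_mem (by exact hω)]
    congr 1
    ext ω'
    simp only [Set.mem_ofPred_eq, le_tsub_iff_left hω]
  · rw [Set.indicator_of_notMem (by exact hω)]
    convert measure_empty (μ := P)
    ext ω'
    simp only [Set.mem_ofPred_eq, Set.mem_empty_iff_false, iff_false]
    exact fun h' => hω (le_self_add.trans h')

/-- Bound on the expected number of renewals up to time `T`. -/
lemma Renews.sum_prob_le [IsProbabilityMeasure P] (h : Renews P x d) (K : ℝ≥0) (n : ℕ) (T : ℝ≥0) :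
    (∑ j ∈ Finset.range n, P {ω | partialSum (x ω) (j * d) ≤ T}) *
      ∫⁻ ω, (min (partialSum (x ω) d) K : ℝ≥0) ∂P ≤ T + K := by
  have hc := h.measurable_cycle d
  -- After a first cycle of length x ≤ T the induction hypothesis is used with T − x. Truncation at
  -- K bounds the contribution of the cycle that overshoots T.
  induction n generalizing T with
  | zero => simp
  | succ n ih =>
    have hmeas : ∀ j, Measurable (fun ω =>
        P {ω' | partialSum (x ω') (j * d) ≤ T - partialSum (x ω) d}) := fun j => by
      have hs : MeasurableSet {p : ℝ≥0 × Ω | partialSum (x p.2) (j * d) ≤ p.1} :=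
        measurableSet_le ((h.measurable_cycle _).comp measurable_snd) measurable_fst
      exact (measurable_measure_prodMk_left (ν := P) hs).comp (measurable_const.sub hc)
    have hA : MeasurableSet {ω | partialSum (x ω) d ≤ T} := measurableSet_le hc measurable_const
    have hmin : Measurable (fun ω => ((min (partialSum (x ω) d) K : ℝ≥0) : ℝ≥0∞)) :=
      (hc.min measurable_const).coe_nnreal_ennreal
    rw [Finset.sum_range_succ', add_mul]
    simp_rw [h.prob_succ]
    rw [← lintegral_finsetSum _ fun j _ => hmeas j, ← lintegral_mul_const _
      (Finset.measurable_sum _ fun j _ => hmeas j)]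
    have hle : P {ω | partialSum (x ω) (0 * d) ≤ T} = 1 := by simp [partialSum]
    rw [hle, one_mul, ← lintegral_indicator hA, ← lintegral_add_right _ hmin]
    refine (lintegral_mono (g := fun _ => ((T : ℝ≥0∞) + K)) fun ω => ?_).trans (by simp)
    beta_reduce
    by_cases hω : partialSum (x ω) d ≤ T
    · rw [Set.indicator_of_mem (by exact hω)]
      refine (add_le_add_left (ih (T - partialSum (x ω) d)) _).trans ?_
      norm_cast
      have h1 : min (partialSum (x ω) d) K ≤ partialSum (x ω) d := min_le_left _ _
      calc T - partialSum (x ω) d + K + min (partialSum (x ω) d) K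
          ≤ T - partialSum (x ω) d + K + partialSum (x ω) d := by gcongr
        _ = T + K := by rw [add_right_comm, tsub_add_cancel_of_le hω]
    · rw [Set.indicator_of_notMem (by exact hω), zero_add]
      norm_cast
      exact (min_le_right _ _).trans le_add_self

lemma Renews.lintegral_partialSum [IsProbabilityMeasure P] (h : Renews P x d) (j : ℕ) :
    ∫⁻ ω, (partialSum (x ω) (j * d) : ℝ≥0∞) ∂P = j * ∫⁻ ω, (partialSum (x ω) d : ℝ≥0∞) ∂P := by
  induction j with
  | zero => simp [partialSum]
  | succ j ih =>
    simp_rw [add_mul, one_mul, add_comm (j * d) d, partialSum_add, ENNReal.coe_add]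
    rw [lintegral_add_left (h.measurable_cycle d).coe_nnreal_ennreal]
    have := (h.ident.comp (u := fun y => (partialSum y (j * d) : ℝ≥0∞))
      (measurable_partialSum _).coe_nnreal_ennreal).lintegral_eq
    simp only [Function.comp_def] at this
    rw [this, ih]
    push_cast
    ring

/-- Consequences of regeneration: the number of samples up to a given time, and the frequency
constraint, are controlled by the mean of a cycle `X` with `d` samples. -/
lemma exists_cycle [IsProbabilityMeasure P] {S : ℕ → Ω → ℝ≥0} (hm : ∀ i, Measurable (S i))
    (hmono : ∀ᵐ ω ∂P, ∀ i, S i ω ≤ S (i + 1) ω)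
    (hr : IsRegenerative P S) :
    ∃ (k d : ℕ) (X : Ω → ℝ≥0), 0 < d ∧ Measurable X ∧ 0 < ∫⁻ ω, (X ω : ℝ≥0∞) ∂P ∧
      ∫⁻ ω, (X ω : ℝ≥0∞) ∂P < ∞ ∧
      (∀ (N : ℕ) (T K : ℝ≥0), (∑ i ∈ Finset.range N, P {ω | S i ω ≤ T}) *
        ∫⁻ ω, (min (X ω) K : ℝ≥0) ∂P ≤ k * ∫⁻ ω, (min (X ω) K : ℝ≥0) ∂P + d * (T + K)) ∧
      ∀ fmax, FrequencyConstraint P fmax S → 1 / fmax * d ≤ ∫⁻ ω, (X ω : ℝ≥0∞) ∂P := by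
  obtain ⟨k, hk, hid, hind, hk0, hsq⟩ := hr
  have hT : ∀ i, Measurable (interSampling S i) := fun i => (hm (i + 1)).sub (hm i)
  -- Only the regeneration at `k 1` relative to `k 0` is needed: the sequence from `k 0` on renews
  -- after d = k 1 − k 0 terms.
  obtain ⟨x, hx⟩ : ∃ x : Ω → ℕ → ℝ≥0, x = fun ω i => interSampling S (k 0 + i) ω := ⟨_, rfl⟩
  obtain ⟨d, hd⟩ : ∃ d, k 1 = k 0 + d := ⟨k 1 - k 0, by have := hk (show 0 < 1 by simp); omega⟩
  have hd0 : 0 < d := by have := hk (show 0 < 1 by simp); omega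
  have hR : Renews P x d := by
    refine ⟨?_, ?_, ?_⟩
    · rw [hx]; exact measurable_pi_lambda _ fun i => hT _
    · rw [hx]; simpa only [hd, add_assoc] using hid 1
    · have h1 := (hind 1).comp (ψ := fun (y : Fin (k 1) → ℝ≥0) (i : Fin d) =>
        y ⟨k 0 + i, by omega⟩) measurable_id
        (measurable_pi_lambda _ fun i => measurable_pi_apply _)
      rw [hx]
      simpa only [hd, add_assoc, Function.comp_def, id] using h1
  have hS : ∀ᵐ ω ∂P, ∀ n, S (k 0 + n) ω = S (k 0) ω + partialSum (x ω) n := by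
    filter_upwards [hmono] with ω hω n
    induction n with
    | zero => simp [partialSum]
    | succ n ih =>
      have e : partialSum (x ω) (n + 1) = partialSum (x ω) n + x ω n := Finset.sum_range_succ _ _
      rw [e, ← add_assoc (S (k 0) ω), ← ih, hx]
      simp only [interSampling]
      rw [add_tsub_cancel_of_le (hω _)]
      rfl
  have hcyc : ∀ᵐ ω ∂P, S (k 1) ω - S (k 0) ω = partialSum (x ω) d := by
    filter_upwards [hS] with ω hω
    rw [hd, hω, add_tsub_cancel_left]
  have hmean : ∀ {f : Ω → ℝ≥0}, Measurable f → ∫⁻ ω, (f ω : ℝ≥0∞) ^ 2 ∂P < ∞ →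
      ∫⁻ ω, (f ω : ℝ≥0∞) ∂P < ∞ := by
    intro f hf hf2
    refine lt_of_le_of_lt (lintegral_mono (g := fun ω => 1 + (f ω : ℝ≥0∞) ^ 2) fun ω => ?_) ?_
    · beta_reduce
      norm_cast
      rcases le_total (f ω) 1 with h1 | h1
      · exact h1.trans le_self_add
      · exact (le_self_pow h1 two_ne_zero).trans le_add_self
    · rw [lintegral_add_left measurable_const]
      simpa using hf2
  have hfin : ∫⁻ ω, (partialSum (x ω) d : ℝ≥0∞) ∂P < ∞ := by
    refine hmean (hR.measurable_cycle d) (lt_of_eq_of_lt (lintegral_congr_ae ?_) (hsq 0).2)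
    filter_upwards [hcyc] with ω hω
    rw [zero_add, hω]
  refine ⟨k 0, d, fun ω => partialSum (x ω) d, hd0, hR.measurable_cycle d, ?_, hfin, ?_, ?_⟩
  · have h1 := (hsq 0).1
    rw [zero_add] at h1
    rw [pos_iff_ne_zero] at h1 ⊢
    contrapose! h1
    rw [lintegral_eq_zero_iff (hR.measurable_cycle d).coe_nnreal_ennreal] at h1
    have hm' : Measurable (fun ω => ((S (k 1) ω - S (k 0) ω : ℝ≥0) : ℝ≥0∞) ^ 2) :=
      ((hm _).sub (hm _)).coe_nnreal_ennreal.pow_const 2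
    rw [lintegral_eq_zero_iff hm']
    filter_upwards [h1, hcyc] with ω h1 h2
    simpa [h2] using h1
  · intro N T K
    have hnum : ∑ i ∈ Finset.range N, P {ω | S i ω ≤ T} ≤
        k 0 + d * ∑ j ∈ Finset.range N, P {ω | partialSum (x ω) (j * d) ≤ T} := by
      have h1 : ∑ i ∈ Finset.range N, P {ω | S i ω ≤ T} ≤
          ∑ i ∈ Finset.range (k 0 + d * N), P {ω | S i ω ≤ T} := by
        refine Finset.sum_le_sum_of_subset (Finset.range_mono ?_)
        nlinarith
      refine h1.trans ?_
      rw [Finset.sum_range_add]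
      gcongr
      · refine (Finset.sum_le_card_nsmul _ _ 1 fun i _ => prob_le_one).trans ?_
        simp
      -- Each of the d samples of a block is at least as late as the beginning of its block.
      · have h2 : ∀ n : ℕ, ∑ i ∈ Finset.range (d * n), P {ω | S (k 0 + i) ω ≤ T} ≤
            d * ∑ j ∈ Finset.range n, P {ω | partialSum (x ω) (j * d) ≤ T} := by
          intro n
          induction n with
          | zero => simp
          | succ n ih =>
            rw [mul_add_one, Finset.sum_range_add, Finset.sum_range_succ, mul_add]
            refine add_le_add ih ?_
            refine (Finset.sum_le_card_nsmul _ _ (P {ω | partialSum (x ω) (n * d) ≤ T})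
              fun i _ => ?_).trans (by simp)
            refine measure_mono_ae ?_
            filter_upwards [hS] with ω hω h'
            have h' : S (k 0 + (d * n + i)) ω ≤ T := h'
            rw [hω] at h'
            refine le_trans (partialSum_mono (x ω) ?_) (le_add_self.trans h')
            rw [mul_comm]; omega
        exact h2 N
    calc _ ≤ (k 0 + d * ∑ j ∈ Finset.range N, P {ω | partialSum (x ω) (j * d) ≤ T}) *
          ∫⁻ ω, (min (partialSum (x ω) d) K : ℝ≥0) ∂P := by gcongr
      _ ≤ _ := by
        rw [add_mul, mul_assoc]
        gcongr
        exact hR.sum_prob_le K N T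
  · intro fmax hf
    have hE : ∀ j, ∫⁻ ω, (S (k 0 + j * d) ω : ℝ≥0∞) ∂P
        = ∫⁻ ω, (S (k 0) ω : ℝ≥0∞) ∂P + j * ∫⁻ ω, (partialSum (x ω) d : ℝ≥0∞) ∂P := by
      intro j
      rw [← hR.lintegral_partialSum, ← lintegral_add_left (hm _).coe_nnreal_ennreal]
      refine lintegral_congr_ae ?_
      filter_upwards [hS] with ω hω
      rw [hω]; push_cast; rfl
    obtain ⟨a, ha⟩ : ∃ a, a = ∫⁻ ω, (S (k 0) ω : ℝ≥0∞) ∂P := ⟨_, rfl⟩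
    obtain ⟨μ, hμ⟩ : ∃ μ, μ = ∫⁻ ω, (partialSum (x ω) d : ℝ≥0∞) ∂P := ⟨_, rfl⟩
    have haf : a ≠ ∞ := by rw [ha]; exact (hmean (hm _) hk0).ne
    rw [← ha, ← hμ] at hE
    rw [← hμ]
    have hd1 : (d : ℝ≥0∞) ≠ 0 := by exact_mod_cast hd0.ne'
    -- The lower limit is bounded by the limit along the indices k 0 + (j + 1)d, where the mean is
    -- explicit; the shift by one keeps the divisor j + 1 positive.
    have hφ : Tendsto (fun j : ℕ => k 0 + (j + 1) * d) atTop atTop :=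
      tendsto_atTop_mono (fun j => (by
        have := Nat.le_mul_of_pos_right (j + 1) hd0
        simp only [id]
        omega)) tendsto_id
    have h1 := hf.trans (liminf_le_liminf_of_le (u := fun n : ℕ =>
      (∫⁻ ω, (S n ω : ℝ≥0∞) ∂P) / (n : ℝ≥0∞)) hφ)
    have h2 : Tendsto (fun j : ℕ => a / ((j + 1 : ℕ) : ℝ≥0∞) / d + μ / d) atTop (𝓝 (μ / d)) := by
      have : Tendsto (fun j : ℕ => a / ((j + 1 : ℕ) : ℝ≥0∞)) atTop (𝓝 (a / ∞)) :=
        (ENNReal.Tendsto.const_div ENNReal.tendsto_nat_nhds_top (Or.inr haf)).comp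
          (tendsto_add_atTop_nat 1)
      rw [ENNReal.div_top] at this
      have := (ENNReal.Tendsto.div_const this (Or.inr hd1)).add_const (μ / d)
      simpa using this
    have h3 : 1 / fmax ≤ μ / d := by
      rw [← h2.liminf_eq]
      refine h1.trans ?_
      rw [← liminf_comp]
      refine liminf_le_liminf (Eventually.of_forall fun j => ?_)
      simp only [Function.comp_apply, hE]
      calc _ ≤ (a + ((j + 1 : ℕ) : ℝ≥0∞) * μ) / (((j + 1 : ℕ) : ℝ≥0∞) * d) := by
            gcongr
            push_cast
            exact le_add_self
        _ = _ := by
            rw [ENNReal.add_div, ENNReal.mul_div_mul_left _ _ (by simp) (by finiteness),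
              div_eq_mul_inv, ENNReal.mul_inv (by simp) (by simp), ← mul_assoc]
            rfl
    exact (ENNReal.le_div_iff_mul_le (Or.inl hd1) (by simp)).1 h3

end Renewal

/-! ### Anderson's inequality and the choice of the threshold -/

section Constants

variable {Ω : Type*} {mΩ : MeasurableSpace Ω} {P : Measure Ω}

/-- A centred Gaussian variable is most concentrated around zero (Anderson's inequality for `gap`). -/
lemma lintegral_gap_shift_le {β : ℝ} (hβ : 0 ≤ β) (r : ℝ≥0) (x : ℝ) :
    ∫⁻ b, ENNReal.ofReal (gap β (x + b)) ∂(gaussianReal 0 r) ≤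
      ∫⁻ b, ENNReal.ofReal (gap β b) ∂(gaussianReal 0 r) := by
  have hanti : ∀ {u v : ℝ}, u ^ 2 ≤ v ^ 2 → gap β v ≤ gap β u := fun {u v} h => by
    unfold gap
    have : max (β - v ^ 2) 0 ≤ max (β - u ^ 2) 0 := max_le_max (by linarith) le_rfl
    gcongr
  have hi : ∀ z, Integrable (fun b => gap β (z + b)) (gaussianReal 0 r) := fun z =>
    Integrable.of_bound ((continuous_gap β).comp (by fun_prop)).aestronglyMeasurable (β ^ 2)
      (ae_of_all _ fun b => by
        rw [Real.norm_of_nonneg (gap_nonneg _ _)]; exact gap_le hβ _)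
  have hi0 : Integrable (fun b => gap β b) (gaussianReal 0 r) := by simpa using hi 0
  rw [← ofReal_integral_eq_lintegral_ofReal (hi x) (ae_of_all _ fun b => gap_nonneg _ _),
    ← ofReal_integral_eq_lintegral_ofReal hi0 (ae_of_all _ fun b => gap_nonneg _ _)]
  refine ENNReal.ofReal_le_ofReal ?_
  rcases eq_or_ne r 0 with rfl | hr
  · simp only [gaussianReal_zero_var, integral_dirac]
    exact hanti (by simp; positivity)
  obtain ⟨p, hp⟩ : ∃ p, p = gaussianPDFReal 0 r := ⟨_, rfl⟩
  have hpc : Measurable p := by rw [hp]; exact measurable_gaussianPDFReal 0 r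
  have hpi : Integrable p := by rw [hp]; exact integrable_gaussianPDFReal 0 r
  have hpe : ∀ b, p (-b) = p b := fun b => by simp [hp, gaussianPDFReal]
  have hpm : ∀ {u v : ℝ}, u ^ 2 ≤ v ^ 2 → p v ≤ p u := fun {u v} h => by
    rw [hp]
    simp only [gaussianPDFReal, sub_zero]
    gcongr
  have hge : ∀ b, gap β (-b) = gap β b := fun b => by simp [gap]
  have hF : ∀ u v : ℝ, Integrable (fun b => gap β (u + b) * p (v + b)) := fun u v => by
    refine (hpi.comp_add_left v).bdd_mul (c := β ^ 2)
      ((continuous_gap β).comp (by fun_prop)).aestronglyMeasurable (ae_of_all _ fun b => ?_)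
    rw [Real.norm_of_nonneg (gap_nonneg _ _)]; exact gap_le hβ _
  have h00 := hF 0 0
  have h0x := hF 0 x
  have hx0 := hF x 0
  have hxx := hF x x
  simp only [zero_add] at h00 h0x hx0
  rw [integral_gaussianReal_eq_integral_smul hr, integral_gaussianReal_eq_integral_smul hr, ← hp]
  simp only [smul_eq_mul, mul_comm (p _)]
  have e1 : ∫ b, gap β (x + b) * p (x + b) = ∫ b, gap β b * p b :=
    integral_add_left_eq_self (fun b => gap β b * p b) x
  have e2 : ∫ b, gap β b * p (x + b) = ∫ b, gap β (x + b) * p b := by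
    rw [← integral_sub_left_eq_self (fun b => gap β b * p (x + b)) volume (-x)]
    refine integral_congr_ae (ae_of_all _ fun b => ?_)
    beta_reduce
    rw [show x + (-x - b) = -b by ring, show -x - b = -(x + b) by ring, hpe, hge]
  -- The deficit and the density both decrease in the absolute value of the argument, so their
  -- differences have the same sign. By translation and reflection the four integrals coincide in
  -- pairs.
  have hnn : 0 ≤ ∫ b, ((gap β b * p b + gap β (x + b) * p (x + b)) -
      (gap β (x + b) * p b + gap β b * p (x + b))) := by
    refine integral_nonneg fun b => ?_
    have : 0 ≤ (gap β b - gap β (x + b)) * (p b - p (x + b)) := by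
      rcases le_total (b ^ 2) ((x + b) ^ 2) with h | h
      · exact mul_nonneg (sub_nonneg.2 (hanti h)) (sub_nonneg.2 (hpm h))
      · exact mul_nonneg_of_nonpos_of_nonpos (sub_nonpos.2 (hanti h)) (sub_nonpos.2 (hpm h))
    simp only [Pi.zero_apply]
    linarith
  have j1 : Integrable (fun b => gap β b * p b + gap β (x + b) * p (x + b)) := h00.add hxx
  have j2 : Integrable (fun b => gap β (x + b) * p b + gap β b * p (x + b)) := hx0.add h0x
  rw [integral_sub j1 j2, integral_add h00 hxx, integral_add hx0 h0x,
    e1, e2] at hnn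
  linarith

/-- The threshold that balances sampling cost and frequency. -/
lemma exists_threshold [IsProbabilityMeasure P] {q : Ω → ℝ} (hqm : Measurable q) (hq0 : ∀ ω, 0 ≤ q ω)
    (hq2 : Integrable (fun ω => q ω ^ 2) P) (hpos : 0 < ∫ ω, q ω ^ 2 ∂P) (φ : ℝ) :
    ∃ β > 0, φ ≤ ∫ ω, max (q ω) β ∂P ∧
      0 ≤ 2 * β * ∫ ω, max (q ω) β ∂P - ∫ ω, max (q ω) β ^ 2 ∂P ∧
      (2 * β * ∫ ω, max (q ω) β ∂P - ∫ ω, max (q ω) β ^ 2 ∂P = 0 ∨ ∫ ω, max (q ω) β ∂P = φ) := by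
  have hq1 : Integrable q P := by
    refine ((integrable_const (1 : ℝ)).add hq2).mono' hqm.aestronglyMeasurable
      (ae_of_all _ fun ω => ?_)
    rw [Real.norm_of_nonneg (hq0 ω)]
    simp only [Pi.add_apply]
    nlinarith [sq_nonneg (q ω - 1)]
  have hM1 : ∀ β, Integrable (fun ω => max (q ω) β) P := fun β => hq1.sup (integrable_const β)
  have hM2 : ∀ β, Integrable (fun ω => max (q ω) β ^ 2) P := fun β => by
    refine ((integrable_const (β ^ 2)).add hq2).mono'
      ((hqm.max measurable_const).pow_const 2).aestronglyMeasurable (ae_of_all _ fun ω => ?_)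
    rw [Real.norm_of_nonneg (sq_nonneg _)]
    simp only [Pi.add_apply]
    rcases max_choice (q ω) β with h | h <;> rw [h] <;> nlinarith [sq_nonneg β, sq_nonneg (q ω)]
  obtain ⟨ψ, hψ⟩ : ∃ ψ : ℝ → ℝ, ψ = fun β => ∫ ω, (2 * β * max (q ω) β - max (q ω) β ^ 2) ∂P :=
    ⟨_, rfl⟩
  have hψe : ∀ β, 2 * β * ∫ ω, max (q ω) β ∂P - ∫ ω, max (q ω) β ^ 2 ∂P = ψ β := fun β => by
    rw [hψ]
    beta_reduce
    rw [integral_sub ((hM1 β).const_mul _) (hM2 β), integral_const_mul]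
  have hψi : ∀ β, Integrable (fun ω => 2 * β * max (q ω) β - max (q ω) β ^ 2) P := fun β =>
    ((hM1 β).const_mul _).sub (hM2 β)
  simp_rw [hψe]
  have hφc : ∀ B, ContinuousOn (fun β => ∫ ω, max (q ω) β ∂P) (Set.Icc 0 B) := fun B => by
    refine continuousOn_of_dominated (bound := fun ω => q ω + B)
      (fun β _ => (hM1 β).aestronglyMeasurable) (fun β hβ => ae_of_all _ fun ω => ?_)
      (hq1.add (integrable_const _)) (ae_of_all _ fun ω => by fun_prop)
    rw [Real.norm_of_nonneg (le_max_of_le_left (hq0 ω))]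
    exact max_le (by linarith [hβ.1, hβ.2]) (by linarith [hβ.2, hq0 ω])
  have hψc : ∀ B, ContinuousOn ψ (Set.Icc 0 B) := fun B => by
    rw [hψ]
    refine continuousOn_of_dominated (bound := fun ω => q ω ^ 2 + B ^ 2)
      (fun β _ => (hψi β).aestronglyMeasurable) (fun β hβ => ae_of_all _ fun ω => ?_)
      (hq2.add (integrable_const _)) (ae_of_all _ fun ω => by fun_prop)
    have h1 : β ^ 2 ≤ B ^ 2 := by have := hβ.1; have := hβ.2; gcongr
    rw [Real.norm_eq_abs, abs_le]
    rcases max_cases (q ω) β with ⟨h, h'⟩ | ⟨h, h'⟩ <;> rw [h]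
    · constructor <;> nlinarith [sq_nonneg (q ω - β), mul_nonneg hβ.1 (hq0 ω), sq_nonneg β]
    · constructor <;> nlinarith [sq_nonneg β, sq_nonneg (q ω)]
  have hψm : ∀ {β γ}, 0 ≤ β → β ≤ γ → ψ β ≤ ψ γ := fun {β γ} h0 h => by
    rw [hψ]
    refine integral_mono (hψi β) (hψi γ) fun ω => ?_
    beta_reduce
    rcases max_cases (q ω) β with ⟨e, e'⟩ | ⟨e, e'⟩ <;>
      rcases max_cases (q ω) γ with ⟨f, f'⟩ | ⟨f, f'⟩ <;> rw [e, f] <;> nlinarith [hq0 ω]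
  have hψ0 : ψ 0 < 0 := by
    have : ψ 0 = - ∫ ω, q ω ^ 2 ∂P := by
      rw [hψ, ← integral_neg]
      refine integral_congr_ae (ae_of_all _ fun ω => ?_)
      beta_reduce
      rw [max_eq_left (hq0 ω)]; ring
    linarith
  -- At c the integrand of ψ is at least c² − q², which has mean zero.
  obtain ⟨c, hc⟩ : ∃ c, c = √(∫ ω, q ω ^ 2 ∂P) := ⟨_, rfl⟩
  have hc0 : 0 ≤ c := by rw [hc]; positivity
  have hψ1 : 0 ≤ ψ c := by
    have : ∫ ω, (c ^ 2 - q ω ^ 2) ∂P ≤ ψ c := by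
      rw [hψ]
      refine integral_mono ((integrable_const _).sub hq2) (hψi c) fun ω => ?_
      beta_reduce
      rcases max_cases (q ω) c with ⟨e, e'⟩ | ⟨e, e'⟩ <;> rw [e] <;> nlinarith [hq0 ω]
    rw [integral_sub (integrable_const _) hq2, hc, Real.sq_sqrt hpos.le] at this
    simpa [hc] using this
  obtain ⟨β, ⟨hβ0, hβ1⟩, hβ⟩ := intermediate_value_Icc hc0 (hψc c) ⟨hψ0.le, hψ1⟩
  have hβp : 0 < β := lt_of_le_of_ne hβ0 (by rintro rfl; exact hψ0.ne hβ)
  -- If A at the zero β of ψ is too small for the constraint, the threshold is raised until A = φ;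
  -- monotonicity keeps ψ nonnegative.
  by_cases hle : φ ≤ ∫ ω, max (q ω) β ∂P
  · exact ⟨β, hβp, hle, hβ.ge, Or.inl hβ⟩
  · push Not at hle
    have hge : ∀ γ, γ ≤ ∫ ω, max (q ω) γ ∂P := fun γ => by
      have := integral_mono (integrable_const γ) (hM1 γ) fun ω => le_max_right (q ω) γ
      simpa using this
    have hβφ : β ≤ φ := (hge β).trans hle.le
    obtain ⟨γ, ⟨hγ0, hγ1⟩, hγ⟩ := intermediate_value_Icc hβφ
      ((hφc φ).mono (Set.Icc_subset_Icc_left hβ0)) ⟨hle.le, hge φ⟩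
    exact ⟨γ, hβp.trans_le hγ0, hγ.ge, hβ.ge.trans (hψm hβ0 hγ0), Or.inr hγ⟩

/-- The deficit in terms of the truncated square. -/
lemma gap_eq (β z : ℝ) :
    gap β z = z ^ 4 - 2 * β * z ^ 2 + (2 * β * max (z ^ 2) β - max (z ^ 2) β ^ 2) := by
  unfold gap
  rcases le_total (z ^ 2) β with h | h
  · rw [max_eq_right h, max_eq_left (by linarith)]; ring
  · rw [max_eq_left h, max_eq_right (by linarith)]; ring

end Constants

/-! ### Displacement of the signal during a transmission -/

section Service

variable {Ω : Type*} {mΩ : MeasurableSpace Ω} {P : Measure Ω} {W : ℝ≥0 → Ω → ℝ}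
  {Y : ℕ → Ω → ℝ≥0}

namespace Model

lemma measurable_first (M : Model P W Y) {n : ℕ} {τ : Ω → ℝ≥0} (hτ : Stops (history P W Y (n + 1)) τ) :
    Measurable[hτ.measurableSpace] (Y (n + 1)) :=
  (M.measurable_service n.lt_succ_self 0).mono hτ.zero_le_past le_rfl

lemma measurable_displacement [IsProbabilityMeasure P] (M : Model P W Y) :
    Measurable (fun ω => W (Y 1 ω) ω) := (M.isBM 0).measurable_eval (M.measY 1)

/-- Displacement of the signal during one transmission. -/
lemma lintegral_displacement [IsProbabilityMeasure P] (M : Model P W Y) {f : ℝ → ℝ≥0∞}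
    (hf : Measurable f) :
    ∫⁻ ω, ∫⁻ b, f b ∂(gaussianReal 0 (Y 1 ω)) ∂P = ∫⁻ ω, f (W (Y 1 ω) ω) ∂P := by
  have h0 : Stops (history P W Y 1) (fun _ => 0) := stops_const 0
  have := (M.isBM 1).lintegral_later h0 (M.measurable_first h0) (ξ := fun _ => ())
    measurable_const MeasurableSet.univ (f := fun p => f p.2) (hf.comp measurable_snd)
  simpa [M.zero] using this.symm

lemma lintegral_displacement_four [IsProbabilityMeasure P] (M : Model P W Y) :
    ∫⁻ ω, ENNReal.ofReal (W (Y 1 ω) ω ^ 4) ∂P = ∫⁻ ω, ENNReal.ofReal (3 * (Y 1 ω : ℝ) ^ 2) ∂P := by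
  rw [← M.lintegral_displacement (f := fun b => ENNReal.ofReal (b ^ 4)) (by fun_prop)]
  refine lintegral_congr fun ω => ?_
  simpa using lintegral_shift_pow_four_gaussianReal (Y 1 ω) 0

lemma lintegral_displacement_sq [IsProbabilityMeasure P] (M : Model P W Y) :
    ∫⁻ ω, ENNReal.ofReal (W (Y 1 ω) ω ^ 2) ∂P = ∫⁻ ω, ENNReal.ofReal (Y 1 ω : ℝ) ∂P := by
  rw [← M.lintegral_displacement (f := fun b => ENNReal.ofReal (b ^ 2)) (by fun_prop)]
  refine lintegral_congr fun ω => ?_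
  simpa using lintegral_shift_sq_gaussianReal (Y 1 ω) 0

lemma integrable_service_sq (M : Model P W Y) : Integrable (fun ω => (Y 1 ω : ℝ) ^ 2) P := by
  refine (lintegral_ofReal_ne_top_iff_integrable
    ((M.measY 1).coe_nnreal_real.pow_const 2).aestronglyMeasurable
    (ae_of_all _ fun ω => by positivity)).1 ?_
  convert M.sqY.ne using 2
  ext ω
  rw [ENNReal.ofReal_pow (by positivity), ENNReal.ofReal_coe_nnreal]

lemma integrable_service [IsProbabilityMeasure P] (M : Model P W Y) :
    Integrable (fun ω => (Y 1 ω : ℝ)) P := by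
  refine ((integrable_const (1 : ℝ)).add M.integrable_service_sq).mono'
    (M.measY 1).coe_nnreal_real.aestronglyMeasurable (ae_of_all _ fun ω => ?_)
  rw [Real.norm_of_nonneg (by positivity)]
  simp only [Pi.add_apply]
  nlinarith [sq_nonneg ((Y 1 ω : ℝ) - 1)]

lemma integrable_displacement_four [IsProbabilityMeasure P] (M : Model P W Y) :
    Integrable (fun ω => W (Y 1 ω) ω ^ 4) P := by
  refine (lintegral_ofReal_ne_top_iff_integrable
    (M.measurable_displacement.pow_const 4).aestronglyMeasurable
    (ae_of_all _ fun ω => by positivity)).1 ?_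
  rw [M.lintegral_displacement_four]
  exact (lintegral_ofReal_ne_top_iff_integrable
    (((M.measY 1).coe_nnreal_real.pow_const 2).const_mul 3).aestronglyMeasurable
    (ae_of_all _ fun ω => by positivity)).2 (M.integrable_service_sq.const_mul 3)

lemma integrable_displacement_sq [IsProbabilityMeasure P] (M : Model P W Y) :
    Integrable (fun ω => W (Y 1 ω) ω ^ 2) P := by
  refine ((integrable_const (1 : ℝ)).add M.integrable_displacement_four).mono'
    (M.measurable_displacement.pow_const 2).aestronglyMeasurable (ae_of_all _ fun ω => ?_)
  rw [Real.norm_of_nonneg (by positivity)]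
  simp only [Pi.add_apply]
  nlinarith [sq_nonneg (W (Y 1 ω) ω ^ 2 - 1)]

lemma integral_displacement_four [IsProbabilityMeasure P] (M : Model P W Y) :
    ∫ ω, W (Y 1 ω) ω ^ 4 ∂P = 3 * ∫ ω, (Y 1 ω : ℝ) ^ 2 ∂P := by
  rw [← integral_const_mul, integral_eq_lintegral_of_nonneg_ae (ae_of_all _ fun ω => by positivity)
    M.integrable_displacement_four.aestronglyMeasurable,
    integral_eq_lintegral_of_nonneg_ae (ae_of_all _ fun ω => by positivity)
    (M.integrable_service_sq.const_mul 3).aestronglyMeasurable, M.lintegral_displacement_four]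

lemma integral_displacement_sq [IsProbabilityMeasure P] (M : Model P W Y) :
    ∫ ω, W (Y 1 ω) ω ^ 2 ∂P = ∫ ω, (Y 1 ω : ℝ) ∂P := by
  rw [integral_eq_lintegral_of_nonneg_ae (ae_of_all _ fun ω => by positivity)
    M.integrable_displacement_sq.aestronglyMeasurable,
    integral_eq_lintegral_of_nonneg_ae (ae_of_all _ fun ω => by positivity)
    M.integrable_service.aestronglyMeasurable, M.lintegral_displacement_sq]

/-- Expected deficit after one transmission. -/
lemma integral_gap_displacement [IsProbabilityMeasure P] (M : Model P W Y) (β : ℝ) :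
    ∫ ω, gap β (W (Y 1 ω) ω) ∂P = 3 * ∫ ω, (Y 1 ω : ℝ) ^ 2 ∂P - 2 * β * ∫ ω, (Y 1 ω : ℝ) ∂P +
      (2 * β * ∫ ω, max (W (Y 1 ω) ω ^ 2) β ∂P - ∫ ω, max (W (Y 1 ω) ω ^ 2) β ^ 2 ∂P) := by
  have h4 := M.integrable_displacement_four
  have h2 := M.integrable_displacement_sq.const_mul (2 * β)
  have hM1 : Integrable (fun ω => max (W (Y 1 ω) ω ^ 2) β) P :=
    M.integrable_displacement_sq.sup (integrable_const β)
  have hM2 : Integrable (fun ω => max (W (Y 1 ω) ω ^ 2) β ^ 2) P := by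
    refine ((integrable_const (β ^ 2)).add h4).mono'
      (((M.measurable_displacement.pow_const 2).max measurable_const).pow_const 2).aestronglyMeasurable
      (ae_of_all _ fun ω => ?_)
    rw [Real.norm_of_nonneg (sq_nonneg _)]
    simp only [Pi.add_apply]
    rcases max_choice (W (Y 1 ω) ω ^ 2) β with h | h <;> rw [h] <;>
      nlinarith [sq_nonneg β, sq_nonneg (W (Y 1 ω) ω ^ 2)]
  have j1 : Integrable (fun ω => W (Y 1 ω) ω ^ 4 - 2 * β * W (Y 1 ω) ω ^ 2) P := h4.sub h2
  have j2 : Integrable (fun ω => 2 * β * max (W (Y 1 ω) ω ^ 2) β - max (W (Y 1 ω) ω ^ 2) β ^ 2) P :=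
    (hM1.const_mul _).sub hM2
  simp_rw [gap_eq]
  rw [← M.integral_displacement_four, ← M.integral_displacement_sq, ← integral_const_mul,
    ← integral_const_mul, ← integral_sub h4 h2, ← integral_sub (hM1.const_mul _) hM2,
    ← integral_add j1 j2]

/-- Independence of the next transmission time from the past. -/
lemma setIntegral_mul_service [IsProbabilityMeasure P] (M : Model P W Y) {n : ℕ} {θ : Ω → ℝ≥0}
    (hθ : Stops (history P W Y n) θ) {A : Set Ω} (hA : MeasurableSet[hθ.measurableSpace] A)
    {ξ : Ω → ℝ} (hξ : Measurable[hθ.measurableSpace] ξ) {g : ℝ≥0 → ℝ} (hg : Measurable g) :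
    ∫ ω in A, ξ ω * g (Y (n + 1) ω) ∂P = (∫ ω in A, ξ ω ∂P) * ∫ ω, g (Y 1 ω) ∂P := by
  have hAm : MeasurableSet A := hθ.measurableSpace_le _ hA
  have h1 : Measurable[total P W Y n] (A.indicator ξ) :=
    (hξ.indicator hA).mono (M.past_le_total hθ) le_rfl
  have h2 : IndepFun (A.indicator ξ) (fun ω => g (Y (n + 1) ω)) P :=
    (M.indepFun_service h1).comp measurable_id hg
  have h3 := h2.integral_fun_mul_eq_mul_integral
    ((h1.mono completed_le le_rfl).aestronglyMeasurable)
    (hg.comp (M.measY (n + 1))).aestronglyMeasurable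
  have h4 : ∫ ω, g (Y (n + 1) ω) ∂P = ∫ ω, g (Y 1 ω) ∂P :=
    ((M.identY n).comp hg).integral_eq
  rw [h4, integral_indicator hAm] at h3
  rw [← h3, ← integral_indicator hAm]
  refine integral_congr_ae (ae_of_all _ fun ω => ?_)
  by_cases h : ω ∈ A <;> simp [h]

lemma setLIntegral_mul_service [IsProbabilityMeasure P] (M : Model P W Y) {n : ℕ} {θ : Ω → ℝ≥0}
    (hθ : Stops (history P W Y n) θ) {A : Set Ω} (hA : MeasurableSet[hθ.measurableSpace] A)
    {ξ : Ω → ℝ≥0∞} (hξ : Measurable[hθ.measurableSpace] ξ) {g : ℝ≥0 → ℝ≥0∞} (hg : Measurable g) :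
    ∫⁻ ω in A, ξ ω * g (Y (n + 1) ω) ∂P = (∫⁻ ω in A, ξ ω ∂P) * ∫⁻ ω, g (Y 1 ω) ∂P := by
  have hAm : MeasurableSet A := hθ.measurableSpace_le _ hA
  have h1 : Measurable[total P W Y n] (A.indicator ξ) :=
    (hξ.indicator hA).mono (M.past_le_total hθ) le_rfl
  have h2 : IndepFun (A.indicator ξ) (fun ω => g (Y (n + 1) ω)) P :=
    (M.indepFun_service h1).comp measurable_id hg
  have h3 := lintegral_mul_eq_lintegral_mul_lintegral_of_indepFun''
    (h1.mono completed_le le_rfl).aemeasurable (hg.comp (M.measY (n + 1))).aemeasurable h2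
  have h4 : ∫⁻ ω, g (Y (n + 1) ω) ∂P = ∫⁻ ω, g (Y 1 ω) ∂P :=
    ((M.identY n).comp hg).lintegral_eq
  simp only [Function.comp_apply] at h3
  rw [h4, lintegral_indicator hAm] at h3
  rw [← h3, ← lintegral_indicator hAm]
  refine lintegral_congr fun ω => ?_
  by_cases h : ω ∈ A <;> simp [h]

lemma setLIntegral_service [IsProbabilityMeasure P] (M : Model P W Y) {n : ℕ} {θ : Ω → ℝ≥0}
    (hθ : Stops (history P W Y n) θ) {A : Set Ω} (hA : MeasurableSet[hθ.measurableSpace] A)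
    {g : ℝ≥0 → ℝ≥0∞} (hg : Measurable g) :
    ∫⁻ ω in A, g (Y (n + 1) ω) ∂P = P A * ∫⁻ ω, g (Y 1 ω) ∂P := by
  simpa using M.setLIntegral_mul_service hθ hA (ξ := fun _ => 1) measurable_const hg

end Model

end Service

/-! ### Squared error between two deliveries -/

section Stages

variable {Ω : Type*} {mΩ : MeasurableSpace Ω} {P : Measure Ω} {W : ℝ≥0 → Ω → ℝ}
  {Y S : ℕ → Ω → ℝ≥0}

/-- The value of the estimate between deliveries `i` and `i + 1`. -/
def held (W : ℝ≥0 → Ω → ℝ) (S : ℕ → Ω → ℝ≥0) (i : ℕ) (ω : Ω) : ℝ :=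
  -- The level 0 agrees with `W (S 0)` almost surely and is trivially known at delivery 0.
  if i = 0 then 0 else W (S i ω) ω

/-- End of the part before `T` of the idle period after delivery `i`. -/
def waitEnd (S Y : ℕ → Ω → ℝ≥0) (T : ℝ≥0) (i : ℕ) (ω : Ω) : ℝ≥0 :=
  max (delivery S Y i ω) (min (start S Y i ω) T)

lemma Stops.past_le_history_mono {m n : ℕ} (h : m ≤ n) {τ : Ω → ℝ≥0}
    (hτ : Stops (history P W Y m) τ) :
    hτ.measurableSpace ≤ (hτ.history_mono h).measurableSpace := by
  refine fun A hA => ⟨?_, fun t => RemoteEstimation.history_mono h _ _ (hA.2 t)⟩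
  exact (iSup_mono fun t => RemoteEstimation.history_mono h t :
    ⨆ t, history P W Y m t ≤ ⨆ t, history P W Y n t) _ hA.1

lemma IsBM.integrable_stop_pow_four [IsProbabilityMeasure P] {𝓖 : Filtration ℝ≥0 mΩ}
    (h : IsBM P 𝓖 W) {τ : Ω → ℝ≥0} (hτ : Stops 𝓖 τ) {T : ℝ≥0} (hle : ∀ ω, τ ω ≤ T) :
    Integrable (fun ω => W (τ ω) ω ^ 4) P := by
  have hS : Sandwich P 𝓖 W (fun _ => 0) τ (fun _ => T) (fun _ => 0) Set.univ T :=
    { bm := h, hσ := stops_const 0, hτ := hτ, le₁ := fun _ => zero_le, le₂ := hle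
      hθ := measurable_const, ha := measurable_const, hA := MeasurableSet.univ
      bdd := fun ω _ => by simp
      fin := by simp [h.zero] }
  simpa [IntegrableOn] using hS.integrable_mid

lemma Timed.measurableSet_delivered (h : Timed P W Y S) (i : ℕ) (T : ℝ≥0) :
    MeasurableSet[(h.deliv i).measurableSpace] {ω | delivery S Y i ω ≤ T} :=
  (h.deliv i).measurable_past measurableSet_Iic

lemma Timed.measurableSet_started (h : Timed P W Y S) (i : ℕ) (T : ℝ≥0) :
    MeasurableSet[(h.starting i).measurableSpace] {ω | start S Y i ω ≤ T} :=
  (h.starting i).measurable_past measurableSet_Iic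

lemma waitEnd_of_started {T : ℝ≥0} {i : ℕ} {ω : Ω} (h : start S Y i ω ≤ T) :
    waitEnd S Y T i ω = start S Y i ω := by
  unfold waitEnd
  rw [min_eq_left h, max_eq_right (delivery_le_start S Y i ω)]

lemma waitEnd_of_waiting {T : ℝ≥0} {i : ℕ} {ω : Ω} (h1 : delivery S Y i ω ≤ T)
    (h : T ≤ start S Y i ω) : waitEnd S Y T i ω = T := by
  unfold waitEnd
  rw [min_eq_right h, max_eq_right h1]

variable [IsProbabilityMeasure P]

lemma Timed.measurable_held (M : Model P W Y) (h : Timed P W Y S) (i : ℕ) :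
    Measurable[(h.deliv i).measurableSpace] (held W S i) := by
  rcases i with _ | i
  · exact measurable_const
  · have h1 := (h.sampling i).history_mono i.le_succ
    exact ((M.isBM (i + 1)).measurable_eval_past h1).mono
      (h1.past_mono (h.deliv (i + 1)) (le_delivery S Y i)) le_rfl

/-- On this event delivery and sampling precede T, so both may be stopped at T, and (u − v)⁴ ≤ 8(u⁴
+ v⁴). -/
lemma Timed.pow_four_lt_top (M : Model P W Y) (h : Timed P W Y S) (i : ℕ) (T : ℝ≥0) :
    ∫⁻ ω in {ω | delivery S Y i ω ≤ T},
      ENNReal.ofReal ((W (delivery S Y i ω) ω - held W S i ω) ^ 4) ∂P < ∞ := by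
  rcases i with _ | i
  · simp [delivery, held, M.zero]
  have hA : MeasurableSet {ω | delivery S Y (i + 1) ω ≤ T} :=
    (h.deliv (i + 1)).measurable measurableSet_Iic
  have h1 := (M.isBM (i + 1)).integrable_stop_pow_four ((h.deliv (i + 1)).min (stops_const T))
    (fun ω => min_le_right _ _)
  have h2 := (M.isBM i).integrable_stop_pow_four ((h.sampling i).min (stops_const T))
    (fun ω => min_le_right _ _)
  refine lt_of_le_of_lt (setLIntegral_mono' hA (g := fun ω => ENNReal.ofReal
    (8 * (W (min (delivery S Y (i + 1) ω) T) ω ^ 4 + W (min (S (i + 1) ω) T) ω ^ 4)))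
    fun ω hω => ?_) (lt_of_le_of_lt (setLIntegral_le_lintegral _ _)
      ((lintegral_ofReal_ne_top_iff_integrable ((h1.add h2).const_mul 8).aestronglyMeasurable
      (ae_of_all _ fun ω => ?_)).2 ((h1.add h2).const_mul 8)).lt_top)
  · have hω : delivery S Y (i + 1) ω ≤ T := hω
    rw [min_eq_left hω, min_eq_left ((le_delivery S Y i ω).trans hω)]
    refine ENNReal.ofReal_le_ofReal ?_
    simp only [held, Nat.add_eq_zero_iff, one_ne_zero, and_false, if_false]
    generalize W (delivery S Y (i + 1) ω) ω = u
    generalize W (S (i + 1) ω) ω = v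
    nlinarith [sq_nonneg (u ^ 2 - v ^ 2), sq_nonneg (u + v), sq_nonneg ((u + v) ^ 2), sq_nonneg (u - v),
      mul_nonneg (sq_nonneg (u + v)) (sq_nonneg (u - v)), mul_nonneg (sq_nonneg (u+v)) (sq_nonneg u),
      mul_nonneg (sq_nonneg (u+v)) (sq_nonneg v)]
  · simp only [Pi.add_apply, Pi.zero_apply]; positivity

/-- Cutting the wait at T provides a bounded horizon that is known at the delivery, so the stopping
identities apply to arbitrary waits. -/
lemma Timed.sandwich (M : Model P W Y) (h : Timed P W Y S) (i : ℕ) (T : ℝ≥0) :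
    Sandwich P (history P W Y i) W (delivery S Y i) (waitEnd S Y T i)
      (fun ω => max (delivery S Y i ω) T) (held W S i) {ω | delivery S Y i ω ≤ T} T where
  bm := M.isBM i
  hσ := h.deliv i
  hτ := (h.deliv i).max ((h.starting i).min (stops_const T))
  le₁ ω := le_max_left _ _
  le₂ ω := max_le_max le_rfl (min_le_right _ _)
  hθ := (h.deliv i).measurable_past.max measurable_const
  ha := h.measurable_held M i
  hA := h.measurableSet_delivered i T
  bdd ω hω := by
    have hω : delivery S Y i ω ≤ T := hω
    rw [max_eq_right hω]
    simp
  fin := h.pow_four_lt_top M i T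

/-- Squared error accumulated until `T` while sample `i` is the freshest one. -/
noncomputable def stageErr (W : ℝ≥0 → Ω → ℝ) (Y S : ℕ → Ω → ℝ≥0) (T : ℝ≥0) (i : ℕ) (ω : Ω) :
    ℝ≥0∞ :=
  ∫⁻ t : ℝ in Set.Icc 0 (T : ℝ), (Set.Ico (delivery S Y i ω) (delivery S Y (i + 1) ω)).indicator
    (fun s => ENNReal.ofReal ((W s ω - held W S i ω) ^ 2)) t.toNNReal

lemma sqErr_le_stageErr (W : ℝ≥0 → Ω → ℝ) (Y S : ℕ → Ω → ℝ≥0) (T : ℝ≥0) (i : ℕ) (ω : Ω)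
    {ρ : Ω → ℝ≥0} (h1 : ρ ω ≤ delivery S Y (i + 1) ω) (h2 : ρ ω ≤ T) :
    sqErr W (held W S i) (delivery S Y i) ρ ω ≤ stageErr W Y S T i ω := by
  unfold sqErr stageErr
  rw [← lintegral_indicator measurableSet_Ico, ← lintegral_indicator measurableSet_Icc]
  refine lintegral_mono fun t => ?_
  by_cases ht : t ∈ Set.Ico (delivery S Y i ω : ℝ) (ρ ω)
  · have ht0 : 0 ≤ t := le_trans (by positivity) ht.1
    have h3 : t ∈ Set.Icc 0 (T : ℝ) := ⟨ht0, ht.2.le.trans (by exact_mod_cast h2)⟩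
    have h4 : t.toNNReal ∈ Set.Ico (delivery S Y i ω) (delivery S Y (i + 1) ω) := by
      refine ⟨NNReal.le_toNNReal_of_coe_le ht.1, lt_of_lt_of_le ?_ h1⟩
      exact (Real.toNNReal_lt_iff_lt_coe ht0).2 ht.2
    rw [Set.indicator_of_mem ht, Set.indicator_of_mem h3, Set.indicator_of_mem h4]
  · rw [Set.indicator_of_notMem ht]; exact zero_le

/-- Expected squared error during a transmission, cut off at length `K`. -/
lemma Timed.lintegral_service (M : Model P W Y) (h : Timed P W Y S) (i : ℕ) (T K : ℝ≥0)
    (hi : IntegrableOn (fun ω => (W (start S Y i ω) ω - held W S i ω) ^ 2)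
      {ω | start S Y i ω ≤ T} P) :
    ∫⁻ ω in {ω | start S Y i ω ≤ T}, sqErr W (held W S i) (start S Y i)
        (fun ω => start S Y i ω + min (Y (i + 1) ω) K) ω ∂P =
      ENNReal.ofReal ((∫ ω in {ω | start S Y i ω ≤ T},
          (W (start S Y i ω) ω - held W S i ω) ^ 2 ∂P) * (∫ ω, ((min (Y 1 ω) K : ℝ≥0) : ℝ) ∂P) +
        P.real {ω | start S Y i ω ≤ T} * (∫ ω, ((min (Y 1 ω) K : ℝ≥0) : ℝ) ^ 2 / 2 ∂P)) := by
  have hG := h.starting i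
  have hG' := hG.history_mono i.le_succ
  have ha : Measurable[hG.measurableSpace] (held W S i) :=
    (h.measurable_held M i).mono ((h.deliv i).past_mono hG (delivery_le_start S Y i)) le_rfl
  have hA := h.measurableSet_started i T
  have hAm : MeasurableSet {ω | start S Y i ω ≤ T} := hG.measurableSpace_le _ hA
  have hle := hG.past_le_history_mono i.le_succ
  have hz : Measurable[hG.measurableSpace] (fun ω => (W (start S Y i ω) ω - held W S i ω) ^ 2) :=
    (((M.isBM i).measurable_eval_past hG).sub ha).pow_const 2
  rw [(M.isBM (i + 1)).lintegral_sqErr_later (θ := fun ω => start S Y i ω + min (Y (i + 1) ω) K) hG'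
    (hG'.measurable_past.add ((M.measurable_first hG').min measurable_const))
    (fun ω => le_self_add) (ha.mono hle le_rfl) (hle _ hA)]
  have e : ∀ ω, (((start S Y i ω + min (Y (i + 1) ω) K : ℝ≥0) : ℝ) - start S Y i ω)
      = ((min (Y (i + 1) ω) K : ℝ≥0) : ℝ) := fun ω => by push_cast; ring
  simp_rw [e]
  have hg1 : Measurable (fun y : ℝ≥0 => ((min y K : ℝ≥0) : ℝ)) :=
    (measurable_id.min measurable_const).coe_nnreal_real
  have hg2 : Measurable (fun y : ℝ≥0 => ((min y K : ℝ≥0) : ℝ) ^ 2 / 2) :=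
    (hg1.pow_const 2).div_const 2
  have k1 := M.setIntegral_mul_service hG hA hz hg1
  have k2 := M.setIntegral_mul_service hG hA (ξ := fun _ => 1) measurable_const hg2
  have hbd : ∀ y : ℝ≥0, ((min y K : ℝ≥0) : ℝ) ≤ K := fun y => by exact_mod_cast min_le_right _ _
  have i1 : IntegrableOn (fun ω => (W (start S Y i ω) ω - held W S i ω) ^ 2 *
      ((min (Y (i + 1) ω) K : ℝ≥0) : ℝ)) {ω | start S Y i ω ≤ T} P := by
    refine Integrable.mul_bdd (c := K) hi (hg1.comp (M.measY _)).aestronglyMeasurable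
      (ae_of_all _ fun ω => ?_)
    rw [Real.norm_of_nonneg (by positivity)]; exact hbd _
  have i2 : IntegrableOn (fun ω => (1 : ℝ) * (((min (Y (i + 1) ω) K : ℝ≥0) : ℝ) ^ 2 / 2))
      {ω | start S Y i ω ≤ T} P := by
    refine Integrable.of_bound
      ((hg2.comp (M.measY (i + 1))).const_mul 1).aestronglyMeasurable ((K : ℝ) ^ 2)
      (ae_of_all _ fun ω => ?_)
    rw [Real.norm_of_nonneg (by positivity)]
    have := hbd (Y (i + 1) ω)
    have h0 : (0 : ℝ) ≤ ((min (Y (i + 1) ω) K : ℝ≥0) : ℝ) := by positivity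
    nlinarith
  rw [← ofReal_integral_eq_lintegral_ofReal]
  · congr 1
    have k3 : P.real {ω | start S Y i ω ≤ T} = ∫ ω in {ω | start S Y i ω ≤ T}, (1 : ℝ) ∂P := by
      simp
    rw [k3, ← k1, ← k2, ← integral_add i1 i2]
    simp only [one_mul]
  · have := i1.add i2
    simp only [one_mul] at this
    exact this
  · exact ae_of_all _ fun ω => by simp only [Pi.zero_apply]; positivity

/-- Lower bound on the expected squared error of one stage. -/
lemma Timed.le_lintegral_stageErr (M : Model P W Y) (h : Timed P W Y S) (i : ℕ) (T K : ℝ≥0) {β : ℝ}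
    (hβ : 0 ≤ β) {mK wK : ℝ} (hm : mK = ∫ ω, ((min (Y 1 ω) K : ℝ≥0) : ℝ) ∂P)
    (hw : wK = ∫ ω, ((min (Y 1 ω) K : ℝ≥0) : ℝ) ^ 2 / 2 ∂P) :
    ENNReal.ofReal (
      (β / 3 + mK) * (∫ ω in {ω | delivery S Y i ω ≤ T}, (waitEnd S Y T i ω - delivery S Y i ω : ℝ) ∂P)
      + mK * (∫ ω in {ω | delivery S Y i ω ≤ T}, (W (delivery S Y i ω) ω - held W S i ω) ^ 2 ∂P)
      - (∫ ω in {ω | delivery S Y i ω ≤ T}, gap β (W (delivery S Y i ω) ω - held W S i ω) ∂P) / 6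
      - mK * (∫ ω in {ω | delivery S Y i ω ≤ T ∧ T < start S Y i ω}, (W T ω - held W S i ω) ^ 2 ∂P)
      + wK * P.real {ω | start S Y i ω ≤ T}) ≤ ∫⁻ ω, stageErr W Y S (T + K) i ω ∂P := by
  have hs := h.sandwich M i T
  have hG := h.starting i
  have hAm : MeasurableSet {ω | delivery S Y i ω ≤ T} := hs.measurableSet
  have hBm : MeasurableSet {ω | start S Y i ω ≤ T} := hG.measurable measurableSet_Iic
  have hCm : MeasurableSet {ω | delivery S Y i ω ≤ T ∧ T < start S Y i ω} :=
    hAm.inter (hG.measurable measurableSet_Ioi)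
  have hBA : {ω | start S Y i ω ≤ T} ⊆ {ω | delivery S Y i ω ≤ T} :=
    fun ω hω => (delivery_le_start S Y i ω).trans hω
  have hBC : Disjoint {ω | start S Y i ω ≤ T} {ω | delivery S Y i ω ≤ T ∧ T < start S Y i ω} :=
    Set.disjoint_left.2 fun ω h1 h2 => not_lt.2 h1 h2.2
  have hU : {ω | delivery S Y i ω ≤ T} =
      {ω | start S Y i ω ≤ T} ∪ {ω | delivery S Y i ω ≤ T ∧ T < start S Y i ω} := by
    ext ω
    simp only [Set.mem_ofPred_eq, Set.mem_union]
    constructor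
    · intro h1
      rcases le_or_gt (start S Y i ω) T with h2 | h2
      · exact Or.inl h2
      · exact Or.inr ⟨h1, h2⟩
    · rintro (h1 | h1)
      · exact hBA h1
      · exact h1.1
  have hi : IntegrableOn (fun ω => (W (start S Y i ω) ω - held W S i ω) ^ 2)
      {ω | start S Y i ω ≤ T} P := by
    refine IntegrableOn.congr_fun (hs.integrable_mid_sq.mono_set hBA) (fun ω hω => ?_) hBm
    simp only [waitEnd_of_started hω]
  have hsplit : ∫ ω in {ω | start S Y i ω ≤ T}, (W (start S Y i ω) ω - held W S i ω) ^ 2 ∂P =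
      ∫ ω in {ω | delivery S Y i ω ≤ T}, (W (waitEnd S Y T i ω) ω - held W S i ω) ^ 2 ∂P -
      ∫ ω in {ω | delivery S Y i ω ≤ T ∧ T < start S Y i ω}, (W T ω - held W S i ω) ^ 2 ∂P := by
    have hi1 := hs.integrable_mid_sq
    have hi2 := hi1.mono_set hBA
    have hi3 : IntegrableOn (fun ω => (W (waitEnd S Y T i ω) ω - held W S i ω) ^ 2)
        {ω | delivery S Y i ω ≤ T ∧ T < start S Y i ω} P := hi1.mono_set fun ω h => h.1
    have e1 := setIntegral_union hBC hCm hi2 hi3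
    rw [← hU] at e1
    have e2 := setIntegral_congr_fun (μ := P) hBm
      (f := fun ω => (W (waitEnd S Y T i ω) ω - held W S i ω) ^ 2)
      (g := fun ω => (W (start S Y i ω) ω - held W S i ω) ^ 2) fun ω hω => by
        simp only [waitEnd_of_started hω]
    have e3 := setIntegral_congr_fun (μ := P) hCm
      (f := fun ω => (W (waitEnd S Y T i ω) ω - held W S i ω) ^ 2)
      (g := fun ω => (W T ω - held W S i ω) ^ 2) fun ω hω => by
        simp only [waitEnd_of_waiting hω.1 hω.2.le]
    rw [e2, e3] at e1
    linarith
  have h1 := hs.lintegral_sqErr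
  have h2 := hs.gap_le_wait hβ
  have h3 := h.lintegral_service M i T K hi
  rw [hsplit, hs.integral_sq, ← hm, ← hw] at h3
  -- A transmission that starts by T is counted for at most K units, hence the horizon T + K.
  have hpt : ∀ ω, {ω | delivery S Y i ω ≤ T}.indicator
        (sqErr W (held W S i) (delivery S Y i) (waitEnd S Y T i)) ω +
      {ω | start S Y i ω ≤ T}.indicator (sqErr W (held W S i) (start S Y i)
        (fun ω => start S Y i ω + min (Y (i + 1) ω) K)) ω ≤ stageErr W Y S (T + K) i ω := by
    intro ω
    by_cases hB : ω ∈ {ω | start S Y i ω ≤ T}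
    · rw [Set.indicator_of_mem hB, Set.indicator_of_mem (hBA hB)]
      have hB' : start S Y i ω ≤ T := hB
      have e1 : sqErr W (held W S i) (delivery S Y i) (waitEnd S Y T i) ω =
          sqErr W (held W S i) (delivery S Y i) (start S Y i) ω := by
        simp only [sqErr, waitEnd_of_started hB']
      rw [e1, ← sqErr_add W _ (delivery_le_start S Y i ω) le_self_add]
      refine sqErr_le_stageErr W Y S (T + K) i ω ?_ ?_
      · exact add_le_add_right (min_le_left _ _) _
      · exact add_le_add hB' (min_le_right _ _)
    · rw [Set.indicator_of_notMem hB, add_zero]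
      by_cases hA : ω ∈ {ω | delivery S Y i ω ≤ T}
      · rw [Set.indicator_of_mem hA]
        have hA' : delivery S Y i ω ≤ T := hA
        have hB' : T ≤ start S Y i ω := (not_le.1 hB).le
        refine sqErr_le_stageErr W Y S (T + K) i ω ?_ ?_
        · rw [waitEnd_of_waiting hA' hB']
          exact hB'.trans (start_le_delivery S Y i ω)
        · rw [waitEnd_of_waiting hA' hB']
          exact le_self_add
      · rw [Set.indicator_of_notMem hA]; exact zero_le
  refine le_trans ?_ (lintegral_mono hpt)
  have ma : Measurable (held W S i) := hs.measurable_a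
  have ms : Measurable (sqErr W (held W S i) (delivery S Y i) (waitEnd S Y T i)) :=
    hs.bm.measurable_sqErr hs.hσ.measurable hs.hτ.measurable ma
  rw [lintegral_add_left (ms.indicator hAm), lintegral_indicator hAm, lintegral_indicator hBm, h1, h3]
  have hmono : ∀ a b c : ℝ, c ≤ a + b → ENNReal.ofReal c ≤ ENNReal.ofReal a + ENNReal.ofReal b :=
    fun a b c hc => (ENNReal.ofReal_le_ofReal hc).trans ENNReal.ofReal_add_le
  refine hmono _ _ _ ?_
  linarith

end Stages

/-! ### Summation over the stages -/

section LowerBound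

variable {Ω : Type*} {mΩ : MeasurableSpace Ω} {P : Measure Ω} {W : ℝ≥0 → Ω → ℝ}
  {Y S : ℕ → Ω → ℝ≥0}

/-- Waits and transmissions fill the time up to delivery n. It is an inequality because a
transmission in progress at T is counted in full. -/
lemma min_le_sum_stages (S Y : ℕ → Ω → ℝ≥0) (T : ℝ≥0) (n : ℕ) (ω : Ω) :
    (min T (delivery S Y n ω) : ℝ) ≤ ∑ i ∈ Finset.range n,
      ({ω | delivery S Y i ω ≤ T}.indicator
          (fun ω => (waitEnd S Y T i ω - delivery S Y i ω : ℝ)) ω +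
        {ω | start S Y i ω ≤ T}.indicator (fun ω => (Y (i + 1) ω : ℝ)) ω) := by
  induction n with
  | zero => simp [delivery]
  | succ n ih =>
    rw [Finset.sum_range_succ]
    refine le_trans ?_ (add_le_add_left ih _)
    have hD : ((delivery S Y (n + 1) ω : ℝ≥0) : ℝ) = start S Y n ω + Y (n + 1) ω := by
      rw [delivery_succ]; push_cast; rfl
    have h1 : (delivery S Y n ω : ℝ) ≤ start S Y n ω := by exact_mod_cast delivery_le_start S Y n ω
    have h0 : (0 : ℝ) ≤ Y (n + 1) ω := by positivity
    by_cases hG : start S Y n ω ≤ T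
    · have hG' : ω ∈ {ω | start S Y n ω ≤ T} := hG
      have hA' : ω ∈ {ω | delivery S Y n ω ≤ T} := (delivery_le_start S Y n ω).trans hG
      have hA : (delivery S Y n ω : ℝ) ≤ T := by exact_mod_cast hA'
      rw [Set.indicator_of_mem hG', Set.indicator_of_mem hA', waitEnd_of_started hG, min_eq_right hA]
      refine (min_le_right _ _).trans ?_
      linarith
    · have hG' : ω ∉ {ω | start S Y n ω ≤ T} := hG
      rw [Set.indicator_of_notMem hG', add_zero]
      by_cases hA : delivery S Y n ω ≤ T
      · have hA' : ω ∈ {ω | delivery S Y n ω ≤ T} := hA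
        have hA2 : (delivery S Y n ω : ℝ) ≤ T := by exact_mod_cast hA
        rw [Set.indicator_of_mem hA', waitEnd_of_waiting hA (not_le.1 hG).le, min_eq_right hA2]
        refine (min_le_left _ _).trans ?_
        linarith
      · have hA' : ω ∉ {ω | delivery S Y n ω ≤ T} := hA
        have hA2 : (T : ℝ) ≤ delivery S Y n ω := by exact_mod_cast (not_le.1 hA).le
        rw [Set.indicator_of_notMem hA', add_zero, min_eq_left hA2]
        exact min_le_left _ _

/-- Squared error at time `t`, in terms of the freshest delivered sample. -/
noncomputable def errSq (W : ℝ≥0 → Ω → ℝ) (Y S : ℕ → Ω → ℝ≥0) (t : ℝ≥0) (ω : Ω) : ℝ≥0∞ :=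
  ∑' i, (Set.Ico (delivery S Y i ω) (delivery S Y (i + 1) ω)).indicator
    (fun s => ENNReal.ofReal ((W s ω - held W S i ω) ^ 2)) t

lemma delivery_unique {t : ℝ≥0} {ω : Ω} {i j : ℕ}
    (hi : t ∈ Set.Ico (delivery S Y i ω) (delivery S Y (i + 1) ω))
    (hj : t ∈ Set.Ico (delivery S Y j ω) (delivery S Y (j + 1) ω)) : i = j := by
  by_contra h
  rcases lt_or_gt_of_ne h with h | h
  · exact absurd (hi.2.trans_le ((delivery_mono S Y ω h).trans hj.1)) (lt_irrefl t)
  · exact absurd (hj.2.trans_le ((delivery_mono S Y ω h).trans hi.1)) (lt_irrefl t)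

lemma errSq_of_mem {t : ℝ≥0} {ω : Ω} {i : ℕ}
    (hi : t ∈ Set.Ico (delivery S Y i ω) (delivery S Y (i + 1) ω)) :
    errSq W Y S t ω = ENNReal.ofReal ((W t ω - held W S i ω) ^ 2) := by
  unfold errSq
  rw [tsum_eq_single i, Set.indicator_of_mem hi]
  intro j hj
  rw [Set.indicator_of_notMem]
  exact fun h => hj (delivery_unique h hi)

lemma freshest_of_mem {t : ℝ≥0} {ω : Ω} {i : ℕ}
    (hi : t ∈ Set.Ico (delivery S Y i ω) (delivery S Y (i + 1) ω)) : freshest Y S t ω = i := by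
  unfold freshest
  have : {j | delivery S Y j ω ≤ t} = Set.Iic i := by
    ext j
    simp only [Set.mem_ofPred_eq, Set.mem_Iic]
    constructor
    · intro h
      by_contra h'
      push Not at h'
      exact absurd (hi.2.trans_le ((delivery_mono S Y ω h').trans h)) (lt_irrefl t)
    · exact fun h => (delivery_mono S Y ω h).trans hi.1
  rw [this, csSup_Iic]

lemma errSq_eq_of_mem (h0 : ∀ ω, W 0 ω = 0) {t : ℝ≥0} {ω : Ω} (hS : S 0 ω = 0) {i : ℕ}
    (hi : t ∈ Set.Ico (delivery S Y i ω) (delivery S Y (i + 1) ω)) :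
    errSq W Y S t ω = ENNReal.ofReal ((W t ω - estimate W Y S t ω) ^ 2) := by
  rw [errSq_of_mem hi, estimate, freshest_of_mem hi, held]
  split_ifs with h
  · rw [h, hS, h0]
  · rfl

/-- Deliveries might accumulate, and a time after all of them belongs to no stage. There `errSq` is
0, so lower bounds on it hold for every policy. -/
lemma errSq_le (h0 : ∀ ω, W 0 ω = 0) (t : ℝ≥0) {ω : Ω} (hS : S 0 ω = 0) :
    errSq W Y S t ω ≤ ENNReal.ofReal ((W t ω - estimate W Y S t ω) ^ 2) := by
  by_cases h : ∃ i, t ∈ Set.Ico (delivery S Y i ω) (delivery S Y (i + 1) ω)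
  · obtain ⟨i, hi⟩ := h
    exact (errSq_eq_of_mem h0 hS hi).le
  · push Not at h
    unfold errSq
    simp [Set.indicator_of_notMem (h _)]

lemma measurable_stage (hc : ∀ ω, Continuous (W · ω)) (hW : ∀ t, Measurable (W t))
    (hD : ∀ i, Measurable (delivery S Y i)) (ha : ∀ i, Measurable (held W S i)) (i : ℕ) :
    Measurable (fun p : ℝ≥0 × Ω =>
      (Set.Ico (delivery S Y i p.2) (delivery S Y (i + 1) p.2)).indicator
        (fun s => ENNReal.ofReal ((W s p.2 - held W S i p.2) ^ 2)) p.1) := by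
  have hset : MeasurableSet {p : ℝ≥0 × Ω | p.1 ∈ Set.Ico (delivery S Y i p.2)
      (delivery S Y (i + 1) p.2)} := by
    have s1 : MeasurableSet {p : ℝ≥0 × Ω | delivery S Y i p.2 ≤ p.1} :=
      measurableSet_le ((hD i).comp measurable_snd) measurable_fst
    have s2 : MeasurableSet {p : ℝ≥0 × Ω | p.1 < delivery S Y (i + 1) p.2} :=
      measurableSet_lt measurable_fst ((hD (i + 1)).comp measurable_snd)
    exact s1.inter s2
  have hf : Measurable (fun p : ℝ≥0 × Ω => ENNReal.ofReal ((W p.1 p.2 - held W S i p.2) ^ 2)) :=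
    (((measurable_eval_time hc hW).sub ((ha i).comp measurable_snd)).pow_const 2).ennreal_ofReal
  exact hf.indicator hset

lemma measurable_errSq (hc : ∀ ω, Continuous (W · ω)) (hW : ∀ t, Measurable (W t))
    (hD : ∀ i, Measurable (delivery S Y i)) (ha : ∀ i, Measurable (held W S i)) :
    Measurable (fun p : ℝ≥0 × Ω => errSq W Y S p.1 p.2) :=
  Measurable.tsum fun i => measurable_stage hc hW hD ha i

/-- Total expected squared error up to `T`. -/
noncomputable def totalErr (P : Measure Ω) (W : ℝ≥0 → Ω → ℝ) (Y S : ℕ → Ω → ℝ≥0) (T : ℝ≥0) : ℝ≥0∞ :=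
  ∫⁻ ω, (∫⁻ t : ℝ in Set.Icc 0 (T : ℝ), errSq W Y S t.toNNReal ω) ∂P

lemma totalErr_eq_tsum (hc : ∀ ω, Continuous (W · ω)) (hW : ∀ t, Measurable (W t))
    (hD : ∀ i, Measurable (delivery S Y i)) (ha : ∀ i, Measurable (held W S i)) (T : ℝ≥0) :
    totalErr P W Y S T = ∑' i, ∫⁻ ω, stageErr W Y S T i ω ∂P := by
  unfold totalErr
  have hm : ∀ i, Measurable (fun p : Ω × ℝ =>
      (Set.Ico (delivery S Y i p.1) (delivery S Y (i + 1) p.1)).indicator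
        (fun s => ENNReal.ofReal ((W s p.1 - held W S i p.1) ^ 2)) p.2.toNNReal) := fun i =>
    (measurable_stage hc hW hD ha i).comp
      ((measurable_real_toNNReal.comp measurable_snd).prodMk measurable_fst)
  have h1 : ∀ ω, ∫⁻ t : ℝ in Set.Icc 0 (T : ℝ), errSq W Y S t.toNNReal ω =
      ∑' i, stageErr W Y S T i ω := fun ω => by
    unfold errSq stageErr
    exact lintegral_tsum fun i => ((hm i).comp measurable_prodMk_left).aemeasurable
  simp_rw [h1]
  refine lintegral_tsum fun i => ?_
  exact (hm i).lintegral_prod_right'.aemeasurable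

lemma sum_le_totalErr (hc : ∀ ω, Continuous (W · ω)) (hW : ∀ t, Measurable (W t))
    (hD : ∀ i, Measurable (delivery S Y i)) (ha : ∀ i, Measurable (held W S i)) (T : ℝ≥0) (n : ℕ) :
    ∑ i ∈ Finset.range n, ∫⁻ ω, stageErr W Y S T i ω ∂P ≤ totalErr P W Y S T := by
  rw [totalErr_eq_tsum hc hW hD ha]
  exact ENNReal.sum_le_tsum _

lemma totalErr_eq_lintegral [SFinite P] (hc : ∀ ω, Continuous (W · ω)) (hW : ∀ t, Measurable (W t))
    (hD : ∀ i, Measurable (delivery S Y i)) (ha : ∀ i, Measurable (held W S i)) (T : ℝ≥0) :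
    totalErr P W Y S T = ∫⁻ t : ℝ in Set.Icc 0 (T : ℝ), (∫⁻ ω, errSq W Y S t.toNNReal ω ∂P) := by
  refine lintegral_lintegral_swap (f := fun ω (t : ℝ) => errSq W Y S t.toNNReal ω)
    (Measurable.aemeasurable ?_)
  exact (measurable_errSq hc hW hD ha).comp
      ((measurable_real_toNNReal.comp measurable_snd).prodMk measurable_fst)

lemma Timed.measurable_delivery (h : Timed P W Y S) (i : ℕ) : Measurable (delivery S Y i) :=
  (h.deliv i).measurable

variable [IsProbabilityMeasure P]

lemma Timed.measurable_held' (M : Model P W Y) (h : Timed P W Y S) (i : ℕ) :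
    Measurable (held W S i) :=
  (h.measurable_held M i).mono (h.deliv i).measurableSpace_le le_rfl

/-- The mean of `min_le_sum_stages`: a transmission time is independent of the event that its
transmission starts by T, whence the factor E[Y]. -/
lemma Timed.integral_min_le (M : Model P W Y) (h : Timed P W Y S) (T : ℝ≥0) (n : ℕ) :
    ∫ ω, (min T (delivery S Y n ω) : ℝ) ∂P ≤ ∑ i ∈ Finset.range n,
      ∫ ω in {ω | delivery S Y i ω ≤ T}, (waitEnd S Y T i ω - delivery S Y i ω : ℝ) ∂P +
      (∫ ω, (Y 1 ω : ℝ) ∂P) * ∑ i ∈ Finset.range n, P.real {ω | start S Y i ω ≤ T} := by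
  have hA : ∀ i, MeasurableSet {ω | delivery S Y i ω ≤ T} := fun i =>
    (h.sandwich M i T).measurableSet
  have hB : ∀ i, MeasurableSet {ω | start S Y i ω ≤ T} := fun i =>
    (h.starting i).measurable measurableSet_Iic
  have i1 : ∀ i, Integrable ({ω | delivery S Y i ω ≤ T}.indicator
      (fun ω => (waitEnd S Y T i ω - delivery S Y i ω : ℝ))) P := fun i =>
    (integrable_indicator_iff (hA i)).2 (h.sandwich M i T).integrable_wait
  have hYi : ∀ i, Integrable (fun ω => (Y (i + 1) ω : ℝ)) P := fun i =>
    ((M.identY i).comp measurable_coe_nnreal_real).integrable_iff.2 M.integrable_service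
  have i2 : ∀ i, Integrable ({ω | start S Y i ω ≤ T}.indicator
      (fun ω => (Y (i + 1) ω : ℝ))) P := fun i =>
    (integrable_indicator_iff (hB i)).2 (hYi i).integrableOn
  have hsvc : ∀ i, ∫ ω in {ω | start S Y i ω ≤ T}, (Y (i + 1) ω : ℝ) ∂P =
      (∫ ω, (Y 1 ω : ℝ) ∂P) * P.real {ω | start S Y i ω ≤ T} := fun i => by
    have := M.setIntegral_mul_service (h.starting i) (h.measurableSet_started i T)
      (ξ := fun _ => 1) measurable_const measurable_coe_nnreal_real
    simp only [one_mul] at this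
    rw [this]
    simp [mul_comm]
  have hint : Integrable (fun ω => (min T (delivery S Y n ω) : ℝ)) P :=
    Integrable.of_bound ((measurable_const.min
      (h.measurable_delivery n).coe_nnreal_real)).aestronglyMeasurable (T : ℝ)
      (ae_of_all _ fun ω => by
        rw [Real.norm_of_nonneg (le_min (by positivity) (by positivity))]
        exact min_le_left _ _)
  calc ∫ ω, (min T (delivery S Y n ω) : ℝ) ∂P
      ≤ ∫ ω, ∑ i ∈ Finset.range n, ({ω | delivery S Y i ω ≤ T}.indicator
          (fun ω => (waitEnd S Y T i ω - delivery S Y i ω : ℝ)) ω +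
        {ω | start S Y i ω ≤ T}.indicator (fun ω => (Y (i + 1) ω : ℝ)) ω) ∂P :=
        integral_mono hint (integrable_finsetSum _ fun i _ => (i1 i).add (i2 i))
          fun ω => min_le_sum_stages S Y T n ω
    _ = _ := by
        have i3 : ∀ i ∈ Finset.range n, Integrable (fun ω =>
            {ω | delivery S Y i ω ≤ T}.indicator
              (fun ω => (waitEnd S Y T i ω - delivery S Y i ω : ℝ)) ω +
            {ω | start S Y i ω ≤ T}.indicator (fun ω => (Y (i + 1) ω : ℝ)) ω) P :=
          fun i _ => (i1 i).add (i2 i)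
        rw [integral_finsetSum _ i3, Finset.mul_sum,
          ← Finset.sum_add_distrib]
        refine Finset.sum_congr rfl fun i _ => ?_
        rw [integral_add (i1 i) (i2 i), integral_indicator (hA i), integral_indicator (hB i), hsvc i]

/-- The squared error upon a delivery is at least that of a perfectly fresh start. -/
lemma Timed.le_integral_sq (M : Model P W Y) (h : Timed P W Y S) (i : ℕ) (T K : ℝ≥0) :
    (∫ ω, ((min (Y 1 ω) K : ℝ≥0) : ℝ) ∂P) * P.real {ω | start S Y i ω ≤ T} -
      K * P.real {ω | start S Y i ω ≤ T ∧ T < delivery S Y (i + 1) ω} ≤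
    ∫ ω in {ω | delivery S Y (i + 1) ω ≤ T},
      (W (delivery S Y (i + 1) ω) ω - held W S (i + 1) ω) ^ 2 ∂P := by
  have hG := h.starting i
  have hG' := hG.history_mono i.le_succ
  have hle := hG.past_le_history_mono i.le_succ
  have hs := h.sandwich M (i + 1) T
  have hAm := hs.measurableSet
  have hBm : MeasurableSet {ω | start S Y i ω ≤ T} := hG.measurable measurableSet_Iic
  have hD' : Measurable[hG'.measurableSpace] (delivery S Y (i + 1)) :=
    hG'.measurable_past.add (M.measurable_first hG')
  have hA' : MeasurableSet[hG'.measurableSpace] {ω | delivery S Y (i + 1) ω ≤ T} :=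
    hD' measurableSet_Iic
  have hS' := (h.sampling i).history_mono i.le_succ
  have ha : Measurable[hG'.measurableSpace] (held W S (i + 1)) :=
    ((M.isBM (i + 1)).measurable_eval_past hS').mono
      (hS'.past_mono hG' fun ω => le_max_left _ _) le_rfl
  have hsq := (M.isBM (i + 1)).lintegral_sq_later hG' hD' (start_le_delivery S Y i) ha hA'
  have hbd : ∀ y : ℝ≥0, ((min y K : ℝ≥0) : ℝ) ≤ K := fun y => by exact_mod_cast min_le_right _ _
  have hby : ∀ y : ℝ≥0, ((min y K : ℝ≥0) : ℝ) ≤ y := fun y => by exact_mod_cast min_le_left _ _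
  have hmm : Measurable (fun ω => ((min (Y (i + 1) ω) K : ℝ≥0) : ℝ)) :=
    ((M.measY (i + 1)).min measurable_const).coe_nnreal_real
  have hint : Integrable (fun ω => ((min (Y (i + 1) ω) K : ℝ≥0) : ℝ)) P :=
    Integrable.of_bound hmm.aestronglyMeasurable (K : ℝ) (ae_of_all _ fun ω => by
      rw [Real.norm_of_nonneg (by positivity)]; exact hbd _)
  have hsvc : ∫ ω in {ω | start S Y i ω ≤ T}, ((min (Y (i + 1) ω) K : ℝ≥0) : ℝ) ∂P =
      (∫ ω, ((min (Y 1 ω) K : ℝ≥0) : ℝ) ∂P) * P.real {ω | start S Y i ω ≤ T} := by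
    have := M.setIntegral_mul_service hG (h.measurableSet_started i T)
      (ξ := fun _ => 1) measurable_const (g := fun y => ((min y K : ℝ≥0) : ℝ))
      (measurable_id.min measurable_const).coe_nnreal_real
    simp only [one_mul] at this
    rw [this]
    simp [mul_comm]
  have hCm : MeasurableSet {ω | start S Y i ω ≤ T ∧ T < delivery S Y (i + 1) ω} :=
    hBm.inter ((h.measurable_delivery (i + 1)) measurableSet_Ioi)
  -- Transmissions in progress at T are discarded at a cost of at most K; their probabilities add up
  -- to at most 1 by `sum_in_service_le`.
  have hcut : ∫ ω in {ω | start S Y i ω ≤ T}, ((min (Y (i + 1) ω) K : ℝ≥0) : ℝ) ∂P ≤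
      ∫ ω in {ω | delivery S Y (i + 1) ω ≤ T}, ((min (Y (i + 1) ω) K : ℝ≥0) : ℝ) ∂P +
      K * P.real {ω | start S Y i ω ≤ T ∧ T < delivery S Y (i + 1) ω} := by
    have hU : {ω | start S Y i ω ≤ T} = {ω | delivery S Y (i + 1) ω ≤ T} ∪
        {ω | start S Y i ω ≤ T ∧ T < delivery S Y (i + 1) ω} := by
      ext ω
      simp only [Set.mem_ofPred_eq, Set.mem_union]
      constructor
      · intro h1
        rcases le_or_gt (delivery S Y (i + 1) ω) T with h2 | h2
        · exact Or.inl h2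
        · exact Or.inr ⟨h1, h2⟩
      · rintro (h1 | h1)
        · exact (start_le_delivery S Y i ω).trans h1
        · exact h1.1
    have hdis : Disjoint {ω | delivery S Y (i + 1) ω ≤ T}
        {ω | start S Y i ω ≤ T ∧ T < delivery S Y (i + 1) ω} :=
      Set.disjoint_left.2 fun ω h1 h2 => not_lt.2 h1 h2.2
    rw [hU, setIntegral_union hdis hCm hint.integrableOn hint.integrableOn]
    gcongr
    calc _ ≤ ∫ ω in {ω | start S Y i ω ≤ T ∧ T < delivery S Y (i + 1) ω}, (K : ℝ) ∂P :=
          setIntegral_mono hint.integrableOn (integrable_const _).integrableOn fun ω => hbd _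
      _ = _ := by simp [mul_comm]
  rw [← hsvc]
  refine sub_le_iff_le_add.2 (hcut.trans (add_le_add_left ?_ _))
  have hnn : ∀ᵐ ω ∂(P.restrict {ω | delivery S Y (i + 1) ω ≤ T}),
      0 ≤ ((min (Y (i + 1) ω) K : ℝ≥0) : ℝ) := ae_of_all _ fun ω => by positivity
  rw [integral_eq_lintegral_of_nonneg_ae hnn hmm.aestronglyMeasurable,
    integral_eq_lintegral_of_nonneg_ae (ae_of_all _ fun ω => by positivity)
    hs.integrable_start_sq.aestronglyMeasurable]
  refine ENNReal.toReal_mono ?_ ?_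
  · exact (lintegral_ofReal_ne_top_iff_integrable hs.integrable_start_sq.aestronglyMeasurable
      (ae_of_all _ fun ω => by positivity)).2 hs.integrable_start_sq
  -- The mean of the squared deviation is that of (W_G − W_S)² + Y, where G is the start and S the
  -- sampling time; the displacement accumulated in the queue is dropped.
  · rw [hsq]
    refine setLIntegral_mono' hAm fun ω _ => ENNReal.ofReal_le_ofReal ?_
    refine (hby _).trans ?_
    rw [delivery_succ]
    push_cast
    nlinarith [sq_nonneg (W (start S Y i ω) ω - held W S (i + 1) ω)]

/-- The deviation at the delivery is a known shift, accumulated between sampling and start of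
transmission, plus an independent centred displacement. By Anderson's inequality the shift cannot
increase the deficit: a sample kept waiting behind a busy channel brings no gain. -/
lemma Timed.integral_gap_le (M : Model P W Y) (h : Timed P W Y S) (i : ℕ) (T : ℝ≥0) {β : ℝ}
    (hβ : 0 ≤ β) :
    ∫ ω in {ω | delivery S Y (i + 1) ω ≤ T},
      gap β (W (delivery S Y (i + 1) ω) ω - held W S (i + 1) ω) ∂P ≤
    P.real {ω | start S Y i ω ≤ T} * ∫ ω, gap β (W (Y 1 ω) ω) ∂P := by
  have hG := h.starting i
  have hG' := hG.history_mono i.le_succ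
  have hle := hG.past_le_history_mono i.le_succ
  have hBm : MeasurableSet {ω | start S Y i ω ≤ T} := hG.measurable measurableSet_Iic
  have hS' := (h.sampling i).history_mono i.le_succ
  have hx : Measurable[hG'.measurableSpace] (fun ω => W (start S Y i ω) ω - held W S (i + 1) ω) :=
    ((M.isBM (i + 1)).measurable_eval_past hG').sub
      (((M.isBM (i + 1)).measurable_eval_past hS').mono
        (hS'.past_mono hG' fun ω => le_max_left _ _) le_rfl)
  have hgm : Measurable (fun x => ENNReal.ofReal (gap β x)) :=
    (continuous_gap β).measurable.ennreal_ofReal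
  have key := (M.isBM (i + 1)).lintegral_later hG' (M.measurable_first hG') hx
    (hle _ (h.measurableSet_started i T)) (f := fun p => ENNReal.ofReal (gap β (p.1 + p.2)))
    (hgm.comp (measurable_fst.add measurable_snd))
  have e : ∀ ω, W (start S Y i ω) ω - held W S (i + 1) ω +
      (W (start S Y i ω + Y (i + 1) ω) ω - W (start S Y i ω) ω) =
      W (delivery S Y (i + 1) ω) ω - held W S (i + 1) ω := fun ω => by
    rw [delivery_succ]; ring
  simp only [e] at key
  obtain ⟨g, hg⟩ : ∃ g : ℝ≥0 → ℝ≥0∞, g = fun r => ∫⁻ b, ENNReal.ofReal (gap β b) ∂(gaussianReal 0 r) :=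
    ⟨_, rfl⟩
  obtain ⟨B, hB⟩ : ∃ B : ℝ≥0∞, B = ∫⁻ ω, ENNReal.ofReal (gap β (W (Y 1 ω) ω)) ∂P := ⟨_, rfl⟩
  have hgmeas : Measurable g := by
    have h1 : ∀ r, g r = ∫⁻ ω, ENNReal.ofReal (gap β (W r ω)) ∂P := fun r => by
      have hl := M.pre.hasLaw_eval r
      rw [hg]
      beta_reduce
      rw [← hl.map_eq, lintegral_map' (f := fun x => ENNReal.ofReal (gap β x))
        hgm.aemeasurable hl.aemeasurable]
    have h2 : g = fun r => ∫⁻ ω, ENNReal.ofReal (gap β (W r ω)) ∂P := funext h1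
    rw [h2]
    exact (hgm.comp (measurable_eval_time M.cont M.measW)).lintegral_prod_right'
  have h2 : ∫⁻ ω in {ω | start S Y i ω ≤ T},
      ENNReal.ofReal (gap β (W (delivery S Y (i + 1) ω) ω - held W S (i + 1) ω)) ∂P ≤
      P {ω | start S Y i ω ≤ T} * B := by
    rw [key, hB, ← M.lintegral_displacement hgm]
    have := M.setLIntegral_service hG (h.measurableSet_started i T) hgmeas
    simp only [hg] at this
    rw [← this]
    exact lintegral_mono fun ω => lintegral_gap_shift_le hβ _ _
  have hBi : Integrable (fun ω => gap β (W (Y 1 ω) ω)) P :=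
    Integrable.of_bound ((continuous_gap β).measurable.comp
      M.measurable_displacement).aestronglyMeasurable (β ^ 2) (ae_of_all _ fun ω => by
        rw [Real.norm_of_nonneg (gap_nonneg _ _)]; exact gap_le hβ _)
  have hBe : B = ENNReal.ofReal (∫ ω, gap β (W (Y 1 ω) ω) ∂P) := by
    rw [hB, ofReal_integral_eq_lintegral_ofReal hBi (ae_of_all _ fun ω => gap_nonneg _ _)]
  have hm : Measurable (fun ω => gap β (W (delivery S Y (i + 1) ω) ω - held W S (i + 1) ω)) :=
    (continuous_gap β).measurable.comp (((M.isBM 0).measurable_eval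
      (h.measurable_delivery (i + 1))).sub (h.measurable_held' M (i + 1)))
  rw [integral_eq_lintegral_of_nonneg_ae (ae_of_all _ fun ω => gap_nonneg _ _)
    hm.aestronglyMeasurable]
  refine ENNReal.toReal_le_of_le_ofReal (mul_nonneg measureReal_nonneg
    (integral_nonneg fun ω => gap_nonneg _ _)) ?_
  rw [ENNReal.ofReal_mul measureReal_nonneg, ofReal_measureReal, ← hBe]
  refine le_trans (lintegral_mono_set ?_) h2
  exact fun ω hω => (start_le_delivery S Y i ω).trans hω

end LowerBound

/-! ### The long-run lower bound -/

section LongRun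

variable {Ω : Type*} {mΩ : MeasurableSpace Ω} {P : Measure Ω} {W : ℝ≥0 → Ω → ℝ}
  {Y S : ℕ → Ω → ℝ≥0}

lemma ofReal_sum_le (f : ℕ → ℝ) (n : ℕ) :
    ENNReal.ofReal (∑ i ∈ Finset.range n, f i) ≤ ∑ i ∈ Finset.range n, ENNReal.ofReal (f i) := by
  induction n with
  | zero => simp
  | succ n ih =>
    rw [Finset.sum_range_succ, Finset.sum_range_succ]
    exact ENNReal.ofReal_add_le.trans (add_le_add_left ih _)

lemma tendsto_integral_min {X : Ω → ℝ≥0} (hX : Measurable X) {f : ℝ → ℝ} (hf : Continuous f)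
    {g : Ω → ℝ} (hg : Integrable g P) (hb : ∀ (n : ℕ) ω, |f ((min (X ω) n : ℝ≥0) : ℝ)| ≤ g ω) :
    Tendsto (fun n : ℕ => ∫ ω, f ((min (X ω) n : ℝ≥0) : ℝ) ∂P) atTop (𝓝 (∫ ω, f (X ω) ∂P)) := by
  refine tendsto_integral_of_dominated_convergence g (fun n => ?_) hg
    (fun n => ae_of_all _ fun ω => hb n ω) (ae_of_all _ fun ω => ?_)
  · exact (hf.measurable.comp (hX.min measurable_const).coe_nnreal_real).aestronglyMeasurable
  · refine tendsto_const_nhds.congr' ?_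
    obtain ⟨N, hN⟩ := exists_nat_ge (X ω)
    filter_upwards [eventually_ge_atTop N] with n hn
    rw [min_eq_left (hN.trans (by exact_mod_cast hn))]

variable [IsProbabilityMeasure P]

/-- While waiting at time `T`, the squared error is `errSq`. -/
lemma Timed.sum_waiting_le (M : Model P W Y) (h : Timed P W Y S) (T : ℝ≥0) (n : ℕ) {L : ℝ}
    (hL0 : 0 ≤ L) (hL : ∫⁻ ω, errSq W Y S T ω ∂P ≤ ENNReal.ofReal L) :
    ∑ i ∈ Finset.range n, ∫ ω in {ω | delivery S Y i ω ≤ T ∧ T < start S Y i ω},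
      (W T ω - held W S i ω) ^ 2 ∂P ≤ L := by
  have hm : ∀ i, Measurable (fun ω => (W T ω - held W S i ω) ^ 2) := fun i =>
    ((M.measW T).sub (h.measurable_held' M i)).pow_const 2
  have hC : ∀ i, MeasurableSet {ω | delivery S Y i ω ≤ T ∧ T < start S Y i ω} := fun i =>
    (h.measurable_delivery i measurableSet_Iic).inter ((h.starting i).measurable measurableSet_Ioi)
  have hle : ∑ i ∈ Finset.range n, ∫⁻ ω in {ω | delivery S Y i ω ≤ T ∧ T < start S Y i ω},
      ENNReal.ofReal ((W T ω - held W S i ω) ^ 2) ∂P ≤ ENNReal.ofReal L := by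
    refine le_trans ?_ hL
    simp_rw [← lintegral_indicator (hC _)]
    rw [← lintegral_finsetSum _ fun i _ => (hm i).ennreal_ofReal.indicator (hC i)]
    refine lintegral_mono fun ω => ?_
    refine le_trans (Finset.sum_le_sum fun i _ => ?_) (ENNReal.sum_le_tsum (Finset.range n))
    by_cases hω : ω ∈ {ω | delivery S Y i ω ≤ T ∧ T < start S Y i ω}
    · rw [Set.indicator_of_mem hω, Set.indicator_of_mem]
      exact ⟨hω.1, hω.2.trans_le (start_le_delivery S Y i ω)⟩
    · rw [Set.indicator_of_notMem hω]; exact zero_le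
  have hfin : ∀ i ∈ Finset.range n, ∫⁻ ω in {ω | delivery S Y i ω ≤ T ∧ T < start S Y i ω},
      ENNReal.ofReal ((W T ω - held W S i ω) ^ 2) ∂P ≠ ∞ := fun i hi =>
    ((Finset.single_le_sum (f := fun i => ∫⁻ ω in {ω | delivery S Y i ω ≤ T ∧ T < start S Y i ω},
      ENNReal.ofReal ((W T ω - held W S i ω) ^ 2) ∂P) (fun _ _ => zero_le) hi).trans
        (hle)).trans_lt ENNReal.ofReal_lt_top |>.ne
  have e : ∀ i, ∫ ω in {ω | delivery S Y i ω ≤ T ∧ T < start S Y i ω},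
      (W T ω - held W S i ω) ^ 2 ∂P = (∫⁻ ω in {ω | delivery S Y i ω ≤ T ∧ T < start S Y i ω},
      ENNReal.ofReal ((W T ω - held W S i ω) ^ 2) ∂P).toReal := fun i =>
    integral_eq_lintegral_of_nonneg_ae (ae_of_all _ fun ω => by positivity)
      (hm i).aestronglyMeasurable
  simp_rw [e]
  rw [← ENNReal.toReal_sum hfin]
  exact ENNReal.toReal_le_of_le_ofReal hL0 hle

/-- The events are disjoint: at most one transmission is in progress at time T. -/
lemma Timed.sum_in_service_le (h : Timed P W Y S) (T : ℝ≥0) (n : ℕ) :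
    ∑ i ∈ Finset.range n, P.real {ω | start S Y i ω ≤ T ∧ T < delivery S Y (i + 1) ω} ≤ 1 := by
  have hE : ∀ i, MeasurableSet {ω | start S Y i ω ≤ T ∧ T < delivery S Y (i + 1) ω} := fun i =>
    ((h.starting i).measurable measurableSet_Iic).inter
      (h.measurable_delivery (i + 1) measurableSet_Ioi)
  have := sum_measureReal_le_measureReal_univ (μ := P) (s := Finset.range n)
    (t := fun i => {ω | start S Y i ω ≤ T ∧ T < delivery S Y (i + 1) ω})
    (fun i _ => hE i) (fun i _ j _ hij => by
      refine Set.disjoint_left.2 fun ω h1 h2 => hij ?_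
      exact delivery_unique (S := S) (Y := Y) (t := T) (ω := ω)
        ⟨(delivery_le_start S Y i ω).trans h1.1, h1.2⟩
        ⟨(delivery_le_start S Y j ω).trans h2.1, h2.2⟩)
  simpa using this

/-- Lower bound on the total squared error from finitely many stages. -/
lemma Timed.le_totalErr (M : Model P W Y) (h : Timed P W Y S) (T K : ℝ≥0) (n : ℕ) {L β : ℝ}
    (hβ : 0 ≤ β) (hL0 : 0 ≤ L) (hL : ∫⁻ ω, errSq W Y S T ω ∂P ≤ ENNReal.ofReal L)
    {m mK wK c : ℝ} (hm : m = ∫ ω, (Y 1 ω : ℝ) ∂P)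
    (hmK : mK = ∫ ω, ((min (Y 1 ω) K : ℝ≥0) : ℝ) ∂P)
    (hwK : wK = ∫ ω, ((min (Y 1 ω) K : ℝ≥0) : ℝ) ^ 2 / 2 ∂P) (hc0 : 0 ≤ c)
    (hc : (β / 3 + mK) * m - mK ^ 2 - wK + (∫ ω, gap β (W (Y 1 ω) ω) ∂P) / 6 ≤ c) :
    ENNReal.ofReal ((β / 3 + mK) * ∫ ω, (min T (delivery S Y (n + 1) ω) : ℝ) ∂P -
      c * ∑ i ∈ Finset.range n, P.real {ω | S (i + 1) ω ≤ T} -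
      ((β / 3 + mK) * m + mK * K + β ^ 2 / 6 + mK * L)) ≤ totalErr P W Y S (T + K) := by
  have hm0 : 0 ≤ m := by rw [hm]; exact integral_nonneg fun ω => by positivity
  have hmK0 : 0 ≤ mK := by rw [hmK]; exact integral_nonneg fun ω => by positivity
  have hwK0 : 0 ≤ wK := by rw [hwK]; exact integral_nonneg fun ω => by positivity
  refine le_trans ?_ (sum_le_totalErr M.cont M.measW h.measurable_delivery (h.measurable_held' M)
    (T + K) (n + 1))
  refine le_trans ?_ (Finset.sum_le_sum fun i _ => h.le_lintegral_stageErr M i T K hβ hmK hwK)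
  refine le_trans (ENNReal.ofReal_le_ofReal ?_) (ofReal_sum_le _ _)
  have h1 := h.integral_min_le M T (n + 1)
  have h2 := h.sum_waiting_le M T (n + 1) hL0 hL
  have h3 := h.sum_in_service_le T n
  have h4 := fun i => h.le_integral_sq M i T K
  have h5 := fun i => h.integral_gap_le M i T hβ
  rw [← hm] at h1
  rw [← hmK] at h4
  have hg0 : ∫ ω in {ω | delivery S Y 0 ω ≤ T},
      gap β (W (delivery S Y 0 ω) ω - held W S 0 ω) ∂P ≤ β ^ 2 := by
    have := norm_setIntegral_le_of_norm_le_const (μ := P) (s := {ω | delivery S Y 0 ω ≤ T})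
      (f := fun ω => gap β (W (delivery S Y 0 ω) ω - held W S 0 ω)) (C := β ^ 2)
      (measure_lt_top _ _) (fun ω _ => by
        rw [Real.norm_of_nonneg (gap_nonneg _ _)]; exact gap_le hβ _)
    refine (le_abs_self _).trans (this.trans ?_)
    have h6 : P.real {ω | delivery S Y 0 ω ≤ T} ≤ 1 := measureReal_le_one
    nlinarith [sq_nonneg β]
  have hv0 : 0 ≤ ∫ ω in {ω | delivery S Y 0 ω ≤ T},
      (W (delivery S Y 0 ω) ω - held W S 0 ω) ^ 2 ∂P := integral_nonneg fun ω => sq_nonneg _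
  have hE0 : 0 ≤ ∫ ω, gap β (W (Y 1 ω) ω) ∂P := integral_nonneg fun ω => gap_nonneg _ _
  -- No transmission starts before its sample is taken, so samples may be counted instead; since c ≥
  -- 0 this only weakens the bound.
  have hpS : ∑ i ∈ Finset.range n, P.real {ω | start S Y i ω ≤ T} ≤
      ∑ i ∈ Finset.range n, P.real {ω | S (i + 1) ω ≤ T} :=
    Finset.sum_le_sum fun i _ => measureReal_mono fun ω hω =>
      le_trans (b := start S Y i ω) (le_max_left _ _) hω
  have hN0 : 0 ≤ ∑ i ∈ Finset.range n, P.real {ω | start S Y i ω ≤ T} :=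
    Finset.sum_nonneg fun i _ => measureReal_nonneg
  have hpn : P.real {ω | start S Y n ω ≤ T} ≤ 1 := measureReal_le_one
  have hpn0 : 0 ≤ P.real {ω | start S Y n ω ≤ T} := measureReal_nonneg
  have h4' := Finset.sum_le_sum (s := Finset.range n) fun i _ => h4 i
  have h5' := Finset.sum_le_sum (s := Finset.range n) fun i _ => h5 i
  rw [Finset.sum_sub_distrib, ← Finset.mul_sum, ← Finset.mul_sum] at h4'
  rw [← Finset.sum_mul] at h5'
  rw [Finset.sum_add_distrib, Finset.sum_sub_distrib, Finset.sum_sub_distrib,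
    Finset.sum_add_distrib, ← Finset.mul_sum, ← Finset.mul_sum, ← Finset.mul_sum, ← Finset.mul_sum,
    ← Finset.sum_div,
    Finset.sum_range_succ' (fun i => ∫ ω in {ω | delivery S Y i ω ≤ T},
      (W (delivery S Y i ω) ω - held W S i ω) ^ 2 ∂P),
    Finset.sum_range_succ' (fun i => ∫ ω in {ω | delivery S Y i ω ≤ T},
      gap β (W (delivery S Y i ω) ω - held W S i ω) ∂P),
    Finset.sum_range_succ (fun i => P.real {ω | start S Y i ω ≤ T})]
  rw [Finset.sum_range_succ (fun i => P.real {ω | start S Y i ω ≤ T})] at h1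
  generalize ∑ i ∈ Finset.range n, ∫ ω in {ω | delivery S Y (i + 1) ω ≤ T},
      (W (delivery S Y (i + 1) ω) ω - held W S (i + 1) ω) ^ 2 ∂P = v at *
  generalize ∑ i ∈ Finset.range n, ∫ ω in {ω | delivery S Y (i + 1) ω ≤ T},
      gap β (W (delivery S Y (i + 1) ω) ω - held W S (i + 1) ω) ∂P = g at *
  generalize ∑ i ∈ Finset.range n, P.real {ω | start S Y i ω ≤ T} = N at *
  generalize ∑ i ∈ Finset.range n, P.real {ω | S (i + 1) ω ≤ T} = N' at *
  generalize P.real {ω | start S Y n ω ≤ T} = p at *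
  generalize ∑ i ∈ Finset.range (n + 1), ∫ ω in {ω | delivery S Y i ω ≤ T},
      (waitEnd S Y T i ω - delivery S Y i ω : ℝ) ∂P = u at *
  generalize ∑ i ∈ Finset.range (n + 1),
    ∫ ω in {ω | delivery S Y i ω ≤ T ∧ T < start S Y i ω}, (W T ω - held W S i ω) ^ 2 ∂P = l at *
  generalize ∑ i ∈ Finset.range n,
    P.real {ω | start S Y i ω ≤ T ∧ T < delivery S Y (i + 1) ω} = s at *
  generalize ∫ ω in {ω | delivery S Y 0 ω ≤ T},
      (W (delivery S Y 0 ω) ω - held W S 0 ω) ^ 2 ∂P = v0 at *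
  generalize ∫ ω in {ω | delivery S Y 0 ω ≤ T},
      gap β (W (delivery S Y 0 ω) ω - held W S 0 ω) ∂P = g0 at *
  generalize ∫ ω, (min T (delivery S Y (n + 1) ω) : ℝ) ∂P = I at *
  generalize ∫ ω, gap β (W (Y 1 ω) ω) ∂P = E at *
  have hl0 : 0 ≤ β / 3 + mK := by positivity
  have k1 := mul_le_mul_of_nonneg_left h1 hl0
  have k2 := mul_le_mul_of_nonneg_left h4' hmK0
  have k3 := mul_le_mul_of_nonneg_left h2 hmK0
  have k4 : mK * (K * s) ≤ mK * K := by
    have : (K : ℝ) * s ≤ K * 1 := mul_le_mul_of_nonneg_left h3 (by positivity)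
    nlinarith
  have k5 := mul_le_mul_of_nonneg_left hpn (mul_nonneg hl0 hm0)
  have k6 := mul_nonneg hwK0 hpn0
  have k7 := mul_le_mul_of_nonneg_left hpS hc0
  have k8 := mul_nonneg hmK0 hv0
  have k9 : ((β / 3 + mK) * m - mK ^ 2 - wK + E / 6) * N ≤ c * N := by
    exact mul_le_mul_of_nonneg_right hc hN0
  nlinarith

/-- Lower bound on the total squared error, given a bound on the number of samples. -/
lemma Timed.le_totalErr_of_sum_le (M : Model P W Y) (h : Timed P W Y S) (T K : ℝ≥0) {L β : ℝ}
    (hβ : 0 ≤ β) (hL0 : 0 ≤ L) (hL : ∫⁻ ω, errSq W Y S T ω ∂P ≤ ENNReal.ofReal L)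
    {m mK wK c R : ℝ} (hm : m = ∫ ω, (Y 1 ω : ℝ) ∂P)
    (hmK : mK = ∫ ω, ((min (Y 1 ω) K : ℝ≥0) : ℝ) ∂P)
    (hwK : wK = ∫ ω, ((min (Y 1 ω) K : ℝ≥0) : ℝ) ^ 2 / 2 ∂P) (hc0 : 0 ≤ c)
    (hc : (β / 3 + mK) * m - mK ^ 2 - wK + (∫ ω, gap β (W (Y 1 ω) ω) ∂P) / 6 ≤ c)
    (hR : ∀ n, ∑ i ∈ Finset.range n, P.real {ω | S (i + 1) ω ≤ T} ≤ R) :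
    ENNReal.ofReal ((β / 3 + mK) * T - c * R -
      ((β / 3 + mK) * m + mK * K + β ^ 2 / 6 + mK * L)) ≤ totalErr P W Y S (T + K) := by
  have hmK0 : 0 ≤ mK := by rw [hmK]; exact integral_nonneg fun ω => by positivity
  -- The probabilities are summable, hence vanish in the limit, so the mean of min(T, D_n) tends to
  -- T even if finitely many samples are taken late.
  have hq : Tendsto (fun n => P.real {ω | S (n + 1) ω ≤ T}) atTop (𝓝 0) :=
    (summable_of_sum_range_le (fun i => measureReal_nonneg) hR).tendsto_atTop_zero
  have hlim : Tendsto (fun n => ENNReal.ofReal ((β / 3 + mK) *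
      (T - T * P.real {ω | S (n + 1) ω ≤ T}) - c * R -
      ((β / 3 + mK) * m + mK * K + β ^ 2 / 6 + mK * L))) atTop
      (𝓝 (ENNReal.ofReal ((β / 3 + mK) * (T - T * 0) - c * R -
      ((β / 3 + mK) * m + mK * K + β ^ 2 / 6 + mK * L)))) :=
    ENNReal.tendsto_ofReal ((((tendsto_const_nhds.sub (hq.const_mul _)).const_mul _).sub_const
      _).sub_const _)
  rw [mul_zero, sub_zero] at hlim
  refine le_of_tendsto' hlim fun n => ?_
  refine le_trans (ENNReal.ofReal_le_ofReal ?_) (h.le_totalErr M T K n hβ hL0 hL hm hmK hwK hc0 hc)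
  have hA : MeasurableSet {ω | S (n + 1) ω ≤ T} := (h.sampling n).measurable measurableSet_Iic
  have h1 : T - T * P.real {ω | S (n + 1) ω ≤ T} ≤ ∫ ω, (min T (delivery S Y (n + 1) ω) : ℝ) ∂P := by
    have i1 : Integrable ({ω | S (n + 1) ω ≤ T}.indicator (fun _ => (T : ℝ))) P :=
      (integrable_const _).indicator hA
    have hint : Integrable (fun ω => (min T (delivery S Y (n + 1) ω) : ℝ)) P :=
      Integrable.of_bound ((measurable_const.min
        (h.measurable_delivery (n + 1)).coe_nnreal_real)).aestronglyMeasurable (T : ℝ)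
        (ae_of_all _ fun ω => by
          rw [Real.norm_of_nonneg (le_min (by positivity) (by positivity))]
          exact min_le_left _ _)
    have h2 : ∫ ω, ((T : ℝ) - {ω | S (n + 1) ω ≤ T}.indicator (fun _ => (T : ℝ)) ω) ∂P ≤
        ∫ ω, (min T (delivery S Y (n + 1) ω) : ℝ) ∂P := by
      refine integral_mono ((integrable_const _).sub i1) hint fun ω => ?_
      by_cases hω : ω ∈ {ω | S (n + 1) ω ≤ T}
      · simp only [Set.indicator_of_mem hω, sub_self]
        exact le_min (by positivity) (by positivity)
      · simp only [Set.indicator_of_notMem hω, sub_zero]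
        refine le_min le_rfl ?_
        have h3 : T ≤ delivery S Y (n + 1) ω := (not_le.1 hω).le.trans (le_delivery S Y n ω)
        exact_mod_cast h3
    rw [integral_sub (integrable_const _) i1, integral_indicator hA] at h2
    simpa [mul_comm] using h2
  have h2 := mul_le_mul_of_nonneg_left h1 (by positivity : 0 ≤ β / 3 + mK)
  have h3 := mul_le_mul_of_nonneg_left (hR n) hc0
  linarith

/-- If the total error grows at most at rate `r`, its density is at most `r + 1` at arbitrarily
large times. -/
lemma exists_errSq_le (M : Model P W Y) (h : Timed P W Y S) {r : ℝ≥0}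
    (hr : ∀ᶠ T : ℝ≥0 in atTop, totalErr P W Y S T ≤ r * T) (T₀ : ℝ≥0) :
    ∃ T ≥ T₀, ∫⁻ ω, errSq W Y S T ω ∂P ≤ ENNReal.ofReal (r + 1) := by
  by_contra! hcon
  obtain ⟨T₁, hT₁⟩ := eventually_atTop.1 hr
  -- With this T, (r + 1)(T − T₀) ≥ rT + 1, which contradicts the growth bound.
  obtain ⟨T, hT⟩ : ∃ T, T = max T₁ ((r + 1) * T₀ + 1) := ⟨_, rfl⟩
  have h1 := hT₁ T (by rw [hT]; exact le_max_left _ _)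
  have hT2 : (r + 1) * T₀ + 1 ≤ T := by rw [hT]; exact le_max_right _ _
  have hT0 : T₀ ≤ T := by
    refine le_trans ?_ hT2
    refine le_trans ?_ le_self_add
    exact le_mul_of_one_le_left zero_le le_add_self
  rw [totalErr_eq_lintegral M.cont M.measW h.measurable_delivery (h.measurable_held' M)] at h1
  have h2 : ∫⁻ t : ℝ in Set.Icc (T₀ : ℝ) T, ENNReal.ofReal (r + 1) ≤
      ∫⁻ t : ℝ in Set.Icc 0 (T : ℝ), (∫⁻ ω, errSq W Y S t.toNNReal ω ∂P) := by
    refine le_trans (setLIntegral_mono' measurableSet_Icc fun t ht => ?_)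
      (lintegral_mono_set (Set.Icc_subset_Icc_left (by positivity)))
    exact (hcon t.toNNReal (NNReal.le_toNNReal_of_coe_le ht.1)).le
  rw [lintegral_const, Measure.restrict_apply MeasurableSet.univ, Set.univ_inter,
    Real.volume_Icc] at h2
  have h3 := h2.trans h1
  have e : (r : ℝ≥0∞) * T = ENNReal.ofReal (r * T) := by
    rw [ENNReal.ofReal_mul (by positivity)]; simp
  rw [← ENNReal.ofReal_mul (by positivity), e, ENNReal.ofReal_le_ofReal_iff (by positivity)] at h3
  have hT2' : ((r : ℝ) + 1) * T₀ + 1 ≤ T := by exact_mod_cast hT2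
  nlinarith

/-- Long-run lower bound, with truncated constants. -/
lemma Timed.rate_ge (M : Model P W Y) (h : Timed P W Y S) {r : ℝ≥0}
    (hr : ∀ᶠ T : ℝ≥0 in atTop, totalErr P W Y S T ≤ r * T) (K : ℝ≥0) {β : ℝ}
    (hβ : 0 ≤ β) {m mK wK c k d μ K' : ℝ} (hm : m = ∫ ω, (Y 1 ω : ℝ) ∂P)
    (hmK : mK = ∫ ω, ((min (Y 1 ω) K : ℝ≥0) : ℝ) ∂P)
    (hwK : wK = ∫ ω, ((min (Y 1 ω) K : ℝ≥0) : ℝ) ^ 2 / 2 ∂P) (hc0 : 0 ≤ c)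
    (hc : (β / 3 + mK) * m - mK ^ 2 - wK + (∫ ω, gap β (W (Y 1 ω) ω) ∂P) / 6 ≤ c)
    (hR : ∀ (T : ℝ≥0) n, ∑ i ∈ Finset.range n, P.real {ω | S (i + 1) ω ≤ T} ≤
      k + d * (T + K') / μ) :
    β / 3 + mK - c * (d / μ) ≤ r := by
  by_contra! hcon
  obtain ⟨T₁, hT₁⟩ := eventually_atTop.1 hr
  -- C collects the terms that do not grow with T, and α is the supposed excess of the rate; any T
  -- beyond |C|/α + 1 gives a contradiction.
  obtain ⟨C, hC⟩ : ∃ C, C = r * K + c * (k + d * K' / μ) +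
    ((β / 3 + mK) * m + mK * K + β ^ 2 / 6 + mK * (r + 1)) := ⟨_, rfl⟩
  obtain ⟨α, hα⟩ : ∃ α, α = β / 3 + mK - c * (d / μ) - r := ⟨_, rfl⟩
  have hα0 : 0 < α := by rw [hα]; linarith
  obtain ⟨T, hT, hL⟩ := exists_errSq_le M h hr (max T₁ ((|C| / α).toNNReal + 1))
  have h1 := h.le_totalErr_of_sum_le M T K hβ (by positivity) hL hm hmK hwK hc0 hc (hR T)
  have h2 := h1.trans (hT₁ (T + K) (((le_max_left _ _).trans hT).trans le_self_add))
  have e : (r : ℝ≥0∞) * ((T + K : ℝ≥0) : ℝ≥0∞) = ENNReal.ofReal (r * (T + K)) := by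
    rw [ENNReal.ofReal_mul (by positivity), ENNReal.ofReal_add (by positivity) (by positivity)]
    simp
  rw [e, ENNReal.ofReal_le_ofReal_iff (by positivity)] at h2
  have h3 : |C| / α + 1 ≤ T := by
    have := (le_max_right _ _).trans hT
    calc |C| / α + 1 = (((|C| / α).toNNReal + 1 : ℝ≥0) : ℝ) := by
          push_cast; rw [Real.coe_toNNReal _ (by positivity)]
      _ ≤ T := by exact_mod_cast this
  have h4 : α * T ≤ C := by
    rw [hα, hC]
    have : c * (k + d * (T + K') / μ) = c * (d / μ) * T + c * (k + d * K' / μ) := by ring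
    linarith
  have h5 : |C| + α ≤ α * T := by
    have := mul_le_mul_of_nonneg_left h3 hα0.le
    have e2 : α * (|C| / α + 1) = |C| + α := by field_simp
    linarith
  linarith [le_abs_self C]

/-- **Lower bound** on the mean square error of every policy. -/
lemma le_mse (M : Model P W Y) (hS : IsPolicy P W Y S) {fmax : ℝ≥0∞} (hf0 : 0 < fmax)
    (hf : FrequencyConstraint P fmax S) {β A B : ℝ} (hβ : 0 < β)
    (hA : A = ∫ ω, max (W (Y 1 ω) ω ^ 2) β ∂P) (hB : B = ∫ ω, max (W (Y 1 ω) ω ^ 2) β ^ 2 ∂P)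
    (hψ : 0 ≤ 2 * β * A - B) (hcase : 2 * β * A - B = 0 ∨ A = (1 / fmax).toReal) (hA0 : 0 < A) :
    ENNReal.ofReal (∫ ω, (Y 1 ω : ℝ) ∂P + B / (6 * A)) ≤ mse P W Y S := by
  by_contra! hcon
  have h := M.timed hS.measurable hS.zero hS.causal
  obtain ⟨r, hr1, hr2⟩ := ENNReal.lt_iff_exists_nnreal_btwn.1 hcon
  have hrV : (r : ℝ) < ∫ ω, (Y 1 ω : ℝ) ∂P + B / (6 * A) := by
    rw [← ENNReal.ofReal_coe_nnreal] at hr2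
    exact (ENNReal.ofReal_lt_ofReal_iff_of_nonneg (by positivity)).1 hr2
  have hr : ∀ᶠ T : ℝ≥0 in atTop, totalErr P W Y S T ≤ r * T := by
    have h1 := NNReal.tendsto_coe_atTop.2 (tendsto_id (α := ℝ≥0) (x := atTop))
    have h2 := h1.eventually (eventually_lt_of_limsup_lt hr1)
    filter_upwards [h2, eventually_gt_atTop 0] with T hT hT0
    simp only [id] at hT
    rw [ENNReal.ofReal_coe_nnreal] at hT
    refine le_trans ?_ ((ENNReal.div_le_iff (by simpa using hT0.ne') (by simp)).1 hT.le)
    refine lintegral_mono_ae ?_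
    filter_upwards [hS.zero] with ω hω
    exact lintegral_mono fun t => errSq_le M.zero _ hω
  obtain ⟨k, d, X, hd0, hX, hμ0, hμ1, hcyc, hfr⟩ :=
    exists_cycle hS.measurable hS.mono hS.regenerative
  have hXi : Integrable (fun ω => (X ω : ℝ)) P := by
    refine (lintegral_ofReal_ne_top_iff_integrable hX.coe_nnreal_real.aestronglyMeasurable
      (ae_of_all _ fun ω => by positivity)).1 ?_
    simpa using hμ1.ne
  have hminb : ∀ (Z : Ω → ℝ≥0) (n : ℕ) ω, |((min (Z ω) n : ℝ≥0) : ℝ)| ≤ Z ω := fun Z n ω => by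
    rw [abs_of_nonneg (by positivity)]
    exact_mod_cast min_le_left _ _
  obtain ⟨m, hm⟩ : ∃ m, m = ∫ ω, (Y 1 ω : ℝ) ∂P := ⟨_, rfl⟩
  obtain ⟨μ, hμ⟩ : ∃ μ, μ = ∫ ω, (X ω : ℝ) ∂P := ⟨_, rfl⟩
  obtain ⟨E, hE⟩ : ∃ E, E = ∫ ω, gap β (W (Y 1 ω) ω) ∂P := ⟨_, rfl⟩
  obtain ⟨mn, hmn⟩ : ∃ mn : ℕ → ℝ, mn = fun n : ℕ => ∫ ω, ((min (Y 1 ω) n : ℝ≥0) : ℝ) ∂P := ⟨_, rfl⟩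
  obtain ⟨wn, hwn⟩ : ∃ wn : ℕ → ℝ,
    wn = fun n : ℕ => ∫ ω, ((min (Y 1 ω) n : ℝ≥0) : ℝ) ^ 2 / 2 ∂P := ⟨_, rfl⟩
  obtain ⟨μn, hμn⟩ : ∃ μn : ℕ → ℝ, μn = fun n : ℕ => ∫ ω, ((min (X ω) n : ℝ≥0) : ℝ) ∂P := ⟨_, rfl⟩
  have lm : Tendsto mn atTop (𝓝 m) := by
    rw [hmn, hm]
    exact tendsto_integral_min (M.measY 1) continuous_id M.integrable_service (hminb _)
  have lμ : Tendsto μn atTop (𝓝 μ) := by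
    rw [hμn, hμ]
    exact tendsto_integral_min hX continuous_id hXi (hminb _)
  have lw : Tendsto wn atTop (𝓝 (∫ ω, (Y 1 ω : ℝ) ^ 2 / 2 ∂P)) := by
    rw [hwn]
    refine tendsto_integral_min (f := fun y => y ^ 2 / 2) (M.measY 1) (by fun_prop)
      M.integrable_service_sq fun n ω => ?_
    have h1 := hminb (Y 1) n ω
    rw [abs_of_nonneg (by positivity)] at h1 ⊢
    have h2 : (0 : ℝ) ≤ ((min (Y 1 ω) n : ℝ≥0) : ℝ) := by positivity
    nlinarith
  have hμpos : 0 < μ := by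
    rw [hμ, integral_pos_iff_support_of_nonneg (fun ω => by positivity) hXi]
    rw [lintegral_pos_iff_support hX.coe_nnreal_ennreal] at hμ0
    convert hμ0 using 2
    ext ω; simp
  -- The maximum with 0 provides the sign required by `rate_ge`; it disappears in the limit, which
  -- is nonnegative by the choice of β.
  obtain ⟨cn, hcn⟩ : ∃ cn : ℕ → ℝ, cn = fun n => max ((β / 3 + mn n) * m - mn n ^ 2 - wn n + E / 6) 0 :=
    ⟨_, rfl⟩
  have hrate : ∀ᶠ n in atTop, β / 3 + mn n - cn n * (d / μn n) ≤ r := by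
    filter_upwards [lμ.eventually (lt_mem_nhds hμpos)] with n hn
    refine h.rate_ge M hr (n : ℝ≥0) hβ.le hm (by rw [hmn]) (by rw [hwn])
      (by rw [hcn]; exact le_max_right _ _) (by rw [hcn, ← hE]; exact le_max_left _ _)
      (mK := mn n) (wK := wn n) (k := k) (d := d) (K' := n) fun T N => ?_
    have h1 := hcyc (N + 1) T n
    have e1 : ∫⁻ ω, ((min (X ω) n : ℝ≥0) : ℝ≥0∞) ∂P = ENNReal.ofReal (μn n) := by
      rw [hμn]
      have hi : Integrable (fun ω => ((min (X ω) n : ℝ≥0) : ℝ)) P :=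
        hXi.mono' (hX.min measurable_const).coe_nnreal_real.aestronglyMeasurable
          (ae_of_all _ fun ω => hminb X n ω)
      rw [ofReal_integral_eq_lintegral_ofReal hi (ae_of_all _ fun ω => by positivity)]
      simp
    have e2 : ∑ i ∈ Finset.range (N + 1), P {ω | S i ω ≤ T} =
        ENNReal.ofReal (∑ i ∈ Finset.range (N + 1), P.real {ω | S i ω ≤ T}) := by
      rw [ENNReal.ofReal_sum_of_nonneg fun i _ => measureReal_nonneg]
      simp
    have e3 : (k : ℝ≥0∞) * ENNReal.ofReal (μn n) + d * ((T : ℝ≥0∞) + ((n : ℝ≥0) : ℝ≥0∞)) =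
        ENNReal.ofReal (k * μn n + d * (T + n)) := by
      rw [ENNReal.ofReal_add (by positivity) (by positivity), ENNReal.ofReal_mul (by positivity),
        ENNReal.ofReal_mul (by positivity), ENNReal.ofReal_add (by positivity) (by positivity)]
      simp
    rw [e1, e2, e3, ← ENNReal.ofReal_mul (Finset.sum_nonneg fun i _ => measureReal_nonneg),
      ENNReal.ofReal_le_ofReal_iff (by positivity), Finset.sum_range_succ'] at h1
    have h2 : (0 : ℝ) ≤ P.real {ω | S 0 ω ≤ T} := measureReal_nonneg
    have h3 : (k : ℝ) + d * (T + (n : ℕ)) / μn n = (k * μn n + d * (T + n)) / μn n := by field_simp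
    rw [h3, le_div_iff₀ hn]
    nlinarith
  have hE' := M.integral_gap_displacement β
  rw [← hE, ← hm, ← hA, ← hB] at hE'
  have hw' : ∫ ω, (Y 1 ω : ℝ) ^ 2 / 2 ∂P = (∫ ω, (Y 1 ω : ℝ) ^ 2 ∂P) / 2 := integral_div _ _
  -- By `integral_gap_displacement` the terms in E[Y] and E[Y²] cancel, and the price tends to (2βA
  -- − B)/6.
  have hc : Tendsto cn atTop (𝓝 ((2 * β * A - B) / 6)) := by
    have h1 := (((lm.const_add (β / 3)).mul_const m).sub (lm.pow 2)).sub lw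
    have h2 := (h1.add_const (E / 6)).max (tendsto_const_nhds (x := (0 : ℝ)))
    rw [← hcn] at h2
    convert h2 using 2
    rw [hE', hw', eq_comm, max_eq_left]
    · ring
    · have : (2 * β * A - B) / 6 ≥ 0 := by positivity
      linarith
  have hlim := le_of_tendsto ((lm.const_add (β / 3)).sub
    (hc.mul (Tendsto.div (tendsto_const_nhds (x := (d : ℝ))) lμ hμpos.ne'))) hrate
  -- Complementary slackness: either the price is zero and B/(6A) = β/3, or the frequency constraint
  -- gives d/μ ≤ 1/A.
  have hV : m + B / (6 * A) ≤ r := by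
    rcases hcase with h0 | h0
    · rw [h0] at hlim
      have : B / (6 * A) = β / 3 := by
        rw [show B = 2 * β * A by linarith]; field_simp; norm_num
      linarith
    · have h1 := hfr fmax hf
      have hdμ : A * d ≤ μ := by
        have e1 : ∫⁻ ω, (X ω : ℝ≥0∞) ∂P = ENNReal.ofReal μ := by
          rw [hμ, ofReal_integral_eq_lintegral_ofReal hXi (ae_of_all _ fun ω => by positivity)]
          simp
        have e2 : 1 / fmax * d = ENNReal.ofReal (A * d) := by
          rw [ENNReal.ofReal_mul hA0.le, h0, ENNReal.ofReal_toReal (by simp [hf0.ne'])]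
          simp
        rw [e1, e2] at h1
        exact (ENNReal.ofReal_le_ofReal_iff hμpos.le).1 h1
      have h2 : (d : ℝ) / μ ≤ 1 / A := by
        rw [div_le_div_iff₀ hμpos hA0]; linarith
      have h3 := mul_le_mul_of_nonneg_left h2 (by positivity : 0 ≤ (2 * β * A - B) / 6)
      have h4 : (2 * β * A - B) / 6 * (1 / A) = β / 3 - B / (6 * A) := by field_simp; ring
      linarith
  rw [← hm] at hrV
  linarith

end LongRun

/-! ### Exceedance times of continuous unbounded paths -/

section Hitting

/-- First time after `y` at which the squared path exceeds `β`, with values in `[0, ∞]`;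
the times are restricted to a countable dense set, which makes no difference for continuous paths. -/
noncomputable def hitTop (β : ℝ) (x : ℝ≥0 → ℝ) (y : ℝ≥0) : ℝ≥0∞ :=
  ⨅ n, if y ≤ TopologicalSpace.denseSeq ℝ≥0 n ∧ β < x (TopologicalSpace.denseSeq ℝ≥0 n) ^ 2
    then (TopologicalSpace.denseSeq ℝ≥0 n : ℝ≥0∞) else ∞

/-- First time after `y` at which the squared path exceeds `β`. -/
noncomputable def hit (β : ℝ) (x : ℝ≥0 → ℝ) (y : ℝ≥0) : ℝ≥0 := (hitTop β x y).toNNReal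

lemma measurable_hit (β : ℝ) : Measurable (fun p : (ℝ≥0 → ℝ) × ℝ≥0 => hit β p.1 p.2) := by
  refine Measurable.ennreal_toNNReal (Measurable.iInf fun n => ?_)
  refine Measurable.ite ?_ measurable_const measurable_const
  exact (measurableSet_le measurable_snd measurable_const).inter (measurableSet_lt measurable_const
    (((measurable_pi_apply _).comp measurable_fst).pow_const 2))

/-- Continuous unbounded paths. -/
structure Wandering (x : ℝ≥0 → ℝ) : Prop where
  cont : Continuous x
  unbounded : ∀ c, ∃ s, c < |x s|

variable {β : ℝ} {x : ℝ≥0 → ℝ} {y : ℝ≥0}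

lemma Wandering.exists_sq_gt (hx : Wandering x) (β : ℝ) (y : ℝ≥0) : ∃ s, y < s ∧ β < x s ^ 2 := by
  obtain ⟨c, hc⟩ := (isCompact_Icc (a := (0 : ℝ≥0)) (b := y)).exists_bound_of_continuousOn
    hx.cont.continuousOn
  obtain ⟨s, hs⟩ := hx.unbounded (max c (|β| + 1))
  refine ⟨s, ?_, ?_⟩
  · by_contra h
    have := hc s ⟨zero_le, not_lt.1 h⟩
    rw [Real.norm_eq_abs] at this
    exact absurd ((le_max_left _ _).trans_lt hs) (not_lt.2 this)
  · have h1 := (le_max_right _ _).trans_lt hs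
    rw [← sq_abs]
    nlinarith [abs_nonneg β, le_abs_self β]

/-- Unboundedness makes the infimum finite, so `toNNReal` loses nothing. The countable description
underlies the causality of the threshold policy. -/
lemma Wandering.hit_lt_iff (hx : Wandering x) {u : ℝ≥0} :
    hit β x y < u ↔ ∃ n, y ≤ TopologicalSpace.denseSeq ℝ≥0 n ∧
      β < x (TopologicalSpace.denseSeq ℝ≥0 n) ^ 2 ∧ TopologicalSpace.denseSeq ℝ≥0 n < u := by
  have hlt : ∀ v : ℝ≥0∞, hitTop β x y < v ↔ ∃ n, y ≤ TopologicalSpace.denseSeq ℝ≥0 n ∧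
      β < x (TopologicalSpace.denseSeq ℝ≥0 n) ^ 2 ∧ (TopologicalSpace.denseSeq ℝ≥0 n : ℝ≥0∞) < v := by
    intro v
    rw [hitTop, iInf_lt_iff]
    refine exists_congr fun n => ?_
    split_ifs with h
    · exact ⟨fun h' => ⟨h.1, h.2, h'⟩, fun h' => h'.2.2⟩
    · exact ⟨fun h' => absurd h' (by simp), fun h' => absurd ⟨h'.1, h'.2.1⟩ h⟩
  have hfin : hitTop β x y ≠ ∞ := by
    obtain ⟨s, hs1, hs2⟩ := hx.exists_sq_gt β y
    have hopen : IsOpen {t | y < t ∧ β < x t ^ 2} :=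
      (isOpen_lt continuous_const continuous_id).inter
        (isOpen_lt continuous_const (hx.cont.pow 2))
    obtain ⟨n, hn⟩ := (TopologicalSpace.denseRange_denseSeq ℝ≥0).exists_mem_open hopen ⟨s, hs1, hs2⟩
    exact ((hlt ∞).2 ⟨n, hn.1.le, hn.2, ENNReal.coe_lt_top⟩).ne
  rw [hit, ← ENNReal.coe_lt_coe, ENNReal.coe_toNNReal hfin, hlt]
  simp only [ENNReal.coe_lt_coe]

/-- By continuity a strict excess at s persists shortly after s, hence occurs at times of the dense
sequence arbitrarily close to s. -/
lemma Wandering.hit_le_of_sq_gt (hx : Wandering x) {s : ℝ≥0} (hys : y ≤ s) (hs : β < x s ^ 2) :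
    hit β x y ≤ s := by
  refine le_of_forall_gt fun u hu => ?_
  have hopen : IsOpen {t | β < x t ^ 2} := isOpen_lt continuous_const (hx.cont.pow 2)
  have h1 : {t | β < x t ^ 2} ∈ 𝓝[>] s := nhdsWithin_le_nhds (hopen.mem_nhds hs)
  have h2 : Set.Ioo s u ∈ 𝓝[>] s := Ioo_mem_nhdsGT hu
  obtain ⟨v, hv1, hv2⟩ := (Filter.nonempty_of_mem (inter_mem h1 h2))
  obtain ⟨n, hn⟩ := (TopologicalSpace.denseRange_denseSeq ℝ≥0).exists_mem_open
    (hopen.inter isOpen_Ioo) ⟨v, hv1, hv2⟩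
  exact hx.hit_lt_iff.2 ⟨n, hys.trans hn.2.1.le, hn.1, hn.2.2⟩

lemma Wandering.le_hit (hx : Wandering x) (β : ℝ) (y : ℝ≥0) : y ≤ hit β x y := by
  by_contra h
  obtain ⟨n, h1, -, h2⟩ := hx.hit_lt_iff.1 (not_le.1 h)
  exact absurd (h1.trans_lt h2) (lt_irrefl y)

lemma Wandering.sq_le_of_lt_hit (hx : Wandering x) {s : ℝ≥0} (hys : y ≤ s) (hs : s < hit β x y) :
    x s ^ 2 ≤ β := by
  by_contra h
  exact absurd (hx.hit_le_of_sq_gt hys (not_le.1 h)) (not_le.2 hs)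

lemma Wandering.le_sq_hit (hx : Wandering x) : β ≤ x (hit β x y) ^ 2 := by
  by_contra! h
  have hopen : IsOpen {t | x t ^ 2 < β} := isOpen_lt (hx.cont.pow 2) continuous_const
  have h1 : ∀ᶠ t in 𝓝[≥] (hit β x y), x t ^ 2 < β := nhdsWithin_le_nhds (hopen.mem_nhds h)
  obtain ⟨u, hu, hsub⟩ := (mem_nhdsGE_iff_exists_Ico_subset).1 h1
  obtain ⟨n, hn1, hn2, hn3⟩ := hx.hit_lt_iff.1 hu
  have h4 : hit β x y ≤ TopologicalSpace.denseSeq ℝ≥0 n := hx.hit_le_of_sq_gt hn1 hn2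
  exact absurd (hsub ⟨h4, hn3⟩) (not_lt.2 hn2.le)

/-- Either the level is exceeded from the outset and the hitting time is y, or by continuity it is
reached exactly. -/
lemma Wandering.sq_hit (hx : Wandering x) (β : ℝ) (y : ℝ≥0) :
    x (hit β x y) ^ 2 = max (x y ^ 2) β := by
  rcases lt_or_ge β (x y ^ 2) with h | h
  · rw [le_antisymm (hx.hit_le_of_sq_gt le_rfl h) (hx.le_hit β y), max_eq_left h.le]
  · rw [max_eq_right h]
    refine le_antisymm ?_ hx.le_sq_hit
    rcases eq_or_lt_of_le (hx.le_hit β y) with he | hlt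
    · rw [← he]; exact h
    · have hcl : IsClosed {t | x t ^ 2 ≤ β} := isClosed_le (hx.cont.pow 2) continuous_const
      have h1 : hit β x y ∈ closure (Set.Ico y (hit β x y)) := by
        rw [closure_Ico hlt.ne]; exact ⟨hlt.le, le_rfl⟩
      exact hcl.closure_subset_iff.2 (fun s hs => hx.sq_le_of_lt_hit hs.1 hs.2) h1

lemma Wandering.sq_le_max (hx : Wandering x) {s : ℝ≥0} (hys : y ≤ s) (hs : s ≤ hit β x y) :
    x s ^ 2 ≤ max (x y ^ 2) β := by
  rcases eq_or_lt_of_le hs with rfl | hlt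
  · exact (hx.sq_hit β y).le
  · exact (hx.sq_le_of_lt_hit hys hlt).trans (le_max_right _ _)

end Hitting

/-! ### The threshold policy and its causality -/

section ThresholdPolicy

variable {Ω : Type*} {mΩ : MeasurableSpace Ω} {P : Measure Ω} {W : ℝ≥0 → Ω → ℝ}
  {Y : ℕ → Ω → ℝ≥0} {β : ℝ}

/-- The instants at which the threshold policy takes its samples: a sample is taken as soon as the
previous one is delivered and the squared deviation of the signal from it exceeds `β`. -/
noncomputable def epoch (β : ℝ) (W : ℝ≥0 → Ω → ℝ) (Y : ℕ → Ω → ℝ≥0) : ℕ → Ω → ℝ≥0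
  | 0, _ => 0
  | i + 1, ω => epoch β W Y i ω + hit β (incr W (epoch β W Y i) ω) (Y (i + 1) ω)

/-- The threshold policy. -/
noncomputable def threshold (β : ℝ) (W : ℝ≥0 → Ω → ℝ) (Y : ℕ → Ω → ℝ≥0) (i : ℕ) (ω : Ω) : ℝ≥0 :=
  -- The subtraction is truncated: samples 0 and 1 are both taken at time 0, so the first
  -- transmission starts at once.
  epoch β W Y (i - 1) ω

/-- Duration of a cycle of the threshold policy. -/
noncomputable def cycle (β : ℝ) (W : ℝ≥0 → Ω → ℝ) (Y : ℕ → Ω → ℝ≥0) (i : ℕ) (ω : Ω) : ℝ≥0 :=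
  hit β (incr W (epoch β W Y i) ω) (Y (i + 1) ω)

lemma epoch_succ (i : ℕ) (ω : Ω) : epoch β W Y (i + 1) ω = epoch β W Y i ω + cycle β W Y i ω := rfl

lemma wandering_incr (hc : ∀ ω, Continuous (W · ω)) (hu : ∀ ω c, ∃ t, c < |W t ω|)
    (τ : Ω → ℝ≥0) (ω : Ω) : Wandering (incr W τ ω) := by
  refine ⟨((hc ω).comp (continuous_const.add continuous_id)).sub continuous_const, fun c => ?_⟩
  obtain ⟨b, hb⟩ := (isCompact_Icc (a := (0 : ℝ≥0)) (b := τ ω)).exists_bound_of_continuousOn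
    (hc ω).continuousOn
  obtain ⟨t, ht⟩ := hu ω (max b (c + |W (τ ω) ω|))
  have h1 : τ ω ≤ t := by
    by_contra h
    have := hb t ⟨zero_le, (not_le.1 h).le⟩
    rw [Real.norm_eq_abs] at this
    exact absurd ((le_max_left _ _).trans_lt ht) (not_lt.2 this)
  refine ⟨t - τ ω, ?_⟩
  have h2 := (le_max_right _ _).trans_lt ht
  have h3 : |W t ω| ≤ |W t ω - W (τ ω) ω| + |W (τ ω) ω| := by
    have := abs_add_le (W t ω - W (τ ω) ω) (W (τ ω) ω)
    simpa using this
  simp only [incr, add_tsub_cancel_of_le h1]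
  linarith

namespace Model

lemma wandering (M : Model P W Y) (τ : Ω → ℝ≥0) (ω : Ω) : Wandering (incr W τ ω) :=
  wandering_incr M.cont M.unbounded τ ω

/-- A cycle is never shorter than its transmission, so every sample finds an idle channel. -/
lemma delivery_threshold (M : Model P W Y) (i : ℕ) (ω : Ω) :
    delivery (threshold β W Y) Y (i + 1) ω = epoch β W Y i ω + Y (i + 1) ω := by
  have h : ∀ i, delivery (threshold β W Y) Y i ω ≤ epoch β W Y i ω ∧
      delivery (threshold β W Y) Y (i + 1) ω = epoch β W Y i ω + Y (i + 1) ω := by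
    intro i
    induction i with
    | zero => exact ⟨le_rfl, by simp [delivery, threshold]⟩
    | succ i ih =>
      have h1 : delivery (threshold β W Y) Y (i + 1) ω ≤ epoch β W Y (i + 1) ω := by
        rw [ih.2, epoch_succ]
        exact add_le_add_right ((M.wandering _ ω).le_hit β _) _
      refine ⟨h1, ?_⟩
      rw [delivery_succ, start]
      congr 1
      exact max_eq_left h1
  exact (h i).2

lemma delivery_le_epoch (M : Model P W Y) (i : ℕ) (ω : Ω) :
    delivery (threshold β W Y) Y i ω ≤ epoch β W Y i ω := by
  rcases i with _ | i
  · exact le_rfl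
  · rw [M.delivery_threshold, epoch_succ]
    exact add_le_add_right ((M.wandering _ ω).le_hit β _) _

lemma measurable_epoch (M : Model P W Y) (i : ℕ) : Measurable (epoch β W Y i) := by
  induction i with
  | zero => exact measurable_const
  | succ i ih =>
    have he := measurable_eval_time M.cont M.measW
    have h1 : Measurable (incr W (epoch β W Y i)) := measurable_pi_lambda _ fun t =>
      (he.comp ((ih.add_const t).prodMk measurable_id)).sub (he.comp (ih.prodMk measurable_id))
    exact ih.add ((measurable_hit β).comp (h1.prodMk (M.measY (i + 1))))

/-- The hitting time uses dense times relative to the previous sample. Since exceedance is an open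
condition, it can be detected at deterministic dense times, which is what causality needs. -/
lemma epoch_lt_iff (M : Model P W Y) {i : ℕ} {u : ℝ≥0} {ω : Ω} :
    epoch β W Y (i + 1) ω < u ↔ ∃ n, TopologicalSpace.denseSeq ℝ≥0 n < u ∧
      delivery (threshold β W Y) Y (i + 1) ω ≤ TopologicalSpace.denseSeq ℝ≥0 n ∧
      β < (W (TopologicalSpace.denseSeq ℝ≥0 n) ω - W (epoch β W Y i ω) ω) ^ 2 := by
  have hw := M.wandering (epoch β W Y i) ω
  rw [M.delivery_threshold]
  constructor
  · intro h
    rw [epoch_succ, add_comm, ← lt_tsub_iff_right, cycle, hw.hit_lt_iff] at h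
    obtain ⟨n, h1, h2, h3⟩ := h
    rw [lt_tsub_iff_right, add_comm] at h3
    obtain ⟨t, ht⟩ : ∃ t, t = epoch β W Y i ω + TopologicalSpace.denseSeq ℝ≥0 n := ⟨_, rfl⟩
    rw [incr, ← ht] at h2
    rw [← ht] at h3
    have hopen : IsOpen {s | β < (W s ω - W (epoch β W Y i ω) ω) ^ 2} :=
      isOpen_lt continuous_const (((M.cont ω).sub continuous_const).pow 2)
    have k1 : {s | β < (W s ω - W (epoch β W Y i ω) ω) ^ 2} ∈ 𝓝[>] t :=
      nhdsWithin_le_nhds (hopen.mem_nhds h2)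
    obtain ⟨v, hv1, hv2⟩ := Filter.nonempty_of_mem (inter_mem k1 (Ioo_mem_nhdsGT h3))
    obtain ⟨k, hk⟩ := (TopologicalSpace.denseRange_denseSeq ℝ≥0).exists_mem_open
      (hopen.inter isOpen_Ioo) ⟨v, hv1, hv2⟩
    refine ⟨k, hk.2.2, le_trans ?_ hk.2.1.le, hk.1⟩
    rw [ht]
    exact add_le_add_right h1 _
  · rintro ⟨n, h1, h2, h3⟩
    obtain ⟨q, hq⟩ : ∃ q, q = TopologicalSpace.denseSeq ℝ≥0 n := ⟨_, rfl⟩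
    rw [← hq] at h1 h2 h3
    have h4 : epoch β W Y i ω ≤ q := le_self_add.trans h2
    refine lt_of_le_of_lt ?_ h1
    rw [epoch_succ, cycle, ← le_tsub_iff_left h4]
    refine hw.hit_le_of_sq_gt ((le_tsub_iff_left h4).2 h2) ?_
    rwa [incr, add_tsub_cancel_of_le h4]

end Model

lemma info_mono (W : ℝ≥0 → Ω → ℝ) (S Y : ℕ → Ω → ℝ≥0) (i : ℕ) {s t : ℝ≥0} (h : s ≤ t) :
    info W S Y i s ≤ info W S Y i t := by
  refine sup_le_sup (sup_le_sup ?_ ?_) ?_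
  · exact iSup₂_le fun u hu => le_iSup₂_of_le (f := fun u (_ : u ≤ t) =>
      MeasurableSpace.comap (W u) inferInstance) u (hu.trans h) le_rfl
  · exact MeasurableSpace.generateFrom_mono fun A ⟨u, hu, e⟩ => ⟨u, hu.trans h, e⟩
  · exact MeasurableSpace.generateFrom_mono fun A ⟨u, hu, e⟩ => ⟨u, hu.trans h, e⟩

lemma measurable_info (W : ℝ≥0 → Ω → ℝ) (S Y : ℕ → Ω → ℝ≥0) (i : ℕ) {s t : ℝ≥0} (h : s ≤ t) :
    Measurable[info W S Y i t] (W s) := by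
  refine measurable_iff_comap_le.2 (le_trans ?_ (le_trans le_sup_left le_sup_left))
  exact le_iSup₂ (f := fun u (_ : u ≤ t) => MeasurableSpace.comap (W u) inferInstance) s h

lemma measurableSet_info_sampled (W : ℝ≥0 → Ω → ℝ) (S Y : ℕ → Ω → ℝ≥0) {i j : ℕ} (hj : j < i)
    {s t : ℝ≥0} (h : s ≤ t) : MeasurableSet[info W S Y i t] {ω | S j ω ≤ s} :=
  (le_sup_right : _ ≤ info W S Y i t) _
    (MeasurableSpace.measurableSet_generateFrom ⟨s, h, j, hj, rfl⟩)

lemma measurableSet_info_busy (W : ℝ≥0 → Ω → ℝ) (S Y : ℕ → Ω → ℝ≥0) (i : ℕ)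
    {s t : ℝ≥0} (h : s ≤ t) : MeasurableSet[info W S Y i t] (busyBefore S Y i s) :=
  (le_trans le_sup_right le_sup_left : _ ≤ info W S Y i t) _
    (MeasurableSpace.measurableSet_generateFrom ⟨s, h, rfl⟩)

namespace Model

/-- The sampler sees the channel state rather than the deliveries; this recovers the latter from the
former. -/
lemma delivered_iff (_ : Model P W Y) (i : ℕ) (q : ℝ≥0) (ω : Ω) :
    delivery (threshold β W Y) Y (i + 1) ω ≤ q ↔ threshold β W Y (i + 1) ω ≤ q ∧
      ω ∉ busyBefore (threshold β W Y) Y (i + 2) q := by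
  constructor
  · intro h
    refine ⟨(le_delivery _ Y i ω).trans h, ?_⟩
    rintro ⟨j, hj, -, h2⟩
    exact absurd (h2.trans_le (delivery_mono _ Y ω (Nat.le_of_lt_succ hj))) (not_lt.2 h)
  · rintro ⟨h1, h2⟩
    by_contra h
    exact h2 ⟨i + 1, Nat.lt_succ_self _, h1, not_le.1 h⟩

/-- The threshold policy is causal. -/
lemma isCausal_threshold (M : Model P W Y) : IsCausal P W Y (threshold β W Y) := by
  have htriv : ∀ (i : ℕ) (t : ℝ≥0), (∀ ω, threshold β W Y i ω = 0) → ∃ A : Set Ω,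
      MeasurableSet[infoPlus W (threshold β W Y) Y i t] A ∧ {ω | threshold β W Y i ω ≤ t} =ᵐ[P] A := by
    intro i t h
    refine ⟨Set.univ, MeasurableSet.univ, ?_⟩
    have : {ω | threshold β W Y i ω ≤ t} = Set.univ := by
      ext ω; simp [h]
    rw [this]
    exact ae_eq_refl _
  intro i t
  match i with
  | 0 => exact htriv 0 t fun ω => rfl
  | 1 => exact htriv 1 t fun ω => rfl
  | j + 2 =>
    refine ⟨_, ?_, ae_eq_refl _⟩
    have hq : ∀ q : ℝ≥0, MeasurableSet[info W (threshold β W Y) Y (j + 2) q]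
        {ω | delivery (threshold β W Y) Y (j + 1) ω ≤ q ∧
          β < (W q ω - W (epoch β W Y j ω) ω) ^ 2} := by
      intro q
      have h1 := measurableSet_info_sampled W (threshold β W Y) Y (Nat.lt_succ_self (j + 1)) (le_refl q)
      have h2 := (measurableSet_info_busy W (threshold β W Y) Y (j + 2) (le_refl q)).compl
      -- Cut off at q, the previous sampling time is observable at q without any condition, and so
      -- is the signal at that time.
      have hmin : Measurable[info W (threshold β W Y) Y (j + 2) q]
          (fun ω => min (epoch β W Y j ω) q) := by
        refine measurable_of_Iic fun s => ?_
        rcases le_or_gt q s with h | h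
        · convert MeasurableSet.univ
          ext ω; simp [h]
        · have := measurableSet_info_sampled W (threshold β W Y) Y (Nat.lt_succ_self (j + 1)) h.le
          convert this using 1
          ext ω
          simp [h, threshold]
      have hst := measurable_eval_time (mΩ := info W (threshold β W Y) Y (j + 2) q)
        (W := fun s ω => W (min s q) ω)
        (fun ω => (M.cont ω).comp (continuous_id.min continuous_const))
        (fun s => measurable_info W _ Y (j + 2) (min_le_right s q))
      have hev := hst.comp (hmin.prodMk measurable_id)
      have h3 : MeasurableSet[info W (threshold β W Y) Y (j + 2) q]
          {ω | β < (W q ω - W (min (min (epoch β W Y j ω) q) q) ω) ^ 2} :=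
        measurableSet_lt measurable_const
          (((measurable_info W _ Y (j + 2) le_rfl).sub hev).pow_const 2)
      convert (h1.inter h2).inter h3 using 1
      ext ω
      simp only [Set.mem_ofPred_eq, Set.mem_inter_iff, Set.mem_compl_iff, M.delivered_iff]
      refine and_congr_right fun h => ?_
      have : epoch β W Y j ω ≤ q := h.1
      rw [min_eq_left this, min_eq_left this]
    have hlt : ∀ u, MeasurableSet[info W (threshold β W Y) Y (j + 2) u]
        {ω | threshold β W Y (j + 2) ω < u} := by
      intro u
      have : {ω | threshold β W Y (j + 2) ω < u} = ⋃ n, ⋃ (_ : TopologicalSpace.denseSeq ℝ≥0 n < u),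
          {ω | delivery (threshold β W Y) Y (j + 1) ω ≤ TopologicalSpace.denseSeq ℝ≥0 n ∧
          β < (W (TopologicalSpace.denseSeq ℝ≥0 n) ω - W (epoch β W Y j ω) ω) ^ 2} := by
        ext ω
        simp only [Set.mem_ofPred_eq, Set.mem_iUnion, exists_prop]
        exact M.epoch_lt_iff
      rw [this]
      exact MeasurableSet.iUnion fun n => MeasurableSet.iUnion fun hn => info_mono W _ Y _ hn.le _ (hq _)
    simp only [MeasurableSpace.measurableSet_iInf]
    intro u hu
    -- The event is the intersection of {S < v n} along times v n between t and u that decrease to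
    -- t; all of these are known at u.
    obtain ⟨v, hanti, hv, hlim⟩ := exists_seq_strictAnti_tendsto' hu
    have : {ω | threshold β W Y (j + 2) ω ≤ t} = ⋂ n, {ω | threshold β W Y (j + 2) ω < v n} := by
      ext ω
      simp only [Set.mem_ofPred_eq, Set.mem_iInter]
      exact ⟨fun h n => h.trans_lt (hv n).1, fun h => ge_of_tendsto' hlim fun n => (h n).le⟩
    rw [this]
    exact MeasurableSet.iInter fun n => info_mono W _ Y _ (hv n).2.le _ (hlt _)

lemma timed_threshold (M : Model P W Y) : Timed P W Y (threshold β W Y) :=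
  M.timed (fun i => M.measurable_epoch (i - 1)) (ae_of_all _ fun _ => rfl) M.isCausal_threshold

lemma stops_epoch (M : Model P W Y) (i : ℕ) : Stops (history P W Y i) (epoch β W Y i) :=
  M.timed_threshold.sampling i

end Model

end ThresholdPolicy

/-! ### Independent identically distributed sequences -/

section Sequences

variable {Ω : Type*} {mΩ : MeasurableSpace Ω} {P : Measure Ω}

/-- Variables that are successively independent of their predecessors are independent. -/
lemma iIndepFun_of_indep_past [IsProbabilityMeasure P] {X : ℕ → Ω → ℝ≥0}
    {F : ℕ → MeasurableSpace Ω} (hF : ∀ i j, i < j → Measurable[F j] (X i))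
    (h : ∀ i, Indep (F i) (MeasurableSpace.comap (X i) inferInstance) P) : iIndepFun X P := by
  rw [iIndepFun_iff_measure_inter_preimage_eq_mul]
  intro s
  induction s using Finset.induction_on_max with
  | empty => simp
  | insert a s ha ih =>
    intro A hA
    have hna : a ∉ s := fun h => lt_irrefl a (ha a h)
    rw [Finset.set_biInter_insert, Finset.prod_insert hna, Set.inter_comm]
    have h1 : MeasurableSet[F a] (⋂ i ∈ s, X i ⁻¹' A i) :=
      Finset.measurableSet_biInter s fun i hi =>
        hF i a (ha i hi) (hA i (Finset.mem_insert_of_mem hi))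
    rw [(Indep_iff _ _ P).1 (h a) _ _ h1 ⟨A a, hA a (Finset.mem_insert_self _ _), rfl⟩,
      ih fun i hi => hA i (Finset.mem_insert_of_mem hi), mul_comm]

variable {X : ℕ → Ω → ℝ≥0}

lemma identDistrib_tail [IsProbabilityMeasure P] (hm : ∀ i, Measurable (X i)) (hi : iIndepFun X P)
    (hid : ∀ i, IdentDistrib (X i) (X 0) P P) (j : ℕ) :
    IdentDistrib (fun ω i => X (j + i) ω) (fun ω i => X i ω) P P := by
  refine ⟨(measurable_pi_lambda _ fun i => hm _).aemeasurable,
    (measurable_pi_lambda _ fun i => hm _).aemeasurable, ?_⟩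
  have h1 : iIndepFun (fun i => X (j + i)) P := hi.precomp (g := fun i => j + i)
    (add_right_injective j)
  rw [h1.map_fun_eq_infinitePi_map₀' fun i => (hm _).aemeasurable,
    hi.map_fun_eq_infinitePi_map₀' fun i => (hm _).aemeasurable]
  congr 1
  funext i
  rw [(hid (j + i)).map_eq, (hid i).map_eq]

lemma indepFun_tail (hm : ∀ i, Measurable (X i)) (hi : iIndepFun X P) (j : ℕ) :
    IndepFun (fun ω i => X (j + i) ω) (fun ω (i : Fin j) => X i ω) P := by
  rw [IndepFun_iff_Indep]
  have h := indep_iSup_of_disjoint (fun i => (hm i).comap_le) ((iIndepFun_iff_iIndep _ _ _).1 hi)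
    (S := Set.Ici j) (T := Set.Iio j)
    (Set.disjoint_left.2 fun a h1 h2 => absurd (Set.mem_Ici.1 h1) (not_le.2 h2))
  refine indep_of_indep_of_le h ?_ ?_
  · refine Measurable.comap_le (@measurable_pi_lambda _ _ _ (_) _ _ fun i =>
      (comap_measurable (X (j + i))).mono ?_ le_rfl)
    exact le_iSup₂ (f := fun i (_ : i ∈ Set.Ici j) => MeasurableSpace.comap (X i) inferInstance)
      (j + i) (Nat.le_add_right j i)
  · refine Measurable.comap_le (@measurable_pi_lambda _ _ _ (_) _ _ fun i =>
      (comap_measurable (X i)).mono ?_ le_rfl)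
    exact le_iSup₂ (f := fun i (_ : i ∈ Set.Iio j) => MeasurableSpace.comap (X i) inferInstance)
      (i : ℕ) i.2

lemma epoch_eq_sum (β : ℝ) (W : ℝ≥0 → Ω → ℝ) (Y : ℕ → Ω → ℝ≥0) (n : ℕ) (ω : Ω) :
    epoch β W Y n ω = partialSum (fun i => cycle β W Y i ω) n := by
  induction n with
  | zero => rfl
  | succ n ih => rw [epoch_succ, ih, partialSum, partialSum, Finset.sum_range_succ]

end Sequences

/-! ### Independence of the cycles and regeneration -/

section Cycles

variable {Ω : Type*} {mΩ : MeasurableSpace Ω} {P : Measure Ω} [IsProbabilityMeasure P]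
  {W : ℝ≥0 → Ω → ℝ} {Y : ℕ → Ω → ℝ≥0} {β : ℝ}

namespace Model

lemma measurable_cycle (M : Model P W Y) (i : ℕ) : Measurable (cycle β W Y i) :=
  (measurable_hit β).comp
    (((M.isBM 0).measurable_incr (M.measurable_epoch i)).prodMk (M.measY (i + 1)))

lemma epoch_mono (β : ℝ) (W : ℝ≥0 → Ω → ℝ) (Y : ℕ → Ω → ℝ≥0) (ω : Ω) :
    Monotone (fun i => epoch β W Y i ω) :=
  monotone_nat_of_le_succ fun _ => le_self_add

/-- Each cycle is the same function of the increments after its epoch and the next transmission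
time. By the strong Markov property this pair always has the same product law. -/
lemma identDistrib_cycle (M : Model P W Y) (i : ℕ) :
    IdentDistrib (cycle β W Y i) (cycle β W Y 0) P P := by
  have hpair : ∀ i, Measurable (fun ω => (incr W (epoch β W Y i) ω, Y (i + 1) ω)) := fun i =>
    ((M.isBM 0).measurable_incr (M.measurable_epoch i)).prodMk (M.measY (i + 1))
  have hlaw : ∀ i, P.map (fun ω => (incr W (epoch β W Y i) ω, Y (i + 1) ω)) =
      (P.map (fun ω t => W t ω)).prod (P.map (Y 1)) := fun i => by
    have h1 : IndepFun (incr W (epoch β W Y i)) (Y (i + 1)) P :=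
      M.indepFun_service (M.measurable_incr_total (M.stops_epoch i))
    rw [(indepFun_iff_map_prod_eq_prod_map_map
      ((M.isBM 0).measurable_incr (M.measurable_epoch i)).aemeasurable
      (M.measY (i + 1)).aemeasurable).1 h1, (M.isBM i).map_incr (M.stops_epoch i),
      (M.identY i).map_eq]
  have : IdentDistrib (fun ω => (incr W (epoch β W Y i) ω, Y (i + 1) ω))
      (fun ω => (incr W (epoch β W Y 0) ω, Y (0 + 1) ω)) P P :=
    ⟨(hpair i).aemeasurable, (hpair 0).aemeasurable, by rw [hlaw, hlaw]⟩
  exact this.comp (measurable_hit β)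

/-- Earlier cycles belong to the past of the epoch, while the new cycle depends on later increments
and a fresh transmission time, which are jointly independent of that past. -/
lemma iIndepFun_cycle (M : Model P W Y) : iIndepFun (cycle β W Y) P := by
  refine iIndepFun_of_indep_past (F := fun i => (M.stops_epoch (β := β) i).measurableSpace) ?_ ?_
  · intro i j hij
    have h1 : ∀ k ≤ j, Measurable[(M.stops_epoch (β := β) j).measurableSpace] (epoch β W Y k) := by
      intro k hk
      have h2 := M.stops_epoch (β := β) k
      exact (h2.history_mono hk).measurable_past.mono
        ((h2.history_mono hk).past_mono (M.stops_epoch j) (fun ω => epoch_mono β W Y ω hk)) le_rfl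
    have h3 : cycle β W Y i = fun ω => epoch β W Y (i + 1) ω - epoch β W Y i ω := by
      ext ω; rw [epoch_succ, add_tsub_cancel_left]
    rw [h3]
    exact (h1 (i + 1) hij).sub (h1 i hij.le)
  · intro i
    have hs := M.stops_epoch (β := β) i
    have hB := M.measurable_incr_total hs
    have hB' := (M.isBM i).measurable_incr hs.measurable
    have hind : Indep (MeasurableSpace.comap (incr W (epoch β W Y i)) inferInstance ⊔
        MeasurableSpace.comap (Y (i + 1)) inferInstance) hs.measurableSpace P := by
      refine Indep.sup_of_sup hB'.comap_le (M.measY (i + 1)).comap_le hs.measurableSpace_le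
        ((M.isBM i).indep_incr hs).symm ?_
      exact indep_of_indep_of_le_left (M.indep_total i) (sup_le hB.comap_le (M.past_le_total hs))
    refine indep_of_indep_of_le_right hind.symm (Measurable.comap_le ?_)
    refine (measurable_hit β).comp (Measurable.prodMk ?_ ?_)
    · exact measurable_iff_comap_le.2 le_sup_left
    · exact measurable_iff_comap_le.2 le_sup_right

lemma renews_cycle (M : Model P W Y) : Renews P (fun ω i => cycle β W Y i ω) 1 where
  measurable := measurable_pi_lambda _ M.measurable_cycle
  ident := identDistrib_tail M.measurable_cycle M.iIndepFun_cycle M.identDistrib_cycle 1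
  indep := indepFun_tail M.measurable_cycle M.iIndepFun_cycle 1

/-- The threshold policy is regenerative at every sample. -/
lemma isRegenerative_threshold (M : Model P W Y)
    (hpos : 0 < ∫⁻ ω, (cycle β W Y 0 ω : ℝ≥0∞) ^ 2 ∂P)
    (hfin : ∫⁻ ω, (cycle β W Y 0 ω : ℝ≥0∞) ^ 2 ∂P < ∞) : IsRegenerative P (threshold β W Y) := by
  have hT : ∀ i ω, interSampling (threshold β W Y) (i + 1) ω = cycle β W Y i ω := fun i ω => by
    simp only [interSampling, threshold, Nat.add_sub_cancel, epoch_succ, add_tsub_cancel_left]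
  have hsq : ∀ j, ∫⁻ ω, ((threshold β W Y (j + 1 + 1) ω - threshold β W Y (j + 1) ω : ℝ≥0) : ℝ≥0∞) ^ 2 ∂P =
      ∫⁻ ω, (cycle β W Y 0 ω : ℝ≥0∞) ^ 2 ∂P := fun j => by
    have := ((M.identDistrib_cycle (β := β) j).comp (u := fun t : ℝ≥0 => (t : ℝ≥0∞) ^ 2)
      (by fun_prop)).lintegral_eq
    simp only [Function.comp_apply] at this
    rw [← this]
    refine lintegral_congr fun ω => ?_
    rw [← hT]; rfl
  -- Regeneration starts at index 1, because the first inter-sampling time vanishes and is no cycle.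
  refine ⟨fun j => j + 1, fun a b h => Nat.succ_lt_succ h, fun j => ?_, fun j => ?_, ?_, fun j => ?_⟩
  · have h1 : ∀ j, (fun ω i => interSampling (threshold β W Y) (j + 1 + i) ω) =
        fun ω i => cycle β W Y (j + i) ω := fun j => by
      funext ω i
      rw [show j + 1 + i = j + i + 1 by ring, hT]
    rw [h1, h1]
    simpa using identDistrib_tail M.measurable_cycle M.iIndepFun_cycle M.identDistrib_cycle j
  · have h1 : (fun ω i => interSampling (threshold β W Y) (j + 1 + i) ω) =
        fun ω i => cycle β W Y (j + i) ω := by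
      funext ω i
      rw [show j + 1 + i = j + i + 1 by ring, hT]
    rw [h1]
    -- The map g prepends the vanishing first inter-sampling time.
    obtain ⟨g, hg⟩ : ∃ g : (Fin j → ℝ≥0) → Fin (j + 1) → ℝ≥0, g = fun y => Fin.cons (α := fun _ => ℝ≥0) 0 y := ⟨_, rfl⟩
    have hgm : Measurable g := by
      rw [hg]
      refine measurable_pi_lambda _ fun i => ?_
      refine Fin.cases ?_ (fun i => ?_) i
      · exact measurable_const
      · exact measurable_pi_apply i
    have h2 := (indepFun_tail M.measurable_cycle (M.iIndepFun_cycle (β := β)) j).comp measurable_id hgm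
    have h3 : (fun ω (i : Fin (j + 1)) => interSampling (threshold β W Y) i ω) =
        g ∘ fun ω (i : Fin j) => cycle β W Y i ω := by
      funext ω i
      rw [hg]
      refine Fin.cases ?_ (fun i => ?_) i
      · simp [interSampling, threshold]
      · simp [hT]
    rw [h3]
    exact h2
  · simp [threshold, epoch]
  · rw [hsq]
    exact ⟨hpos, hfin⟩

end Model

end Cycles

/-! ### Expected squared error of a cycle -/

section CycleCost

variable {Ω : Type*} {mΩ : MeasurableSpace Ω} {P : Measure Ω}
  {W : ℝ≥0 → Ω → ℝ} {Y : ℕ → Ω → ℝ≥0} {β : ℝ}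

lemma stageErr_le_sqErr (W : ℝ≥0 → Ω → ℝ) (Y S : ℕ → Ω → ℝ≥0) (T : ℝ≥0) (i : ℕ) (ω : Ω) :
    stageErr W Y S T i ω ≤ sqErr W (held W S i) (delivery S Y i) (delivery S Y (i + 1)) ω := by
  unfold sqErr stageErr
  rw [← lintegral_indicator measurableSet_Ico, ← lintegral_indicator measurableSet_Icc]
  refine lintegral_mono fun t => ?_
  refine Set.indicator_apply_le' (fun ht => ?_) fun _ => zero_le
  refine Set.indicator_apply_le' (fun h => ?_) fun _ => zero_le
  rw [Set.indicator_of_mem]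
  rw [Set.mem_Ico] at h ⊢
  exact ⟨(NNReal.coe_le_coe.2 h.1).trans_eq (Real.coe_toNNReal _ ht.1),
    (Real.toNNReal_lt_iff_lt_coe ht.1).1 h.2⟩

lemma stageErr_eq_zero (W : ℝ≥0 → Ω → ℝ) (Y S : ℕ → Ω → ℝ≥0) {T : ℝ≥0} {i : ℕ} {ω : Ω}
    (h : T < delivery S Y i ω) : stageErr W Y S T i ω = 0 := by
  unfold stageErr
  refine (setLIntegral_congr_fun measurableSet_Icc fun t ht => ?_).trans lintegral_zero
  refine Set.indicator_of_notMem (fun h' => ?_) _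
  exact absurd (h.trans_le h'.1) (not_lt.2 (Real.toNNReal_le_iff_le_coe.2 ht.2))

lemma sqErr_tendsto (W : ℝ≥0 → Ω → ℝ) (a : Ω → ℝ) (σ τ : Ω → ℝ≥0) (ω : Ω) :
    Tendsto (fun N : ℕ => sqErr W a σ (fun ω => min (τ ω) (σ ω + N)) ω) atTop
      (𝓝 (sqErr W a σ τ ω)) := by
  obtain ⟨n, hn⟩ := exists_nat_ge (τ ω)
  refine tendsto_const_nhds.congr' ?_
  filter_upwards [eventually_ge_atTop n] with N hN
  have : min (τ ω) (σ ω + N) = τ ω :=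
    min_eq_left (hn.trans ((Nat.cast_le.2 hN).trans le_add_self))
  simp only [sqErr, this]

namespace Model

lemma sq_epoch (M : Model P W Y) (i : ℕ) (ω : Ω) :
    (W (epoch β W Y (i + 1) ω) ω - W (epoch β W Y i ω) ω) ^ 2 =
      max ((W (epoch β W Y i ω + Y (i + 1) ω) ω - W (epoch β W Y i ω) ω) ^ 2) β :=
  (M.wandering _ ω).sq_hit β (Y (i + 1) ω)

lemma sq_le_of_le_epoch (M : Model P W Y) (i : ℕ) {s : ℝ≥0} {ω : Ω}
    (h1 : epoch β W Y i ω + Y (i + 1) ω ≤ s) (h2 : s ≤ epoch β W Y (i + 1) ω) :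
    (W s ω - W (epoch β W Y i ω) ω) ^ 2 ≤
      max ((W (epoch β W Y i ω + Y (i + 1) ω) ω - W (epoch β W Y i ω) ω) ^ 2) β := by
  obtain ⟨u, rfl⟩ := exists_add_of_le (le_self_add.trans h1)
  rw [epoch_succ] at h2
  exact (M.wandering _ ω).sq_le_max (le_of_add_le_add_left h1) (le_of_add_le_add_left h2)

lemma sq_stopped_le (M : Model P W Y) (i : ℕ) (N : ℝ≥0) (ω : Ω) :
    (W (min (epoch β W Y (i + 1) ω) (delivery (threshold β W Y) Y (i + 1) ω + N)) ω -
      W (epoch β W Y i ω) ω) ^ 2 ≤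
      max ((W (epoch β W Y i ω + Y (i + 1) ω) ω - W (epoch β W Y i ω) ω) ^ 2) β := by
  refine M.sq_le_of_le_epoch i ?_ (min_le_left _ _)
  rw [← M.delivery_threshold]
  exact le_min (M.delivery_le_epoch (i + 1) ω) le_self_add

variable [IsProbabilityMeasure P]

/-- The displacement of the signal during a transmission is independent of the past. -/
lemma setLIntegral_displacement (M : Model P W Y) {i : ℕ} {θ : Ω → ℝ≥0}
    (hθ : Stops (history P W Y i) θ) {A : Set Ω} (hA : MeasurableSet[hθ.measurableSpace] A)
    {f : ℝ → ℝ≥0∞} (hf : Measurable f) :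
    ∫⁻ ω in A, f (W (θ ω + Y (i + 1) ω) ω - W (θ ω) ω) ∂P =
      P A * ∫⁻ ω, f (W (Y 1 ω) ω) ∂P := by
  have hθ' := hθ.history_mono i.le_succ
  have hle := hθ.past_le_history_mono i.le_succ
  have key := (M.isBM (i + 1)).lintegral_later hθ' (M.measurable_first hθ') (ξ := fun _ => ())
    measurable_const (hle _ hA) (f := fun p => f p.2) (hf.comp measurable_snd)
  obtain ⟨g, hg⟩ : ∃ g : ℝ≥0 → ℝ≥0∞, g = fun r => ∫⁻ b, f b ∂(gaussianReal 0 r) := ⟨_, rfl⟩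
  have hgmeas : Measurable g := by
    have h1 : ∀ r, g r = ∫⁻ ω, f (W r ω) ∂P := fun r => by
      have hl := M.pre.hasLaw_eval r
      rw [hg]
      beta_reduce
      rw [← hl.map_eq, lintegral_map' hf.aemeasurable hl.aemeasurable]
    have h2 : g = fun r => ∫⁻ ω, f (W r ω) ∂P := funext h1
    rw [h2]
    exact (hf.comp (measurable_eval_time M.cont M.measW)).lintegral_prod_right'
  have h3 := M.setLIntegral_service hθ hA hgmeas
  simp only [hg] at h3
  rw [key, h3, M.lintegral_displacement hf]

lemma integrable_max_displacement (M : Model P W Y) (β : ℝ) :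
    Integrable (fun ω => max (W (Y 1 ω) ω ^ 2) β) P :=
  M.integrable_displacement_sq.sup (integrable_const β)

lemma integrable_max_displacement_sq (M : Model P W Y) (β : ℝ) :
    Integrable (fun ω => max (W (Y 1 ω) ω ^ 2) β ^ 2) P := by
  refine ((integrable_const (β ^ 2)).add M.integrable_displacement_four).mono'
    (((M.measurable_displacement.pow_const 2).max measurable_const).pow_const 2).aestronglyMeasurable
    (ae_of_all _ fun ω => ?_)
  rw [Real.norm_of_nonneg (sq_nonneg _)]
  simp only [Pi.add_apply]
  rcases max_choice (W (Y 1 ω) ω ^ 2) β with h | h <;> rw [h] <;>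
    nlinarith [sq_nonneg β, sq_nonneg (W (Y 1 ω) ω ^ 2)]

lemma setLIntegral_ofReal_displacement (M : Model P W Y) {i : ℕ} {θ : Ω → ℝ≥0}
    (hθ : Stops (history P W Y i) θ) {A : Set Ω} (hA : MeasurableSet[hθ.measurableSpace] A)
    {f : ℝ → ℝ} (hf : Measurable f) (hf0 : ∀ x, 0 ≤ f x)
    (hi : Integrable (fun ω => f (W (Y 1 ω) ω)) P) :
    ∫⁻ ω in A, ENNReal.ofReal (f (W (θ ω + Y (i + 1) ω) ω - W (θ ω) ω)) ∂P =
      P A * ENNReal.ofReal (∫ ω, f (W (Y 1 ω) ω) ∂P) := by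
  rw [M.setLIntegral_displacement hθ hA hf.ennreal_ofReal,
    ofReal_integral_eq_lintegral_ofReal hi (ae_of_all _ fun ω => hf0 _)]

/-- The wait is stopped N units after the delivery, so that the horizon is known at the delivery;
Fatou's lemma later removes N. -/
lemma sandwich_threshold (M : Model P W Y) (i : ℕ) (N : ℝ≥0) {A : Set Ω}
    (hA : MeasurableSet[(M.stops_epoch (β := β) i).measurableSpace] A) :
    Sandwich P (history P W Y (i + 1)) W (delivery (threshold β W Y) Y (i + 1))
      (fun ω => min (epoch β W Y (i + 1) ω) (delivery (threshold β W Y) Y (i + 1) ω + N))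
      (fun ω => delivery (threshold β W Y) Y (i + 1) ω + N) (fun ω => W (epoch β W Y i ω) ω) A N := by
  have hD := M.timed_threshold (β := β).deliv (i + 1)
  have hR := M.stops_epoch (β := β) i
  have hle := hR.past_le_history_mono i.le_succ
  have hRD : ∀ ω, epoch β W Y i ω ≤ delivery (threshold β W Y) Y (i + 1) ω := fun ω =>
    le_delivery (threshold β W Y) Y i ω
  have hle' := (hR.history_mono i.le_succ).past_mono hD hRD
  refine
    { bm := M.isBM (i + 1), hσ := hD
      hτ := (M.stops_epoch (i + 1)).min
        (hD.of_past (hD.measurable_past.add measurable_const) fun ω => le_self_add)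
      le₁ := fun ω => le_min (M.delivery_le_epoch (i + 1) ω) le_self_add
      le₂ := fun ω => min_le_right _ _
      hθ := hD.measurable_past.add measurable_const
      ha := ((M.isBM (i + 1)).measurable_eval_past (hR.history_mono i.le_succ)).mono hle' le_rfl
      hA := hle' _ (hle _ hA)
      bdd := fun ω _ => by simp
      fin := ?_ }
  have h4 := M.setLIntegral_ofReal_displacement hR hA (f := fun x => x ^ 4) (by fun_prop)
    (fun x => by positivity) M.integrable_displacement_four
  simp only [← M.delivery_threshold] at h4
  rw [h4]
  exact ENNReal.mul_lt_top (measure_lt_top _ _) ENNReal.ofReal_lt_top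

lemma measurable_displacement_epoch (M : Model P W Y) (i : ℕ) :
    Measurable (fun ω => W (epoch β W Y i ω + Y (i + 1) ω) ω - W (epoch β W Y i ω) ω) :=
  ((M.isBM 0).measurable_eval ((M.measurable_epoch i).add (M.measY _))).sub
    ((M.isBM 0).measurable_eval (M.measurable_epoch i))

lemma setIntegral_displacement (M : Model P W Y) {i : ℕ} {A : Set Ω}
    (hA : MeasurableSet[(M.stops_epoch (β := β) i).measurableSpace] A)
    {f : ℝ → ℝ} (hf : Measurable f) (hf0 : ∀ x, 0 ≤ f x)
    (hi : Integrable (fun ω => f (W (Y 1 ω) ω)) P) :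
    IntegrableOn (fun ω => f (W (epoch β W Y i ω + Y (i + 1) ω) ω - W (epoch β W Y i ω) ω)) A P ∧
    ∫ ω in A, f (W (epoch β W Y i ω + Y (i + 1) ω) ω - W (epoch β W Y i ω) ω) ∂P =
      P.real A * ∫ ω, f (W (Y 1 ω) ω) ∂P := by
  have h := M.setLIntegral_ofReal_displacement (M.stops_epoch i) hA hf hf0 hi
  have hm := (hf.comp (M.measurable_displacement_epoch (β := β) i)).aestronglyMeasurable
    (μ := P.restrict A)
  refine ⟨(lintegral_ofReal_ne_top_iff_integrable hm (ae_of_all _ fun ω => hf0 _)).1 ?_, ?_⟩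
  · exact (h.trans_lt (ENNReal.mul_lt_top (measure_lt_top _ _) ENNReal.ofReal_lt_top)).ne
  · rw [integral_eq_lintegral_of_nonneg_ae (ae_of_all _ fun ω => hf0 _) hm]
    refine (congrArg ENNReal.toReal h).trans ?_
    rw [ENNReal.toReal_mul, ENNReal.toReal_ofReal (integral_nonneg fun ω => hf0 _)]
    rfl

/-- Expected squared error during the waiting phase of a cycle. -/
lemma lintegral_waiting_le (M : Model P W Y) (i : ℕ) {A : Set Ω}
    (hA : MeasurableSet[(M.stops_epoch (β := β) i).measurableSpace] A) :
    ∫⁻ ω in A, sqErr W (fun ω => W (epoch β W Y i ω) ω) (delivery (threshold β W Y) Y (i + 1))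
      (epoch β W Y (i + 1)) ω ∂P ≤
    P A * ENNReal.ofReal ((∫ ω, max (W (Y 1 ω) ω ^ 2) β ^ 2 ∂P - ∫ ω, W (Y 1 ω) ω ^ 4 ∂P) / 6) := by
  have hs := fun N : ℕ => M.sandwich_threshold (β := β) i N hA
  obtain ⟨i2, e2⟩ := M.setIntegral_displacement hA (f := fun x => max (x ^ 2) β ^ 2) (by fun_prop)
    (fun x => by positivity) (M.integrable_max_displacement_sq β)
  obtain ⟨-, e4⟩ := M.setIntegral_displacement hA (f := fun x => x ^ 4) (by fun_prop)
    (fun x => by positivity) M.integrable_displacement_four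
  simp only [← M.delivery_threshold] at e4 i2 e2
  have hb : ∀ N : ℕ, ∫⁻ ω in A, sqErr W (fun ω => W (epoch β W Y i ω) ω)
      (delivery (threshold β W Y) Y (i + 1)) (fun ω => min (epoch β W Y (i + 1) ω)
        (delivery (threshold β W Y) Y (i + 1) ω + N)) ω ∂P ≤
      P A * ENNReal.ofReal ((∫ ω, max (W (Y 1 ω) ω ^ 2) β ^ 2 ∂P - ∫ ω, W (Y 1 ω) ω ^ 4 ∂P) / 6) := by
    intro N
    have h1 := (hs N).lintegral_sqErr
    -- Until the threshold is hit, the squared deviation stays below max(y², β), uniformly in N.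
    have h2 : ∫ ω in A, (W (min (epoch β W Y (i + 1) ω)
        (delivery (threshold β W Y) Y (i + 1) ω + (N : ℝ≥0))) ω - W (epoch β W Y i ω) ω) ^ 4 ∂P ≤
        ∫ ω in A, max ((W (delivery (threshold β W Y) Y (i + 1) ω) ω -
          W (epoch β W Y i ω) ω) ^ 2) β ^ 2 ∂P := by
      refine integral_mono (hs N).integrable_mid i2 fun ω => ?_
      have := M.sq_stopped_le (β := β) i N ω
      simp only [← M.delivery_threshold] at this
      have h0 := pow_le_pow_left₀ (sq_nonneg _) this 2
      rw [← pow_mul] at h0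
      exact h0
    have e : P A = ENNReal.ofReal (P.real A) := (ofReal_measureReal).symm
    refine h1.trans_le ?_
    rw [e, ← ENNReal.ofReal_mul measureReal_nonneg]
    refine ENNReal.ofReal_le_ofReal ?_
    rw [e4]
    rw [e2] at h2
    linarith
  have hfat := lintegral_liminf_le' (μ := P.restrict A) (u := atTop) (f := fun (N : ℕ) ω =>
    sqErr W (fun ω => W (epoch β W Y i ω) ω) (delivery (threshold β W Y) Y (i + 1))
      (fun ω => min (epoch β W Y (i + 1) ω) (delivery (threshold β W Y) Y (i + 1) ω + N)) ω)
    fun N => ((M.isBM 0).measurable_sqErr (hs N).hσ.measurable (hs N).hτ.measurable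
      (hs N).measurable_a).aemeasurable
  refine le_trans (le_of_eq ?_) (hfat.trans (liminf_le_of_le (by isBoundedDefault) fun b hb' => ?_))
  · refine lintegral_congr fun ω => ?_
    exact ((sqErr_tendsto W _ _ _ ω).liminf_eq).symm
  · obtain ⟨N, hN⟩ := hb'.exists
    exact hN.trans (hb N)

/-- Expected squared error during the transmission that follows the sample `i + 2`. -/
lemma lintegral_transmission (M : Model P W Y) (i : ℕ) {A : Set Ω}
    (hA : MeasurableSet[(M.stops_epoch (β := β) i).measurableSpace] A) :
    ∫⁻ ω in A, sqErr W (fun ω => W (epoch β W Y i ω) ω) (epoch β W Y (i + 1))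
      (delivery (threshold β W Y) Y (i + 2)) ω ∂P =
    P A * ENNReal.ofReal ((∫ ω, max (W (Y 1 ω) ω ^ 2) β ∂P) * (∫ ω, (Y 1 ω : ℝ) ∂P) +
      (∫ ω, (Y 1 ω : ℝ) ^ 2 ∂P) / 2) := by
  have hR := M.stops_epoch (β := β) i
  have hR1 := M.stops_epoch (β := β) (i + 1)
  have hR2 := hR1.history_mono (i + 1).le_succ
  have hmono : ∀ ω, epoch β W Y i ω ≤ epoch β W Y (i + 1) ω := fun ω => le_self_add
  have hle1 : hR.measurableSpace ≤ hR1.measurableSpace :=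
    (hR.past_le_history_mono i.le_succ).trans ((hR.history_mono i.le_succ).past_mono hR1 hmono)
  have hle2 := hR1.past_le_history_mono (i + 1).le_succ
  have ha : Measurable[hR1.measurableSpace] (fun ω => W (epoch β W Y i ω) ω) :=
    ((M.isBM i).measurable_eval_past hR).mono hle1 le_rfl
  have hz : Measurable[hR1.measurableSpace] (fun ω =>
      (W (epoch β W Y (i + 1) ω) ω - W (epoch β W Y i ω) ω) ^ 2) :=
    (((M.isBM (i + 1)).measurable_eval_past hR1).sub ha).pow_const 2
  have h1 := (M.isBM (i + 2)).lintegral_sqErr_later (θ := fun ω => epoch β W Y (i + 1) ω + Y (i + 2) ω)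
    hR2 (hR2.measurable_past.add (M.measurable_first hR2)) (fun ω => le_self_add) (ha.mono hle2 le_rfl)
    (hle2 _ (hle1 _ hA))
  have e0 : delivery (threshold β W Y) Y (i + 2) = fun ω => epoch β W Y (i + 1) ω + Y (i + 2) ω :=
    funext fun ω => M.delivery_threshold (i + 1) ω
  rw [e0, h1]
  have e1 : ∀ ω, ENNReal.ofReal ((W (epoch β W Y (i + 1) ω) ω - W (epoch β W Y i ω) ω) ^ 2 *
      (((epoch β W Y (i + 1) ω + Y (i + 2) ω : ℝ≥0) : ℝ) - epoch β W Y (i + 1) ω) +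
      (((epoch β W Y (i + 1) ω + Y (i + 2) ω : ℝ≥0) : ℝ) - epoch β W Y (i + 1) ω) ^ 2 / 2) =
      ENNReal.ofReal ((W (epoch β W Y (i + 1) ω) ω - W (epoch β W Y i ω) ω) ^ 2) *
        ENNReal.ofReal (Y (i + 1 + 1) ω : ℝ) + 1 * ENNReal.ofReal ((Y (i + 1 + 1) ω : ℝ) ^ 2 / 2) := by
    intro ω
    have : (((epoch β W Y (i + 1) ω + Y (i + 2) ω : ℝ≥0) : ℝ) - epoch β W Y (i + 1) ω) = Y (i + 2) ω := by
      push_cast; ring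
    rw [this, ENNReal.ofReal_add (by positivity) (by positivity), ENNReal.ofReal_mul (by positivity),
      one_mul]
  have hg1 : Measurable (fun y : ℝ≥0 => ENNReal.ofReal (y : ℝ)) := by fun_prop
  have hg2 : Measurable (fun y : ℝ≥0 => ENNReal.ofReal ((y : ℝ) ^ 2 / 2)) := by fun_prop
  have hzm : Measurable (fun ω => (W (epoch β W Y (i + 1) ω) ω - W (epoch β W Y i ω) ω) ^ 2) :=
    hz.mono hR1.measurableSpace_le le_rfl
  have k1 := M.setLIntegral_mul_service hR1 (hle1 _ hA) hz.ennreal_ofReal hg1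
  have k2 := M.setLIntegral_mul_service hR1 (hle1 _ hA) (ξ := fun _ => 1) measurable_const hg2
  have hmx : ∫⁻ ω in A, ENNReal.ofReal
      ((W (epoch β W Y (i + 1) ω) ω - W (epoch β W Y i ω) ω) ^ 2) ∂P =
      P A * ENNReal.ofReal (∫ ω, max (W (Y 1 ω) ω ^ 2) β ∂P) := by
    simp only [M.sq_epoch]
    exact M.setLIntegral_ofReal_displacement hR hA (f := fun x => max (x ^ 2) β) (by fun_prop)
      (fun x => le_max_of_le_left (sq_nonneg x)) (M.integrable_max_displacement β)
  have hA0 : 0 ≤ ∫ ω, max (W (Y 1 ω) ω ^ 2) β ∂P :=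
    integral_nonneg fun ω => le_max_of_le_left (sq_nonneg _)
  have hm0 : 0 ≤ ∫ ω, (Y 1 ω : ℝ) ∂P := integral_nonneg fun ω => NNReal.coe_nonneg _
  have hE0 : 0 ≤ ∫ ω, (Y 1 ω : ℝ) ^ 2 ∂P := integral_nonneg fun ω => sq_nonneg _
  have hpm : Measurable (fun ω => ENNReal.ofReal
      ((W (epoch β W Y (i + 1) ω) ω - W (epoch β W Y i ω) ω) ^ 2) *
        ENNReal.ofReal (Y (i + 1 + 1) ω : ℝ)) :=
    hzm.ennreal_ofReal.mul (hg1.comp (M.measY _))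
  simp only [e1]
  rw [lintegral_add_left hpm, k1, k2, hmx,
    ← ofReal_integral_eq_lintegral_ofReal M.integrable_service (ae_of_all _ fun ω => NNReal.coe_nonneg _),
    ← ofReal_integral_eq_lintegral_ofReal (M.integrable_service_sq.div_const 2)
      (ae_of_all _ fun ω => by simp only [Pi.zero_apply]; positivity), integral_div,
    ENNReal.ofReal_add (mul_nonneg hA0 hm0) (by positivity), ENNReal.ofReal_mul hA0, mul_add, mul_assoc]
  simp

/-- Expected squared error of a full cycle of the threshold policy. -/
lemma lintegral_stageErr_threshold_le (M : Model P W Y) (i : ℕ) (T : ℝ≥0) :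
    ∫⁻ ω, stageErr W Y (threshold β W Y) T (i + 1) ω ∂P ≤ P {ω | epoch β W Y i ω ≤ T} *
      ENNReal.ofReal ((∫ ω, max (W (Y 1 ω) ω ^ 2) β ^ 2 ∂P) / 6 +
        (∫ ω, max (W (Y 1 ω) ω ^ 2) β ∂P) * (∫ ω, (Y 1 ω : ℝ) ∂P)) := by
  have hA : MeasurableSet[(M.stops_epoch (β := β) i).measurableSpace] {ω | epoch β W Y i ω ≤ T} :=
    (M.stops_epoch i).measurable_past measurableSet_Iic
  have hAm : MeasurableSet {ω | epoch β W Y i ω ≤ T} := M.measurable_epoch i measurableSet_Iic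
  have h1 := M.lintegral_waiting_le i hA
  have h2 := M.lintegral_transmission i hA
  have hpt : ∀ ω, stageErr W Y (threshold β W Y) T (i + 1) ω ≤
      {ω | epoch β W Y i ω ≤ T}.indicator (fun ω =>
        sqErr W (fun ω => W (epoch β W Y i ω) ω) (delivery (threshold β W Y) Y (i + 1))
          (epoch β W Y (i + 1)) ω + sqErr W (fun ω => W (epoch β W Y i ω) ω) (epoch β W Y (i + 1))
          (delivery (threshold β W Y) Y (i + 2)) ω) ω := by
    intro ω
    by_cases h : epoch β W Y i ω ≤ T
    · have h' : ω ∈ {ω | epoch β W Y i ω ≤ T} := h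
      rw [Set.indicator_of_mem h', ← sqErr_add W _ (M.delivery_le_epoch (i + 1) ω)
        (le_delivery (threshold β W Y) Y (i + 1) ω)]
      exact stageErr_le_sqErr W Y _ T (i + 1) ω
    · rw [stageErr_eq_zero]
      · exact zero_le
      · exact (not_le.1 h).trans_le (le_delivery (threshold β W Y) Y i ω)
  have hms : Measurable (sqErr W (fun ω => W (epoch β W Y i ω) ω)
      (delivery (threshold β W Y) Y (i + 1)) (epoch β W Y (i + 1))) :=
    (M.isBM 0).measurable_sqErr (M.timed_threshold.measurable_delivery _) (M.measurable_epoch _)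
      ((M.isBM 0).measurable_eval (M.measurable_epoch i))
  have hB := M.integral_displacement_four
  have hBE : 0 ≤ (∫ ω, max (W (Y 1 ω) ω ^ 2) β ^ 2 ∂P - ∫ ω, W (Y 1 ω) ω ^ 4 ∂P) / 6 := by
    have : ∫ ω, W (Y 1 ω) ω ^ 4 ∂P ≤ ∫ ω, max (W (Y 1 ω) ω ^ 2) β ^ 2 ∂P :=
      integral_mono M.integrable_displacement_four (M.integrable_max_displacement_sq β) fun ω => by
        have := pow_le_pow_left₀ (sq_nonneg _) (le_max_left (W (Y 1 ω) ω ^ 2) β) 2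
        rw [← pow_mul] at this
        exact this
    linarith
  refine (lintegral_mono hpt).trans ?_
  rw [lintegral_indicator hAm, lintegral_add_left hms, h2]
  refine (add_le_add_left h1 _).trans (le_of_eq ?_)
  rw [← mul_add, ← ENNReal.ofReal_add hBE ?_, hB]
  · congr 2
    ring
  · have hA0 : 0 ≤ ∫ ω, max (W (Y 1 ω) ω ^ 2) β ∂P :=
      integral_nonneg fun ω => le_max_of_le_left (sq_nonneg _)
    positivity

/-- The stage before the first delivery is the transmission of sample 1 with held value 0. Its error
is bounded in T and disappears in the long-run average. -/
lemma lintegral_stageErr_zero_le (M : Model P W Y) (T : ℝ≥0) :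
    ∫⁻ ω, stageErr W Y (threshold β W Y) T 0 ω ∂P ≤
      ENNReal.ofReal ((∫ ω, (Y 1 ω : ℝ) ^ 2 ∂P) / 2) := by
  have h0 : Stops (history P W Y 1) (fun _ => 0) := stops_const 0
  have h1 := (M.isBM 1).lintegral_sqErr_later (θ := fun ω => Y 1 ω) h0 (M.measurable_first h0)
    (fun ω => zero_le) (a := fun _ => 0) measurable_const MeasurableSet.univ
  simp only [Measure.restrict_univ, M.zero, NNReal.coe_zero, sub_zero, ne_eq, OfNat.ofNat_ne_zero,
    not_false_eq_true, zero_pow, zero_mul, zero_add] at h1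
  refine (lintegral_mono (stageErr_le_sqErr W Y _ T 0)).trans (le_of_eq ?_)
  have e : ∀ ω, sqErr W (held W (threshold β W Y) 0) (delivery (threshold β W Y) Y 0)
      (delivery (threshold β W Y) Y 1) ω = sqErr W (fun _ => 0) (fun _ => 0) (fun ω => Y 1 ω) ω := by
    intro ω
    have := M.delivery_threshold (β := β) 0 ω
    simp only [sqErr, held, if_true, zero_add] at this ⊢
    rw [this]
    simp [delivery, epoch]
  simp only [e]
  rw [h1, ← integral_div, ofReal_integral_eq_lintegral_ofReal (M.integrable_service_sq.div_const 2)
    (ae_of_all _ fun ω => by simp only [Pi.zero_apply]; positivity)]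

end Model

end CycleCost

/-! ### Performance of the threshold policy -/

section UpperBound

variable {Ω : Type*} {mΩ : MeasurableSpace Ω} {P : Measure Ω}
  {W : ℝ≥0 → Ω → ℝ} {Y : ℕ → Ω → ℝ≥0} {β : ℝ}

namespace Model

lemma tendsto_stopped (a b : ℝ≥0) : ∀ᶠ N : ℕ in atTop, min a (b + (N : ℝ≥0)) = a := by
  obtain ⟨n, hn⟩ := exists_nat_ge a
  filter_upwards [eventually_ge_atTop n] with N hN
  exact min_eq_left (hn.trans ((Nat.cast_le.2 hN).trans le_add_self))

lemma sq_first (M : Model P W Y) (β : ℝ) (ω : Ω) :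
    W (epoch β W Y 1 ω) ω ^ 2 = max (W (Y 1 ω) ω ^ 2) β := by
  have := M.sq_epoch (β := β) 0 ω
  simpa [epoch, M.zero] using this

lemma sq_first_stopped_le (M : Model P W Y) (β : ℝ) (N : ℝ≥0) (ω : Ω) :
    W (min (epoch β W Y 1 ω) (Y 1 ω + N)) ω ^ 2 ≤ max (W (Y 1 ω) ω ^ 2) β := by
  have h := M.sq_stopped_le (β := β) 0 N ω
  rw [M.delivery_threshold] at h
  simpa [epoch, M.zero] using h

lemma tendsto_lintegral_min (M : Model P W Y) (β : ℝ) :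
    Tendsto (fun n : ℕ => ∫⁻ ω, (min (epoch β W Y 1 ω) (n : ℝ≥0) : ℝ≥0) ∂P) atTop
      (𝓝 (∫⁻ ω, (epoch β W Y 1 ω : ℝ≥0∞) ∂P)) := by
  have hR := M.measurable_epoch (β := β) 1
  refine lintegral_tendsto_of_tendsto_of_monotone (fun n => Measurable.aemeasurable (by fun_prop))
    (ae_of_all _ fun ω a b hab => ENNReal.coe_le_coe.2 (min_le_min_left _ (Nat.cast_le.2 hab)))
    (ae_of_all _ fun ω => tendsto_const_nhds.congr' ?_)
  filter_upwards [tendsto_stopped (epoch β W Y 1 ω) 0] with n hn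
  rw [zero_add] at hn
  rw [hn]

lemma neverSamplesBusy_threshold (M : Model P W Y) : NeverSamplesBusy P Y (threshold β W Y) :=
  ae_of_all _ fun ω i => M.delivery_le_epoch i ω

variable [IsProbabilityMeasure P]

lemma sandwich_first (M : Model P W Y) (β : ℝ) (N : ℝ≥0) :
    Sandwich P (history P W Y 1) W (Y 1) (fun ω => min (epoch β W Y 1 ω) (Y 1 ω + N))
      (fun ω => Y 1 ω + N) (fun _ => 0) Set.univ N := by
  have h := M.sandwich_threshold (β := β) 0 N (A := Set.univ) MeasurableSet.univ
  have e : delivery (threshold β W Y) Y (0 + 1) = Y 1 := funext fun ω => by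
    rw [M.delivery_threshold]; simp [epoch]
  have e' : (fun ω => W (epoch β W Y 0 ω) ω) = fun _ => 0 := funext fun ω => M.zero ω
  rw [e, e'] at h
  exact h

/-- Lower bound on the mean cycle length, from Wald's second identity. -/
lemma le_lintegral_cycle (M : Model P W Y) (β : ℝ) :
    ENNReal.ofReal (∫ ω, max (W (Y 1 ω) ω ^ 2) β ∂P) ≤ ∫⁻ ω, (epoch β W Y 1 ω : ℝ≥0∞) ∂P := by
  have hs := fun N : ℕ => M.sandwich_first β N
  -- Wald's identity for the cycle stopped N units after the delivery; the stopped cycle is no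
  -- longer than the cycle, and Fatou's lemma restores the value at the epoch.
  have hb : ∀ N : ℕ, ∫⁻ ω, ENNReal.ofReal (W (min (epoch β W Y 1 ω) (Y 1 ω + (N : ℝ≥0))) ω ^ 2) ∂P ≤
      ∫⁻ ω, (epoch β W Y 1 ω : ℝ≥0∞) ∂P := by
    intro N
    have h1 := (hs N).integral_sq
    have i1 := (hs N).integrable_mid_sq
    have i2 := (hs N).integrable_wait
    simp only [sub_zero, Measure.restrict_univ, IntegrableOn] at h1 i1 i2
    rw [← ofReal_integral_eq_lintegral_ofReal i1 (ae_of_all _ fun ω => sq_nonneg _), h1,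
      M.integral_displacement_sq, ← integral_add M.integrable_service i2]
    have i3 : Integrable (fun ω => (Y 1 ω : ℝ) + (((min (epoch β W Y 1 ω) (Y 1 ω + (N : ℝ≥0)) : ℝ≥0) : ℝ)
      - Y 1 ω)) P := M.integrable_service.add i2
    rw [ofReal_integral_eq_lintegral_ofReal i3 (ae_of_all _ fun ω => by
      simp only [Pi.zero_apply, add_sub_cancel]; positivity)]
    refine lintegral_mono fun ω => ?_
    beta_reduce
    rw [add_sub_cancel, ENNReal.ofReal_coe_nnreal]
    exact ENNReal.coe_le_coe.2 (min_le_left _ _)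
  have hfat := lintegral_liminf_le' (μ := P) (u := atTop) (f := fun (N : ℕ) ω =>
      ENNReal.ofReal (W (min (epoch β W Y 1 ω) (Y 1 ω + (N : ℝ≥0))) ω ^ 2))
    fun N => (((M.isBM 0).measurable_eval (hs N).hτ.measurable).pow_const 2).ennreal_ofReal.aemeasurable
  rw [ofReal_integral_eq_lintegral_ofReal (M.integrable_max_displacement β)
    (ae_of_all _ fun ω => le_max_of_le_left (sq_nonneg _))]
  refine le_trans (le_of_eq ?_) (hfat.trans (liminf_le_of_le (by isBoundedDefault) fun b hb' => ?_))
  · refine lintegral_congr fun ω => ?_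
    refine (Tendsto.liminf_eq ?_).symm
    refine tendsto_const_nhds.congr' ?_
    filter_upwards [tendsto_stopped (epoch β W Y 1 ω) (Y 1 ω)] with N hN
    rw [hN, M.sq_first]
  · obtain ⟨N, hN⟩ := hb'.exists
    exact hN.trans (hb N)

/-- For the wait w stopped after N units, `integral_wait_sq` bounds 3E[w²] by E[W_Y⁴] + 6E[z²w]. By
z²w ≤ (9z⁴ + w²)/6 one E[w²] is absorbed, and z⁴ ≤ max(W_Y², β)² makes the bound uniform in N. -/
lemma lintegral_cycle_sq_lt_top (M : Model P W Y) (β : ℝ) :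
    ∫⁻ ω, (epoch β W Y 1 ω : ℝ≥0∞) ^ 2 ∂P < ∞ := by
  obtain ⟨B, hB⟩ : ∃ B, B = ∫ ω, max (W (Y 1 ω) ω ^ 2) β ^ 2 ∂P := ⟨_, rfl⟩
  obtain ⟨E, hE⟩ : ∃ E, E = ∫ ω, W (Y 1 ω) ω ^ 4 ∂P := ⟨_, rfl⟩
  have hs := fun N : ℕ => M.sandwich_first β N
  have hY := M.measY 1
  have hR := M.measurable_epoch (β := β) 1
  have hb : ∀ N : ℕ, ∫⁻ ω, ENNReal.ofReal
      ((((min (epoch β W Y 1 ω) (Y 1 ω + (N : ℝ≥0)) : ℝ≥0) : ℝ) - Y 1 ω) ^ 2) ∂P ≤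
      ENNReal.ofReal ((E + 9 * B) / 2) := by
    intro N
    have h1 := (hs N).integral_wait_sq fun ω => by simp
    have i4 := (hs N).integrable_mid
    have i2 := (hs N).integrable_bounded (g := fun ω =>
      (((min (epoch β W Y 1 ω) (Y 1 ω + (N : ℝ≥0)) : ℝ≥0) : ℝ) - Y 1 ω) ^ 2) (by fun_prop)
      (((N : ℝ≥0) : ℝ) ^ 2) fun ω hω => by
        have := (hs N).bounds hω
        rw [abs_of_nonneg (sq_nonneg _)]
        exact pow_le_pow_left₀ this.2.1 (by linarith [this.1, this.2.2]) 2
    simp only [sub_zero, Measure.restrict_univ, IntegrableOn] at h1 i4 i2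
    have hz4 : ∀ ω, W (min (epoch β W Y 1 ω) (Y 1 ω + (N : ℝ≥0))) ω ^ 4 ≤
        max (W (Y 1 ω) ω ^ 2) β ^ 2 := fun ω => by
      have h0 := pow_le_pow_left₀ (sq_nonneg _) (M.sq_first_stopped_le β N ω) 2
      rwa [← pow_mul] at h0
    have h2 : ∫ ω, W (min (epoch β W Y 1 ω) (Y 1 ω + (N : ℝ≥0))) ω ^ 4 ∂P ≤ B := by
      rw [hB]
      exact integral_mono i4 (M.integrable_max_displacement_sq β) hz4
    have i5 : Integrable (fun ω => 9 / 6 * W (min (epoch β W Y 1 ω) (Y 1 ω + (N : ℝ≥0))) ω ^ 4 +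
        1 / 6 * (((min (epoch β W Y 1 ω) (Y 1 ω + (N : ℝ≥0)) : ℝ≥0) : ℝ) - Y 1 ω) ^ 2) P :=
      (i4.const_mul _).add (i2.const_mul _)
    have h3 := integral_mono_of_nonneg (f := fun ω =>
      W (min (epoch β W Y 1 ω) (Y 1 ω + (N : ℝ≥0))) ω ^ 2 *
        (((min (epoch β W Y 1 ω) (Y 1 ω + (N : ℝ≥0)) : ℝ≥0) : ℝ) - Y 1 ω))
      (ae_of_all P fun ω => mul_nonneg (sq_nonneg _) ((hs N).bounds (Set.mem_univ ω)).2.1) i5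
      (ae_of_all _ fun ω => by
        beta_reduce
        generalize W (min (epoch β W Y 1 ω) (Y 1 ω + (N : ℝ≥0))) ω = z
        nlinarith [sq_nonneg (3 * z ^ 2 -
          (((min (epoch β W Y 1 ω) (Y 1 ω + (N : ℝ≥0)) : ℝ≥0) : ℝ) - Y 1 ω))])
    rw [integral_add (i4.const_mul _) (i2.const_mul _), integral_const_mul, integral_const_mul] at h3
    rw [← ofReal_integral_eq_lintegral_ofReal i2 (ae_of_all _ fun ω => sq_nonneg _)]
    refine ENNReal.ofReal_le_ofReal ?_
    rw [← hE] at h1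
    linarith
  have hfat := lintegral_liminf_le' (μ := P) (u := atTop) (f := fun (N : ℕ) ω => ENNReal.ofReal
      ((((min (epoch β W Y 1 ω) (Y 1 ω + (N : ℝ≥0)) : ℝ≥0) : ℝ) - Y 1 ω) ^ 2))
    fun N => Measurable.aemeasurable (by fun_prop)
  have hw : ∫⁻ ω, ENNReal.ofReal (((epoch β W Y 1 ω : ℝ) - Y 1 ω) ^ 2) ∂P < ∞ := by
    refine lt_of_le_of_lt (le_trans (le_of_eq ?_) (hfat.trans
      (liminf_le_of_le (by isBoundedDefault) fun b hb' => ?_)))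
      (ENNReal.ofReal_lt_top (r := (E + 9 * B) / 2))
    · refine lintegral_congr fun ω => ?_
      refine (Tendsto.liminf_eq ?_).symm
      refine tendsto_const_nhds.congr' ?_
      filter_upwards [tendsto_stopped (epoch β W Y 1 ω) (Y 1 ω)] with N hN
      rw [hN]
    · obtain ⟨N, hN⟩ := hb'.exists
      exact hN.trans (hb N)
  have hpt : ∀ ω, (epoch β W Y 1 ω : ℝ≥0∞) ^ 2 ≤
      2 * ENNReal.ofReal (((epoch β W Y 1 ω : ℝ) - Y 1 ω) ^ 2) + 2 * (Y 1 ω : ℝ≥0∞) ^ 2 := by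
    intro ω
    have e1 : ∀ x : ℝ≥0, (x : ℝ≥0∞) ^ 2 = ENNReal.ofReal ((x : ℝ) ^ 2) := fun x => by
      rw [ENNReal.ofReal_pow (by positivity), ENNReal.ofReal_coe_nnreal]
    have e2 : (2 : ℝ≥0∞) = ENNReal.ofReal 2 := by simp
    rw [e1, e1, e2, ← ENNReal.ofReal_mul (by norm_num), ← ENNReal.ofReal_mul (by norm_num),
      ← ENNReal.ofReal_add (by positivity) (by positivity)]
    refine ENNReal.ofReal_le_ofReal ?_
    nlinarith [sq_nonneg ((epoch β W Y 1 ω : ℝ) - 2 * Y 1 ω)]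
  refine (lintegral_mono hpt).trans_lt ?_
  rw [lintegral_add_left (by fun_prop), lintegral_const_mul _ (by fun_prop),
    lintegral_const_mul _ (by fun_prop)]
  exact ENNReal.add_lt_top.2 ⟨ENNReal.mul_lt_top (by simp) hw, ENNReal.mul_lt_top (by simp) M.sqY⟩

lemma sum_prob_epoch_le (M : Model P W Y) (β : ℝ) (K T : ℝ≥0) :
    (∑' j, P {ω | epoch β W Y j ω ≤ T}) * ∫⁻ ω, (min (epoch β W Y 1 ω) K : ℝ≥0) ∂P ≤ T + K := by
  rw [← ENNReal.tsum_mul_right]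
  refine ENNReal.tsum_le_of_sum_range_le fun n => ?_
  have := (M.renews_cycle (β := β)).sum_prob_le K n T
  simp only [mul_one, ← epoch_eq_sum] at this
  rw [← Finset.sum_mul]
  exact this

lemma lintegral_epoch (M : Model P W Y) (β : ℝ) (n : ℕ) :
    ∫⁻ ω, (epoch β W Y n ω : ℝ≥0∞) ∂P = n * ∫⁻ ω, (epoch β W Y 1 ω : ℝ≥0∞) ∂P := by
  have := (M.renews_cycle (β := β)).lintegral_partialSum n
  simpa only [mul_one, ← epoch_eq_sum] using this

/-- Sample n is taken after n − 1 cycles, so its mean time divided by n tends to the mean cycle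
length, which is at least A. -/
lemma frequencyConstraint_threshold (M : Model P W Y) {fmax : ℝ≥0∞}
    (h : 1 / fmax ≤ ENNReal.ofReal (∫ ω, max (W (Y 1 ω) ω ^ 2) β ∂P)) :
    FrequencyConstraint P fmax (threshold β W Y) := by
  obtain ⟨μ, hμ⟩ : ∃ μ, μ = ∫⁻ ω, (epoch β W Y 1 ω : ℝ≥0∞) ∂P := ⟨_, rfl⟩
  have h1 : Tendsto (fun n : ℕ => (∫⁻ ω, (threshold β W Y n ω : ℝ≥0∞) ∂P) / (n : ℝ≥0∞)) atTop
      (𝓝 μ) := by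
    have h2 : Tendsto (fun n : ℕ => (1 - (n : ℝ≥0∞)⁻¹) * μ) atTop (𝓝 ((1 - 0) * μ)) :=
      ENNReal.Tendsto.mul_const (ENNReal.Tendsto.sub tendsto_const_nhds
        ENNReal.tendsto_inv_nat_nhds_zero (Or.inl ENNReal.one_ne_top)) (Or.inl (by simp))
    rw [tsub_zero, one_mul] at h2
    refine h2.congr' ?_
    filter_upwards [eventually_ge_atTop 1] with n hn
    have hn0 : (n : ℝ≥0∞) ≠ 0 := by simp; omega
    simp only [threshold]
    have e : (1 - (n : ℝ≥0∞)⁻¹) = ((n : ℝ≥0∞) - 1) * (n : ℝ≥0∞)⁻¹ := by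
      rw [ENNReal.sub_mul (fun _ _ => by simp [hn0]), ENNReal.mul_inv_cancel hn0 (by simp), one_mul]
    rw [M.lintegral_epoch, ← hμ, ENNReal.natCast_sub, Nat.cast_one, div_eq_mul_inv, mul_right_comm, e]
  unfold FrequencyConstraint
  rw [h1.liminf_eq]
  exact h.trans (hμ ▸ M.le_lintegral_cycle β)

variable (hβ : 0 < β)
include hβ

lemma max_displacement_pos (M : Model P W Y) : 0 < ∫ ω, max (W (Y 1 ω) ω ^ 2) β ∂P := by
  have := integral_mono (integrable_const β) (M.integrable_max_displacement β)
    fun ω => le_max_right (W (Y 1 ω) ω ^ 2) β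
  simp only [integral_const, probReal_univ, smul_eq_mul, one_mul] at this
  exact hβ.trans_le this

lemma lintegral_epoch_one_pos (M : Model P W Y) : 0 < ∫⁻ ω, (epoch β W Y 1 ω : ℝ≥0∞) ∂P :=
  (ENNReal.ofReal_pos.2 (M.max_displacement_pos hβ)).trans_le (M.le_lintegral_cycle β)

/-- The sampling times of the threshold policy tend to infinity. -/
lemma ae_exists_lt_epoch (M : Model P W Y) :
    ∀ᵐ ω ∂P, ∀ t : ℝ≥0, ∃ i, t < epoch β W Y i ω := by
  have h1 : ∀ n : ℕ, ∀ᵐ ω ∂P, ∃ i, (n : ℝ≥0) < epoch β W Y i ω := by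
    intro n
    obtain ⟨k, hk⟩ := ((M.tendsto_lintegral_min β).eventually
      (lt_mem_nhds (M.lintegral_epoch_one_pos hβ))).exists
    have h2 := M.sum_prob_epoch_le β k n
    -- The expected number of epochs up to n is finite, so the probability that epoch j precedes n
    -- tends to zero in j.
    have h3 : ∑' j, P {ω | epoch β W Y j ω ≤ n} ≠ ∞ := by
      intro h
      rw [h, ENNReal.top_mul hk.ne'] at h2
      exact absurd h2 (not_le.2 (by simp))
    have h4 := ENNReal.tendsto_atTop_zero_of_tsum_ne_top h3
    rw [ae_iff]
    refine le_antisymm (ge_of_tendsto' h4 fun j => measure_mono fun ω hω => ?_) zero_le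
    have hω : ¬ ∃ i, (n : ℝ≥0) < epoch β W Y i ω := hω
    push Not at hω
    exact hω j
  filter_upwards [ae_all_iff.2 h1] with ω hω t
  obtain ⟨n, hn⟩ := exists_nat_ge t
  obtain ⟨i, hi⟩ := hω n
  exact ⟨i, hn.trans_lt hi⟩

/-- The deliveries tend to infinity almost surely, so every time lies in a stage and `errSq` is the
true squared error. -/
lemma totalErr_threshold (M : Model P W Y) (T : ℝ) :
    ∫⁻ ω, (∫⁻ t : ℝ in Set.Icc 0 T, ENNReal.ofReal
      ((W t.toNNReal ω - estimate W Y (threshold β W Y) t.toNNReal ω) ^ 2)) ∂P ≤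
    totalErr P W Y (threshold β W Y) T.toNNReal := by
  unfold totalErr
  refine lintegral_mono_ae ?_
  filter_upwards [M.ae_exists_lt_epoch hβ] with ω hω
  refine lintegral_mono' (Measure.restrict_mono_set _
    (Set.Icc_subset_Icc_right (Real.le_coe_toNNReal T))) fun t => ?_
  beta_reduce
  have h : ∃ i, t.toNNReal < delivery (threshold β W Y) Y i ω := by
    obtain ⟨i, hi⟩ := hω t.toNNReal
    exact ⟨i + 1, hi.trans_le (le_delivery (threshold β W Y) Y i ω)⟩
  obtain ⟨i, hi⟩ : ∃ i, Nat.find h = i + 1 := by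
    refine Nat.exists_eq_succ_of_ne_zero fun h0 => ?_
    have := Nat.find_spec h
    rw [h0] at this
    exact absurd this (not_lt.2 zero_le)
  have h1 := Nat.find_spec h
  rw [hi] at h1
  have h2 : delivery (threshold β W Y) Y i ω ≤ t.toNNReal := not_lt.1 (Nat.find_min h (by omega))
  exact (errSq_eq_of_mem M.zero (rfl : threshold β W Y 0 ω = 0) ⟨h2, h1⟩).ge

/-- The mean square error of the threshold policy. -/
lemma mse_threshold_le (M : Model P W Y) {A B : ℝ}
    (hA : A = ∫ ω, max (W (Y 1 ω) ω ^ 2) β ∂P) (hB : B = ∫ ω, max (W (Y 1 ω) ω ^ 2) β ^ 2 ∂P) :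
    mse P W Y (threshold β W Y) ≤ ENNReal.ofReal (∫ ω, (Y 1 ω : ℝ) ∂P + B / (6 * A)) := by
  obtain ⟨m, hm⟩ : ∃ m, m = ∫ ω, (Y 1 ω : ℝ) ∂P := ⟨_, rfl⟩
  obtain ⟨c, hc⟩ : ∃ c, c = ENNReal.ofReal (B / 6 + A * m) := ⟨_, rfl⟩
  obtain ⟨d, hd⟩ : ∃ d, d = ENNReal.ofReal ((∫ ω, (Y 1 ω : ℝ) ^ 2 ∂P) / 2) := ⟨_, rfl⟩
  obtain ⟨μ, hμ⟩ : ∃ μ : ℕ → ℝ≥0∞, μ = fun n : ℕ =>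
    ∫⁻ ω, (min (epoch β W Y 1 ω) (n : ℝ≥0) : ℝ≥0) ∂P := ⟨_, rfl⟩
  have hμt := M.tendsto_lintegral_min β
  have hA0 : 0 < A := hA ▸ M.max_displacement_pos hβ
  have htot : ∀ T, totalErr P W Y (threshold β W Y) T ≤
      d + c * ∑' j, P {ω | epoch β W Y j ω ≤ T} := by
    intro T
    rw [totalErr_eq_tsum M.cont M.measW (fun i => M.timed_threshold.measurable_delivery i)
      (fun i => M.timed_threshold.measurable_held' M i), tsum_eq_zero_add' ENNReal.summable]
    refine add_le_add (hd ▸ M.lintegral_stageErr_zero_le T) ?_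
    rw [← ENNReal.tsum_mul_left]
    refine ENNReal.tsum_le_tsum fun i => ?_
    refine (M.lintegral_stageErr_threshold_le i T).trans (le_of_eq ?_)
    rw [← hA, ← hB, ← hm, ← hc, mul_comm]
  -- The renewal bound with cycles truncated at n controls the number of epochs by (T + n)/μ n;
  -- first T tends to infinity, then n.
  have hbound : ∀ n : ℕ, 0 < μ n → mse P W Y (threshold β W Y) ≤ c / μ n := by
    intro n hn
    have h1 : ∀ T : ℝ, 0 < T → (∫⁻ ω, (∫⁻ t : ℝ in Set.Icc 0 T, ENNReal.ofReal
        ((W t.toNNReal ω - estimate W Y (threshold β W Y) t.toNNReal ω) ^ 2)) ∂P) / ENNReal.ofReal T ≤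
        (d + c * (n / μ n)) / ENNReal.ofReal T + c / μ n := by
      intro T hT
      have hT0 : ENNReal.ofReal T ≠ 0 := (ENNReal.ofReal_pos.2 hT).ne'
      have h2 := M.sum_prob_epoch_le β n T.toNNReal
      have h3 : ∑' j, P {ω | epoch β W Y j ω ≤ T.toNNReal} ≤ (ENNReal.ofReal T + n) / μ n := by
        rw [ENNReal.le_div_iff_mul_le (Or.inl hn.ne') (Or.inr (by simp))]
        rw [hμ]
        exact h2
      have h4 := (M.totalErr_threshold hβ T).trans ((htot T.toNNReal).trans
        (add_le_add_right (mul_le_mul_right h3 c) d))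
      refine (ENNReal.div_le_div_right h4 _).trans (le_of_eq ?_)
      have h5 : d + c * ((ENNReal.ofReal T + n) / μ n) =
          (d + c * (n / μ n)) + (c / μ n) * ENNReal.ofReal T := by
        simp only [div_eq_mul_inv]; ring
      rw [h5, ENNReal.add_div, ENNReal.mul_div_cancel_right hT0 ENNReal.ofReal_ne_top]
    have h6 : Tendsto (fun T : ℝ => (d + c * (n / μ n)) / ENNReal.ofReal T + c / μ n) atTop
        (𝓝 (c / μ n)) := by
      have hfin : d + c * (n / μ n) ≠ ∞ := by
        rw [hd, hc]
        exact ENNReal.add_ne_top.2 ⟨ENNReal.ofReal_ne_top, ENNReal.mul_ne_top ENNReal.ofReal_ne_top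
          (ENNReal.div_ne_top (by simp) hn.ne')⟩
      have := (ENNReal.Tendsto.const_div (a := d + c * (n / μ n)) ENNReal.tendsto_ofReal_atTop
        (Or.inr hfin)).add_const (c / μ n)
      simpa using this
    unfold mse
    rw [← h6.limsup_eq]
    refine limsup_le_limsup ?_
    filter_upwards [eventually_gt_atTop 0] with T hT using h1 T hT
  have hlim : Tendsto (fun n => c / μ n) atTop (𝓝 (c / ∫⁻ ω, (epoch β W Y 1 ω : ℝ≥0∞) ∂P)) := by
    rw [hμ]
    exact ENNReal.Tendsto.const_div hμt (Or.inr (hc ▸ ENNReal.ofReal_ne_top))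
  have hev : ∀ᶠ n in atTop, mse P W Y (threshold β W Y) ≤ c / μ n := by
    filter_upwards [hμt.eventually (lt_mem_nhds (M.lintegral_epoch_one_pos hβ))] with n hn
    exact hbound n (by rw [hμ]; exact hn)
  refine (ge_of_tendsto hlim hev).trans ((ENNReal.div_le_div_left (M.le_lintegral_cycle β) _).trans
    (le_of_eq ?_))
  rw [← hA, hc, ← ENNReal.ofReal_div_of_pos hA0, ← hm]
  congr 1
  field_simp
  ring

lemma isPolicy_threshold (M : Model P W Y) : IsPolicy P W Y (threshold β W Y) where
  measurable i := M.measurable_epoch (i - 1)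
  zero := ae_of_all _ fun _ => rfl
  mono := ae_of_all _ fun ω i => epoch_mono β W Y ω (Nat.sub_le_sub_right i.le_succ 1)
  causal := M.isCausal_threshold
  regenerative := by
    have e : ∀ ω, cycle β W Y 0 ω = epoch β W Y 1 ω := fun ω => by simp [epoch_succ, show epoch β W Y 0 ω = 0 from rfl]
    refine M.isRegenerative_threshold ?_ ?_
    · simp only [e]
      rw [pos_iff_ne_zero]
      intro h
      have hm := (M.measurable_epoch (β := β) 1).coe_nnreal_ennreal
      rw [lintegral_eq_zero_iff (hm.pow_const 2)] at h
      refine (M.lintegral_epoch_one_pos hβ).ne' ((lintegral_eq_zero_iff hm).2 ?_)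
      filter_upwards [h] with ω hω
      simpa using hω
    · simp only [e]
      exact M.lintegral_cycle_sq_lt_top β

end Model

end UpperBound

/-! ### Null sets and a regular version of the signal -/

section Modification

variable {Ω : Type*}

/-- The sets that coincide, off `N`, with a set of `m`. -/
@[reducible] def modOff (N : Set Ω) (m : MeasurableSpace Ω) : MeasurableSpace Ω :=
  (m.comap (Subtype.val : (Nᶜ : Set Ω) → Ω)).map Subtype.val

lemma measurableSet_modOff {N : Set Ω} {m : MeasurableSpace Ω} {A : Set Ω} :
    MeasurableSet[modOff N m] A ↔ ∃ B, MeasurableSet[m] B ∧ ∀ ω ∉ N, (ω ∈ A ↔ ω ∈ B) := by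
  constructor
  · rintro ⟨B, hB, h⟩
    refine ⟨B, hB, fun ω hω => ?_⟩
    exact (Set.ext_iff.1 h ⟨ω, hω⟩).symm
  · rintro ⟨B, hB, h⟩
    exact ⟨B, hB, Set.ext fun ω => (h ω.1 ω.2).symm⟩

lemma info_le_modOff {W W' : ℝ≥0 → Ω → ℝ} {N : Set Ω} (h : ∀ ω ∉ N, ∀ t, W t ω = W' t ω)
    (S Y : ℕ → Ω → ℝ≥0) (i : ℕ) (t : ℝ≥0) : info W S Y i t ≤ modOff N (info W' S Y i t) := by
  refine sup_le (sup_le (iSup₂_le fun s hs => ?_) ?_) ?_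
  · rintro _ ⟨C, hC, rfl⟩
    refine measurableSet_modOff.2 ⟨W' s ⁻¹' C, measurable_info W' S Y i hs hC, fun ω hω => ?_⟩
    rw [Set.mem_preimage, Set.mem_preimage, h ω hω]
  · refine MeasurableSpace.generateFrom_le ?_
    rintro _ ⟨s, hs, rfl⟩
    exact measurableSet_modOff.2 ⟨_, measurableSet_info_busy W' S Y i hs, fun _ _ => Iff.rfl⟩
  · refine MeasurableSpace.generateFrom_le ?_
    rintro _ ⟨s, hs, j, hj, rfl⟩
    exact measurableSet_modOff.2 ⟨_, measurableSet_info_sampled W' S Y hj hs, fun _ _ => Iff.rfl⟩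

/-- Causality must survive a change of the signal on a null set that need not belong to the
information itself. -/
lemma infoPlus_le_modOff {W W' : ℝ≥0 → Ω → ℝ} {N : Set Ω} (h : ∀ ω ∉ N, ∀ t, W t ω = W' t ω)
    (S Y : ℕ → Ω → ℝ≥0) (i : ℕ) (t : ℝ≥0) :
    infoPlus W S Y i t ≤ modOff N (infoPlus W' S Y i t) := by
  intro A hA
  obtain ⟨v, hanti, hv, hlim⟩ := exists_seq_strictAnti_tendsto t
  have hA' : ∀ n, MeasurableSet[info W S Y i (v n)] A := fun n =>
    (iInf₂_le (f := fun u (_ : u > t) => info W S Y i u) (v n) (hv n)) _ hA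
  choose B hB hAB using fun n => measurableSet_modOff.1 (info_le_modOff h S Y i (v n) _ (hA' n))
  -- Each time v n has its own representative B n. Their upper limit is determined by any tail of
  -- the sequence, hence known at every u > t, and off N it equals A.
  refine measurableSet_modOff.2 ⟨⋂ m, ⋃ n, B (m + n), ?_, fun ω hω => ?_⟩
  · simp only [MeasurableSpace.measurableSet_iInf]
    intro u hu
    obtain ⟨k, hk⟩ := (hlim.eventually (gt_mem_nhds hu)).exists
    have e : ⋂ m, ⋃ n, B (m + n) = ⋂ m, ⋃ n, B (k + m + n) := by
      ext ω
      simp only [Set.mem_iInter, Set.mem_iUnion]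
      constructor
      · exact fun h m => h (k + m)
      · intro h m
        obtain ⟨n, hn⟩ := h m
        exact ⟨k + n, by rwa [show m + (k + n) = k + m + n by ring]⟩
    rw [e]
    refine MeasurableSet.iInter fun m => MeasurableSet.iUnion fun n => ?_
    exact info_mono W' S Y i ((hanti.antitone (by omega)).trans hk.le) _ (hB (k + m + n))
  · simp only [Set.mem_iInter, Set.mem_iUnion, ← hAB _ ω hω]
    exact ⟨fun h _ => ⟨0, h⟩, fun h => (h 0).elim fun _ h => h⟩

variable {mΩ : MeasurableSpace Ω} {P : Measure Ω} {W W' : ℝ≥0 → Ω → ℝ} {S Y : ℕ → Ω → ℝ≥0}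

lemma IsCausal.congr {N : Set Ω} (hN : P N = 0) (h : ∀ ω ∉ N, ∀ t, W t ω = W' t ω)
    (hS : IsCausal P W Y S) : IsCausal P W' Y S := by
  intro i t
  obtain ⟨A, hA, hA'⟩ := hS i t
  obtain ⟨B, hB, hAB⟩ := measurableSet_modOff.1 (infoPlus_le_modOff h S Y i t _ hA)
  refine ⟨B, hB, hA'.trans ?_⟩
  have : ∀ᵐ ω ∂P, ω ∉ N := measure_eq_zero_iff_ae_notMem.1 hN
  filter_upwards [this] with ω hω
  exact propext (hAB ω hω)

lemma IsPolicy.congr {N : Set Ω} (hN : P N = 0) (h : ∀ ω ∉ N, ∀ t, W t ω = W' t ω)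
    (hS : IsPolicy P W Y S) : IsPolicy P W' Y S :=
  ⟨hS.measurable, hS.zero, hS.mono, hS.causal.congr hN h, hS.regenerative⟩

lemma mse_congr {N : Set Ω} (hN : P N = 0) (h : ∀ ω ∉ N, ∀ t, W t ω = W' t ω) :
    mse P W Y S = mse P W' Y S := by
  unfold mse
  have hN' : ∀ᵐ ω ∂P, ω ∉ N := measure_eq_zero_iff_ae_notMem.1 hN
  congr 1
  funext T
  congr 1
  refine lintegral_congr_ae ?_
  filter_upwards [hN'] with ω hω
  simp only [estimate, h ω hω]

/-- Brownian motion is almost surely unbounded. -/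
lemma ae_unbounded_of_isPreBrownianReal [IsProbabilityMeasure P] (hW : IsPreBrownianReal W P) :
    ∀ᵐ ω ∂P, ∀ c, ∃ t, c < |W t ω| := by
  have h1 : ∀ k : ℕ, ∀ᵐ ω ∂P, ∃ t, (k : ℝ) < |W t ω| := by
    intro k
    -- A path bounded by k stays in [−k, k] at time n + 1, which has probability at most 2k times
    -- the maximal density of the Gaussian of variance n + 1.
    have h2 : ∀ n : ℕ, P {ω | ¬ ∃ t, (k : ℝ) < |W t ω|} ≤
        ENNReal.ofReal (2 * k * (√(2 * Real.pi * (n + 1 : ℕ)))⁻¹) := by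
      intro n
      have hl := hW.hasLaw_eval (n + 1 : ℕ)
      have hv : ((n + 1 : ℕ) : ℝ≥0) ≠ 0 := Nat.cast_ne_zero.2 n.succ_ne_zero
      calc P {ω | ¬ ∃ t, (k : ℝ) < |W t ω|} ≤ P (W (n + 1 : ℕ) ⁻¹' Set.Icc (-k : ℝ) k) := by
            refine measure_mono fun ω hω => ?_
            have hω : ¬ ∃ t, (k : ℝ) < |W t ω| := hω
            push Not at hω
            exact abs_le.1 (hω _)
        _ = gaussianReal 0 (n + 1 : ℕ) (Set.Icc (-k : ℝ) k) := by
            rw [← hl.map_eq, Measure.map_apply_of_aemeasurable hl.aemeasurable measurableSet_Icc]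
        _ = ∫⁻ x in Set.Icc (-k : ℝ) k, gaussianPDF 0 (n + 1 : ℕ) x := gaussianReal_apply _ hv _
        _ ≤ ∫⁻ x in Set.Icc (-k : ℝ) k, ENNReal.ofReal ((√(2 * Real.pi * (n + 1 : ℕ)))⁻¹) := by
            refine lintegral_mono fun x => ENNReal.ofReal_le_ofReal ?_
            unfold gaussianPDFReal
            refine mul_le_of_le_one_right (by positivity) (Real.exp_le_one_iff.2 ?_)
            rw [neg_div]
            exact neg_nonpos.2 (by positivity)
        _ = _ := by
            rw [setLIntegral_const, Real.volume_Icc, ← ENNReal.ofReal_mul (by positivity)]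
            congr 1; ring
    have h3 : Tendsto (fun n : ℕ => ENNReal.ofReal (2 * k * (√(2 * Real.pi * (n + 1 : ℕ)))⁻¹)) atTop
        (𝓝 0) := by
      have : Tendsto (fun n : ℕ => 2 * (k : ℝ) * (√(2 * Real.pi * (n + 1 : ℕ)))⁻¹) atTop (𝓝 (2 * k * 0)) := by
        refine Tendsto.const_mul _ (tendsto_inv_atTop_zero.comp (Real.tendsto_sqrt_atTop.comp
          (Tendsto.const_mul_atTop (by positivity) ?_)))
        exact tendsto_natCast_atTop_atTop.comp (tendsto_add_atTop_nat 1)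
      simpa using ENNReal.tendsto_ofReal this
    exact ae_iff.2 (le_antisymm (ge_of_tendsto' h3 h2) zero_le)
  filter_upwards [ae_all_iff.2 h1] with ω hω c
  obtain ⟨k, hk⟩ := exists_nat_ge c
  obtain ⟨t, ht⟩ := hω k
  exact ⟨t, hk.trans_lt ht⟩

/-- A Wiener process coincides almost surely with one all of whose paths are regular. -/
lemma exists_model [IsProbabilityMeasure P] (hWmeas : ∀ t, Measurable (W t)) (hW : IsBrownianReal W P)
    (hYmeas : ∀ i, Measurable (Y i)) (hYindep : iIndepFun (fun i => Y (i + 1)) P)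
    (hYident : ∀ i, IdentDistrib (Y (i + 1)) (Y 1) P P)
    (hYsq : ∫⁻ ω, (Y 1 ω : ℝ≥0∞) ^ 2 ∂P < ∞)
    (hWY : IndepFun (fun ω t => W t ω) (fun ω i => Y (i + 1) ω) P) :
    ∃ (W' : ℝ≥0 → Ω → ℝ) (N : Set Ω), P N = 0 ∧ (∀ ω ∉ N, ∀ t, W t ω = W' t ω) ∧ Model P W' Y := by
  classical
  have hgood : ∀ᵐ ω ∂P, Continuous (W · ω) ∧ W 0 ω = 0 ∧ ∀ c, ∃ t, c < |W t ω| := by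
    filter_upwards [hW.cont, hW.toIsPreBrownianReal.eval_zero_ae_eq_zero,
      ae_unbounded_of_isPreBrownianReal hW.toIsPreBrownianReal] with ω h1 h2 h3 using ⟨h1, h2, h3⟩
  obtain ⟨N, hsub, hNm, hN⟩ := exists_measurable_superset_of_null (ae_iff.1 hgood)
  have hg : ∀ ω ∉ N, Continuous (W · ω) ∧ W 0 ω = 0 ∧ ∀ c, ∃ t, c < |W t ω| := fun ω hω => by
    by_contra h
    exact hω (hsub h)
  -- On the exceptional set the path is replaced by the identity, which is continuous, unbounded and
  -- starts at 0.
  obtain ⟨W', hW'⟩ : ∃ W' : ℝ≥0 → Ω → ℝ, W' = fun (t : ℝ≥0) ω => if ω ∈ N then (t : ℝ) else W t ω := ⟨_, rfl⟩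
  have hin : ∀ ω ∈ N, ∀ t, W' t ω = t := fun ω hω t => by rw [hW']; exact if_pos hω
  have hout : ∀ ω ∉ N, ∀ t, W t ω = W' t ω := fun ω hω t => by rw [hW']; exact (if_neg hω).symm
  have hN' : ∀ᵐ ω ∂P, ω ∉ N := measure_eq_zero_iff_ae_notMem.1 hN
  refine ⟨W', N, hN, hout, ?_⟩
  exact
    { cont := fun ω => by
        by_cases h : ω ∈ N
        · simp only [hin ω h]; exact NNReal.continuous_coe
        · simp only [← hout ω h]; exact (hg ω h).1
      zero := fun ω => by
        by_cases h : ω ∈ N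
        · simp [hin ω h]
        · rw [← hout ω h]; exact (hg ω h).2.1
      unbounded := fun ω c => by
        by_cases h : ω ∈ N
        · obtain ⟨n, hn⟩ := exists_nat_gt c
          exact ⟨n, by simp only [hin ω h]; simpa using hn⟩
        · simp only [← hout ω h]; exact (hg ω h).2.2 c
      measW := fun t => by
        rw [hW']
        exact Measurable.ite hNm measurable_const (hWmeas t)
      pre := hW.toIsPreBrownianReal.congr fun t => by
        filter_upwards [hN'] with ω hω using hout ω hω t
      measY := hYmeas
      indepY := hYindep
      identY := hYident
      sqY := hYsq
      indepWY := hWY.congr (by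
        filter_upwards [hN'] with ω hω
        exact funext fun t => hout ω hω t) (ae_eq_refl _) }

/-- If the transmission times vanish, no policy ever samples while the channel is busy. -/
lemma neverSamplesBusy_of_instantaneous (hYident : ∀ i, IdentDistrib (Y (i + 1)) (Y 1) P P)
    (hY : ∀ᵐ ω ∂P, Y 1 ω = 0) (hS : IsPolicy P W Y S) : NeverSamplesBusy P Y S := by
  have h1 : ∀ i, ∀ᵐ ω ∂P, Y (i + 1) ω = 0 := fun i =>
    (hYident i).symm.ae_snd (p := fun y => y = 0) (measurableSet_singleton 0) hY
  filter_upwards [ae_all_iff.2 h1, hS.zero, hS.mono] with ω hω h0 hm i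
  have hD : ∀ i, delivery S Y i ω = S i ω := by
    intro i
    induction i with
    | zero => exact h0.symm
    | succ i ih => rw [delivery, ih, hω, add_zero, max_eq_left (hm i)]
  rw [hD]
  exact hm i

end Modification

/-! ### Optimality of a threshold policy -/

namespace Model

variable {Ω : Type*} {mΩ : MeasurableSpace Ω} {P : Measure Ω} [IsProbabilityMeasure P]
  {W : ℝ≥0 → Ω → ℝ} {Y : ℕ → Ω → ℝ≥0}

/-- Some threshold policy is optimal. -/
lemma exists_optimal (M : Model P W Y) (hY : ¬ ∀ᵐ ω ∂P, Y 1 ω = 0) {fmax : ℝ≥0∞}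
    (hfmax : 0 < fmax) :
    ∃ S' : ℕ → Ω → ℝ≥0, IsPolicy P W Y S' ∧ FrequencyConstraint P fmax S' ∧
      NeverSamplesBusy P Y S' ∧ ∀ S, IsPolicy P W Y S → FrequencyConstraint P fmax S →
        mse P W Y S' ≤ mse P W Y S := by
  -- This moment equals 3E[Y²]; its positivity makes the threshold strictly positive.
  have hpos : 0 < ∫ ω, (W (Y 1 ω) ω ^ 2) ^ 2 ∂P := by
    simp only [← pow_mul, Nat.reduceMul]
    rw [M.integral_displacement_four]
    refine mul_pos (by norm_num) ((integral_pos_iff_support_of_nonneg (fun ω => sq_nonneg _)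
      M.integrable_service_sq).2 (pos_iff_ne_zero.2 fun h => hY (ae_iff.2 ?_)))
    convert h using 2
    ext ω
    simp
  have hint : Integrable (fun ω => (W (Y 1 ω) ω ^ 2) ^ 2) P := by
    simp only [← pow_mul, Nat.reduceMul]
    exact M.integrable_displacement_four
  obtain ⟨β, hβ, h1, h2, h3⟩ := exists_threshold (M.measurable_displacement.pow_const 2)
    (fun ω => sq_nonneg _) hint hpos (1 / fmax).toReal
  have hfr : 1 / fmax ≤ ENNReal.ofReal (∫ ω, max (W (Y 1 ω) ω ^ 2) β ∂P) := by
    rw [← ENNReal.ofReal_toReal (a := 1 / fmax) (by simp [hfmax.ne'])]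
    exact ENNReal.ofReal_le_ofReal h1
  refine ⟨threshold β W Y, M.isPolicy_threshold hβ, M.frequencyConstraint_threshold hfr,
    M.neverSamplesBusy_threshold, fun S hS hf => ?_⟩
  exact (M.mse_threshold_le hβ rfl rfl).trans
    (le_mse M hS hfmax hf hβ rfl rfl h2 h3 (M.max_displacement_pos hβ))

end Model

end RemoteEstimation

theorem lemma1 {Ω : Type*} [MeasurableSpace Ω] (P : Measure Ω) [IsProbabilityMeasure P]
    (W : ℝ≥0 → Ω → ℝ) (hWmeas : ∀ t, Measurable (W t)) (hW : IsBrownianReal W P)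
    (Y : ℕ → Ω → ℝ≥0) (hYmeas : ∀ i, Measurable (Y i))
    (hYindep : iIndepFun (fun i => Y (i + 1)) P)
    (hYident : ∀ i, IdentDistrib (Y (i + 1)) (Y 1) P P)
    (hYsq : ∫⁻ ω, (Y 1 ω : ℝ≥0∞) ^ 2 ∂P < ∞)
    (hWY : IndepFun (fun ω t => W t ω) (fun ω i => Y (i + 1) ω) P)
    (fmax : ℝ≥0∞) (hfmax : 0 < fmax)
    (S : ℕ → Ω → ℝ≥0) (hS : RemoteEstimation.IsPolicy P W Y S)
    (hSfreq : RemoteEstimation.FrequencyConstraint P fmax S) :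
    ∃ S' : ℕ → Ω → ℝ≥0,
      RemoteEstimation.IsPolicy P W Y S' ∧
      RemoteEstimation.FrequencyConstraint P fmax S' ∧
      RemoteEstimation.NeverSamplesBusy P Y S' ∧
      RemoteEstimation.mse P W Y S' ≤ RemoteEstimation.mse P W Y S := by
  -- If transmissions are instantaneous, the given policy already qualifies; the threshold
  -- construction requires E[Y²] > 0.
  by_cases hY : ∀ᵐ ω ∂P, Y 1 ω = 0
  · exact ⟨S, hS, hSfreq, RemoteEstimation.neverSamplesBusy_of_instantaneous hYident hY hS, le_rfl⟩
  obtain ⟨W', N, hN, hWW', M⟩ :=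
    RemoteEstimation.exists_model hWmeas hW hYmeas hYindep hYident hYsq hWY
  have hWW : ∀ ω ∉ N, ∀ t, W' t ω = W t ω := fun ω hω t => (hWW' ω hω t).symm
  obtain ⟨S', h1, h2, h3, h4⟩ := M.exists_optimal hY hfmax
  refine ⟨S', h1.congr hN hWW, h2, h3, ?_⟩
  rw [RemoteEstimation.mse_congr hN hWW', RemoteEstimation.mse_congr hN hWW']
  exact h4 S (hS.congr hN hWW') hSfreq
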